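/- Let $d\in\{2,3\}$, let $\Omega\subset\mathbb R^d$ be a bounded connected open set with Lipschitz boundary, and let $k\ge 1$ be an integer. **Meshes.** Let $\mathcal T_h$ be a finite partition of $\Omega$ into closed polygons ($d=2$) or polyhedra ($d=3$) with connected interior and flat edges/faces. Write $h_T$, $h_e$ for the diameters of an element $T$ and an edge/face $e$, $h=\max_T h_T$, and $\mathbf n$ for the outward unit normal on $\partial T$. The mesh is shape regular if, with positive constants $\rho_v,\rho_e,\kappa,\sigma_*,\gamma_*,\rho_S$, an angle $\theta_0<\pi/2$ and integers $m_*,N$, for every element $T$ and every edge/face $e\subset\partial T$: $\rho_v h_T^d\le|T|$; $\rho_e h_e^{d-1}\le|e|$; $\kappa h_T\le h_e$; $T$ has at most $m_*$ edges/faces; there is a pyramid contained in $T$ with base $e$, apex $A_e\in T$ and height at least $\sigma_*h_T$, such that the angle between $x-A_e$ and $\mathbf n|_e$ is at most $\theta_0$ for all $x\in e$; and $T$ is contained in a simplex $S(T)$ of diameter at most $\gamma_*h_T$ that contains a ball of radius $\rho_S\,\mathrm{diam}\,S(T)$, where each $S(T)$ meets at most $N$ of the simplices $S(T')$, $T'\in\mathcal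 T_h$. **Discrete spaces.** $W_h$ consists of the pairs $v=\{v_0,v_b\}$ with $v_0|_T\in P_k(T)$ on each element and a single-valued $v_b|_e\in P_k(e)$ on each edge/face. On each $T$ the discrete weak gradient $\nabla_w v\in[P_k(T)]^d$ is defined by $$(\nabla_w v,\boldsymbol\psi)_T=-(v_0,\nabla\cdot\boldsymbol\psi)_T+\langle v_b,\boldsymbol\psi\cdot\mathbf n\rangle_{\partial T}\qquad\forall\boldsymbol\psi\in[P_k(T)]^d .$$ Let $Q_0$ and $Q_b$ be the $L^2$ projections onto $P_k(T)$ and $P_k(e)$, and $Q_hw=\{Q_0w,Q_b(w|_{\partial T})\}$ for $w\in H^1(\Omega)$, where $w|_{\partial T}$ is the trace. **Problem and scheme.** Let $\boldsymbol\beta$ and $c$ be constant on each element of $\mathcal T_h$, let $\Gamma_-$ be the part of $\partial\Omega$ where $\boldsymbol\beta\cdot\mathbf n<0$ (a union of edges/faces), $f\in L^2(\Omega)$, $g\in L^2(\Gamma_-)$, and let $u$ satisfy $\boldsymbol\beta\cdot\nabla u+cu=f$ in $\Omega$ and $u=g$ on $\Gamma_-$. Put $$a(v,w)=\sum_{T}(\boldsymbol\beta\cdot\nabla_wv+cv_0,\boldsymbol\beta\cdot\nabla_ww+cw_0)_T,\qquad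 s(v,w)=\sum_Th_T^{-1}\langle v_0-v_b,w_0-w_b\rangle_{\partial T}.$$ Let $u_h\in W_h$ with $(u_h)_b=Q_bg$ on $\Gamma_-$ satisfy $$a(u_h,v)+s(u_h,v)=\sum_T(f,\boldsymbol\beta\cdot\nabla_wv+cv_0)_T$$ for all $v\in W_h$ with $v_b=0$ on $\Gamma_-$. **Claim.** If $u\in H^{k+1}(\Omega)$, then the error $e_h=u_h-Q_hu$ satisfies $$|||e_h|||\le C\,h^k\,\|u\|_{k+1},\qquad |||v|||^2:=a(v,v)=\sum_T\|\boldsymbol\beta\cdot\nabla_wv+cv_0\|_T^2,$$ where $C>0$ depends only on $\Omega$, $k$ and the shape-regularity constants (in particular not on $h$, the mesh, $\boldsymbol\beta$, $c$, $f$, $g$ or $u$). -/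

import Mathlib

open MeasureTheory Set Filter Topology
open scoped ContDiff InnerProductSpace

noncomputable section

namespace WGLS

/-- The space `ℝ^d` with its Euclidean norm. -/
abbrev Pt (d : ℕ) : Type := EuclideanSpace ℝ (Fin d)

/-! ### Domains -/

/-- A bounded connected open set with Lipschitz boundary: near each boundary point, and in the
direction of a suitable unit vector `ν`, the set is the part of a ball strictly above the graph of
a Lipschitz function `φ` of the component orthogonal to `ν`. -/
structure IsLipschitzDomain {d : ℕ} (Ω : Set (Pt d)) : Prop where
  isOpen : IsOpen Ω
  isBounded : Bornology.IsBounded Ω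
  isConnected : IsConnected Ω
  lipschitz_boundary : ∀ x₀ ∈ frontier Ω, ∃ (r : ℝ) (ν : Pt d) (φ : Pt d → ℝ) (L : NNReal),
    0 < r ∧ ‖ν‖ = 1 ∧ LipschitzWith L φ ∧
      ∀ y ∈ Metric.ball x₀ r, (y ∈ Ω ↔ φ (y - ⟪ν, y⟫_ℝ • ν) < ⟪ν, y⟫_ℝ)

/-! ### Sobolev spaces and traces -/

/-- The classical partial derivative `∂ᵢ φ`. -/
def pderiv {d : ℕ} (i : Fin d) (φ : Pt d → ℝ) : Pt d → ℝ :=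
  fun x => fderiv ℝ φ x (EuclideanSpace.single i 1)

/-- The classical derivative `∂^α φ = ∂₁^{α₁} ⋯ ∂_d^{α_d} φ` for a multi-index `α`. -/
def multiDeriv {d : ℕ} (α : Fin d → ℕ) (φ : Pt d → ℝ) : Pt d → ℝ :=
  (List.finRange d).foldr (fun i ψ => (pderiv i)^[α i] ψ) φ

/-- `v` is a weak derivative of `u` on `Ω` of multi-index `α`. -/
def HasWeakDeriv {d : ℕ} (Ω : Set (Pt d)) (α : Fin d → ℕ) (u v : Pt d → ℝ) : Prop :=
  ∀ φ : Pt d → ℝ, ContDiff ℝ ∞ φ → HasCompactSupport φ → tsupport φ ⊆ Ω →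
    (∫ x in Ω, u x * multiDeriv α φ x) = (-1 : ℝ) ^ (∑ i, α i) * (∫ x in Ω, v x * φ x)

/-- `u ∈ H^m(Ω)`. -/
def MemSobolev {d : ℕ} (Ω : Set (Pt d)) (m : ℕ) (u : Pt d → ℝ) : Prop :=
  MemLp u 2 (volume.restrict Ω) ∧
    ∀ α : Fin d → ℕ, ∑ i, α i ≤ m →
      ∃ v : Pt d → ℝ, MemLp v 2 (volume.restrict Ω) ∧ HasWeakDeriv Ω α u v

open Classical in
/-- The weak derivative `D^α u ∈ L²(Ω)` (zero if there is none); unique up to null sets. -/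
def weakDeriv {d : ℕ} (Ω : Set (Pt d)) (α : Fin d → ℕ) (u : Pt d → ℝ) : Pt d → ℝ :=
  if h : ∃ v : Pt d → ℝ, MemLp v 2 (volume.restrict Ω) ∧ HasWeakDeriv Ω α u v
  then h.choose else 0

/-- The weak gradient `∇u` in the sense of distributions. -/
def gradient {d : ℕ} (Ω : Set (Pt d)) (u : Pt d → ℝ) : Pt d → Pt d :=
  fun x => WithLp.toLp 2 (fun i => weakDeriv Ω (Pi.single i 1) u x)

/-- The norm `‖u‖_m = (∑_{|α| ≤ m} ‖D^α u‖²_{L²(Ω)})^{1/2}` of `H^m(Ω)`. -/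
def sobolevNorm {d : ℕ} (Ω : Set (Pt d)) (m : ℕ) (u : Pt d → ℝ) : ℝ :=
  Real.sqrt (∑ j ∈ Finset.range (m + 1), ∑ α ∈ Finset.piAntidiag (Finset.univ : Finset (Fin d)) j,
    ∫ x in Ω, (weakDeriv Ω α u x) ^ 2)

/-- Surface measure on (subsets of) hyperplanes of `ℝ^d`: the `(d-1)`-dimensional Hausdorff measure,
normalized to agree with Lebesgue measure. -/
abbrev surface (d : ℕ) : Measure (Pt d) := μHE[d - 1]

/-- `γ ∈ L²(e)` is the trace on `e ⊆ closure Ω` of `u ∈ H¹(Ω)`: functions smooth up to the boundary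
converge to `u` in `H¹(Ω)` while their restrictions to `e` converge to `γ` in `L²(e)`. -/
def IsTrace {d : ℕ} (Ω : Set (Pt d)) (u : Pt d → ℝ) (e : Set (Pt d)) (γ : Pt d → ℝ) : Prop :=
  MemLp γ 2 ((surface d).restrict e) ∧
    ∃ φ : ℕ → Pt d → ℝ, (∀ n, ContDiff ℝ ∞ (φ n)) ∧
      Tendsto (fun n => eLpNorm (φ n - u) 2 (volume.restrict Ω)) atTop (𝓝 0) ∧
      (∀ i : Fin d, Tendsto (fun n => eLpNorm (pderiv i (φ n) - weakDeriv Ω (Pi.single i 1) u) 2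
        (volume.restrict Ω)) atTop (𝓝 0)) ∧
      Tendsto (fun n => eLpNorm (φ n - γ) 2 ((surface d).restrict e)) atTop (𝓝 0)

open Classical in
/-- The trace `u|_e` (zero if there is none). -/
def trace {d : ℕ} (Ω : Set (Pt d)) (u : Pt d → ℝ) (e : Set (Pt d)) : Pt d → ℝ :=
  if h : ∃ γ : Pt d → ℝ, IsTrace Ω u e γ then h.choose else 0

/-! ### Polynomials and `L²` projections -/

/-- `p` is a polynomial of total degree at most `k` on `ℝ^d`. -/
def IsPoly {d : ℕ} (k : ℕ) (p : Pt d → ℝ) : Prop :=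
  ∃ P : MvPolynomial (Fin d) ℝ, P.totalDegree ≤ k ∧ ∀ x, p x = MvPolynomial.eval (fun i => x i) P

/-- A vector field with components in `P_k`. -/
def IsVecPoly {d : ℕ} (k : ℕ) (ψ : Pt d → Pt d) : Prop :=
  ∀ i : Fin d, IsPoly k (fun x => ψ x i)

/-- The divergence of a differentiable vector field. -/
def divergence {d : ℕ} (ψ : Pt d → Pt d) : Pt d → ℝ :=
  fun x => ∑ i, pderiv i (fun y => ψ y i) x

open Classical in
/-- The `L²(μ)` projection of `w` onto the polynomials of degree at most `k`. Used with `μ` Lebesgue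
measure on an element or surface measure on a face; unique there as a function on that set. -/
def l2Proj {d : ℕ} (μ : Measure (Pt d)) (k : ℕ) (w : Pt d → ℝ) : Pt d → ℝ :=
  if h : ∃ q : Pt d → ℝ, IsPoly k q ∧
      ∀ p : Pt d → ℝ, IsPoly k p → ∫ x, q x * p x ∂μ = ∫ x, w x * p x ∂μ
  then h.choose else 0

/-! ### Polytopal meshes -/

/-- A (not necessarily convex) `m`-dimensional polytope: a finite union of nondegenerate
`m`-simplices. -/
def IsPolytope {d : ℕ} (m : ℕ) (P : Set (Pt d)) : Prop :=
  ∃ S : Finset (Fin (m + 1) → Pt d), S.Nonempty ∧ (∀ s ∈ S, AffineIndependent ℝ s) ∧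
    P = ⋃ s ∈ S, convexHull ℝ (range s)

/-- A finite partition of `Ω` into closed polytopes, with flat faces (edges if `d = 2`).
A face `e` is a face of the element `T` when `e ⊆ ∂T`; an interior face is thus shared by the two
elements on its sides. Two coplanar mesh faces of one element are allowed (hanging nodes). -/
structure Mesh {d : ℕ} (Ω : Set (Pt d)) where
  /-- the elements -/
  elems : Finset (Set (Pt d))
  /-- the edges/faces -/
  faces : Finset (Set (Pt d))
  /-- `normal T e` is the unit normal to the face `e` of `T` that points out of `T` -/
  normal : Set (Pt d) → Set (Pt d) → Pt d
  elem_polytope : ∀ T ∈ elems, IsPolytope d T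
  elem_connected : ∀ T ∈ elems, IsConnected (interior T)
  elem_disjoint : ∀ T ∈ elems, ∀ T' ∈ elems, T ≠ T' → Disjoint (interior T) (interior T')
  elem_cover : ⋃ T ∈ elems, T = closure Ω
  face_polytope : ∀ e ∈ faces, IsPolytope (d - 1) e
  face_connected : ∀ e ∈ faces, IsConnected e
  face_overlap : ∀ e ∈ faces, ∀ e' ∈ faces, e ≠ e' → surface d (e ∩ e') = 0
  face_of_elem : ∀ e ∈ faces, ∃ T ∈ elems, e ⊆ frontier T
  elem_frontier : ∀ T ∈ elems, frontier T ⊆ ⋃ e ∈ faces, ⋃ (_ : e ⊆ frontier T), e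
  normal_norm : ∀ T ∈ elems, ∀ e ∈ faces, e ⊆ frontier T → ‖normal T e‖ = 1
  face_flat : ∀ T ∈ elems, ∀ e ∈ faces, e ⊆ frontier T →
    ∀ x ∈ e, ∀ y ∈ e, ⟪normal T e, x - y⟫_ℝ = 0
  normal_outward : ∀ T ∈ elems, ∀ e ∈ faces, e ⊆ frontier T →
    ∀ᵐ x ∂((surface d).restrict e), ∀ᶠ t : ℝ in 𝓝[>] 0,
      x + t • normal T e ∉ T ∧ x - t • normal T e ∈ interior T

namespace Mesh

variable {d : ℕ} {Ω : Set (Pt d)}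

open Classical in
/-- The faces of the element `T`. -/
def facesOf (M : Mesh Ω) (T : Set (Pt d)) : Finset (Set (Pt d)) :=
  M.faces.filter (fun e => e ⊆ frontier T)

/-- The mesh size `h = max_T h_T`, where `h_T` is the diameter of `T`. -/
def meshSize (M : Mesh Ω) : ℝ :=
  sSup (Metric.diam '' (M.elems : Set (Set (Pt d))))

end Mesh

/-- The constants that quantify shape regularity. -/
structure ShapeConstants where
  /-- lower bound for `|T| / h_T^d` -/
  volC : ℝ
  /-- lower bound for `|e| / h_e^{d-1}` -/
  faceC : ℝ
  /-- lower bound for `h_e / h_T` -/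
  diamC : ℝ
  /-- upper bound for the number of faces of an element -/
  cardC : ℕ
  /-- lower bound for the height of the pyramids, relative to `h_T` -/
  heightC : ℝ
  /-- upper bound for the angle between the pyramids' rays and the normal to the base -/
  angleC : ℝ
  /-- upper bound for `h_{S(T)} / h_T` -/
  simplexC : ℝ
  /-- lower bound for the radius of a ball inscribed in `S(T)`, relative to `h_{S(T)}` -/
  inradiusC : ℝ
  /-- upper bound for the number of simplices that meet a given one -/
  overlapC : ℕ
  volC_pos : 0 < volC
  faceC_pos : 0 < faceC
  diamC_pos : 0 < diamC
  heightC_pos : 0 < heightC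
  angleC_lt : angleC < Real.pi / 2
  inradiusC_pos : 0 < inradiusC

/-- Shape regularity of a polytopal mesh, with given constants. -/
structure Mesh.ShapeRegular {d : ℕ} {Ω : Set (Pt d)} (M : Mesh Ω) (K : ShapeConstants) : Prop where
  vol_elem : ∀ T ∈ M.elems, K.volC * Metric.diam T ^ d ≤ (volume T).toReal
  vol_face : ∀ T ∈ M.elems, ∀ e ∈ M.facesOf T,
    K.faceC * Metric.diam e ^ (d - 1) ≤ (surface d e).toReal
  diam_face : ∀ T ∈ M.elems, ∀ e ∈ M.facesOf T, K.diamC * Metric.diam T ≤ Metric.diam e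
  card_faces : ∀ T ∈ M.elems, (M.facesOf T).card ≤ K.cardC
  /-- each face `e` of `T` is the base of a pyramid in `T` with apex `A`, of height at least
  `heightC * h_T`, that stands up above its base -/
  pyramid : ∀ T ∈ M.elems, ∀ e ∈ M.facesOf T, ∃ A ∈ T, convexJoin ℝ {A} e ⊆ T ∧
    ∀ x ∈ e, K.heightC * Metric.diam T ≤ ⟪x - A, M.normal T e⟫_ℝ ∧
      InnerProductGeometry.angle (x - A) (M.normal T e) ≤ K.angleC
  /-- each `T` lies in a shape-regular simplex `S(T)` of comparable diameter, and each of these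
  simplices meets only boundedly many others -/
  simplex : ∃ S : Set (Pt d) → Fin (d + 1) → Pt d, ∀ T ∈ M.elems,
    AffineIndependent ℝ (S T) ∧ T ⊆ convexHull ℝ (range (S T)) ∧
    Metric.diam (convexHull ℝ (range (S T))) ≤ K.simplexC * Metric.diam T ∧
    (∃ z, Metric.ball z (K.inradiusC * Metric.diam (convexHull ℝ (range (S T)))) ⊆
      convexHull ℝ (range (S T))) ∧
    {T' ∈ (M.elems : Set (Set (Pt d))) |
      (convexHull ℝ (range (S T)) ∩ convexHull ℝ (range (S T'))).Nonempty}.ncard ≤ K.overlapC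

/-! ### Weak functions, the discrete weak gradient and the scheme -/

/-- A weak function `{v₀, v_b}` on a mesh: interior values for each element and one boundary value
for each face. Only the values of `v0 T` on `T` and of `vb e` on `e` are relevant. -/
structure WeakFn (d : ℕ) where
  /-- the interior component -/
  v0 : Set (Pt d) → Pt d → ℝ
  /-- the boundary component -/
  vb : Set (Pt d) → Pt d → ℝ

instance (d : ℕ) : Sub (WeakFn d) :=
  ⟨fun v w => ⟨fun T => v.v0 T - w.v0 T, fun e => v.vb e - w.vb e⟩⟩

namespace Mesh

variable {d : ℕ} {Ω : Set (Pt d)}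

/-- `v ∈ W_h`: `v₀ ∈ P_k(T)` on each element and `v_b ∈ P_k(e)` on each face. -/
def MemW (M : Mesh Ω) (k : ℕ) (v : WeakFn d) : Prop :=
  (∀ T ∈ M.elems, ∃ p, IsPoly k p ∧ EqOn (v.v0 T) p T) ∧
    ∀ e ∈ M.faces, ∃ p, IsPoly k p ∧ EqOn (v.vb e) p e

/-- `q` is the discrete weak gradient of `v` on `T`, of degree `k`. -/
def IsWeakGrad (M : Mesh Ω) (k : ℕ) (v : WeakFn d) (T : Set (Pt d)) (q : Pt d → Pt d) : Prop :=
  IsVecPoly k q ∧ ∀ ψ : Pt d → Pt d, IsVecPoly k ψ →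
    ∫ x in T, ⟪q x, ψ x⟫_ℝ = -(∫ x in T, v.v0 T x * divergence ψ x) +
      ∑ e ∈ M.facesOf T, (∫ x in e, v.vb e x * ⟪ψ x, M.normal T e⟫_ℝ ∂(surface d))

open Classical in
/-- The discrete weak gradient `∇_{w,k,T} v`. -/
def weakGrad (M : Mesh Ω) (k : ℕ) (v : WeakFn d) (T : Set (Pt d)) : Pt d → Pt d :=
  if h : ∃ q, M.IsWeakGrad k v T q then h.choose else 0

/-- The function `β·∇_w v + c v₀` on the element `T`. -/
def residual (M : Mesh Ω) (k : ℕ) (β : Pt d → Pt d) (c : Pt d → ℝ) (v : WeakFn d)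
    (T : Set (Pt d)) : Pt d → ℝ :=
  fun x => ⟪β x, M.weakGrad k v T x⟫_ℝ + c x * v.v0 T x

/-- The bilinear form `a(v,w)`. -/
def aForm (M : Mesh Ω) (k : ℕ) (β : Pt d → Pt d) (c : Pt d → ℝ) (v w : WeakFn d) : ℝ :=
  ∑ T ∈ M.elems, ∫ x in T, M.residual k β c v T x * M.residual k β c w T x

/-- The stabilizer `s(v,w)`. -/
def sForm (M : Mesh Ω) (v w : WeakFn d) : ℝ :=
  ∑ T ∈ M.elems, ∑ e ∈ M.facesOf T,
    ∫ x in e, (Metric.diam T)⁻¹ * (v.v0 T x - v.vb e x) * (w.v0 T x - w.vb e x) ∂(surface d)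

/-- The energy (semi)norm `|||v||| = a(v,v)^{1/2}`. -/
def energyNorm (M : Mesh Ω) (k : ℕ) (β : Pt d → Pt d) (c : Pt d → ℝ) (v : WeakFn d) : ℝ :=
  Real.sqrt (M.aForm k β c v v)

/-- A function that is constant in the interior of each element. -/
def PiecewiseConst {F : Type*} (M : Mesh Ω) (b : Pt d → F) : Prop :=
  ∀ T ∈ M.elems, ∃ b₀ : F, ∀ x ∈ interior T, b x = b₀

/-- For `β` piecewise constant: the face `e` lies on the inflow boundary, i.e. `e ⊆ ∂Ω` and
`β·n < 0` on `e`, with the value of `β` from inside the element that has `e` as a face. -/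
def IsInflow (M : Mesh Ω) (β : Pt d → Pt d) (e : Set (Pt d)) : Prop :=
  e ∈ M.faces ∧ e ⊆ frontier Ω ∧
    ∃ T ∈ M.elems, e ⊆ frontier T ∧ ∀ x ∈ interior T, ⟪β x, M.normal T e⟫_ℝ < 0

/-- The inflow boundary `Γ₋`. -/
def inflowBoundary (M : Mesh Ω) (β : Pt d → Pt d) : Set (Pt d) :=
  ⋃ e, ⋃ (_ : M.IsInflow β e), e

/-- `v ∈ W_h⁰`: `v ∈ W_h` vanishes on the inflow boundary. -/
def MemW0 (M : Mesh Ω) (k : ℕ) (β : Pt d → Pt d) (v : WeakFn d) : Prop :=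
  M.MemW k v ∧ ∀ e, M.IsInflow β e → ∀ x ∈ e, v.vb e x = 0

/-- The projection `Q_h w = {Q₀ w, Q_b w}`, with `Q_b` applied to the traces of `w`. -/
def Qh (_M : Mesh Ω) (k : ℕ) (w : Pt d → ℝ) : WeakFn d where
  v0 T := l2Proj (volume.restrict T) k w
  vb e := l2Proj ((surface d).restrict e) k (trace Ω w e)

/-- `u ∈ H^m(Ω)` solves `β·∇u + c u = f` in `Ω`, `u = g` on the inflow boundary. -/
structure IsExactSolution (M : Mesh Ω) (m : ℕ) (β : Pt d → Pt d) (c f g u : Pt d → ℝ) : Prop where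
  memSobolev : MemSobolev Ω m u
  equation : ∀ᵐ x ∂(volume.restrict Ω), ⟪β x, gradient Ω u x⟫_ℝ + c x * u x = f x
  boundary : ∀ e, M.IsInflow β e → trace Ω u e =ᵐ[(surface d).restrict e] g

/-- `uh` solves the weak Galerkin least-squares scheme of degree `k`. -/
structure IsDiscreteSolution (M : Mesh Ω) (k : ℕ) (β : Pt d → Pt d) (c f g : Pt d → ℝ)
    (uh : WeakFn d) : Prop where
  memW : M.MemW k uh
  boundary : ∀ e, M.IsInflow β e → EqOn (uh.vb e) (l2Proj ((surface d).restrict e) k g) e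
  equation : ∀ v, M.MemW0 k β v → M.aForm k β c uh v + M.sForm uh v =
    ∑ T ∈ M.elems, ∫ x in T, f x * M.residual k β c v T x

end Mesh

end WGLS

end

open MeasureTheory Set Filter Topology
open scoped ContDiff InnerProductSpace ENNReal

noncomputable section

namespace WGLS

/-! ### Squared `L²` seminorms -/

/-! Write `q = Q_h u` and `e = u_h - q`. Integration by parts on each element, combined with the
defining properties of `Q₀` and `Q_b`, shows that the discrete weak gradient of `q` is the `L²`
projection of `∇u` (`integral_weakGrad_Qh`). Since `β` and `c` are constant on `T`, the residual of
a discrete `v` is a polynomial of degree at most `k` there, so against it the residual of `q` acts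
like `f` (`integral_residual_Qh`). Subtracting from the scheme leaves `a(e, v) = -s(u_h, v)` for
every admissible `v`. The boundary part of `e` vanishes on the inflow boundary, so `v = e` is
admissible, and completing the square in `-4 s(u_h, u_h - q)` gives `4 a(e, e) ≤ s(q, q)`
(`aForm_error_le`). No stability of the continuous problem enters, and `β`, `c` are gone from the
right-hand side: only an approximation property of `u` remains.

That property is `s(q, q) ≤ C h^{2k} ‖u‖²_{k+1}` (`exists_sForm_Qh_le`). On a face, `Q₀u` is a
polynomial, so the jump `Q₀u - Q_b u` is at most `Q₀u - u` in `L²`. Splitting at a local polynomial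
approximation `p`, the part `u - p` is controlled by the trace inequality on a pyramid, and `p -
Q₀u` by a pointwise bound for polynomials that depends on the element only through its volume and
diameter (`exists_remez`).

Elements need not be star-shaped, so `p` is not constructed on `T`. The cone condition of a
Lipschitz domain provides, at scale `h_T`, a subset of `Ω` that contains `T` up to a null set and is
star-shaped with respect to a ball of radius comparable to its own size (`exists_star_set`);
iterating a Poincaré inequality there yields `p` (`exists_local_approx`). For elements of very
different sizes these neighbourhoods may overlap arbitrarily often. However, the sum of `h_T` over
the neighbourhoods that contain a given point is at most a multiple of `h`, because the elements are
disjoint and fat and `|z|^{1-d}` is locally integrable (`exists_sum_lintegral_le`). One factor `h_T`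
of `h_T^{2k}` is spent on this.

The analysis below this level rests on two facts. Functions smooth on the whole space are dense in
`H¹(Ω)` (`IsLipschitzDomain.smoothApprox`), so that Poincaré, trace and integration-by-parts
statements follow from their smooth versions by passing to the limit. The divergence theorem on a
polytope with flat faces (`setIntegral_pderiv_eq_sum_faces`) is the fundamental theorem of calculus
on coordinate lines together with Fubini. -/

/-- The squared `L²(μ)` seminorm, with values in `[0, ∞]`. -/
def sqInt {X : Type*} [MeasurableSpace X] (μ : Measure X) (f : X → ℝ) : ℝ≥0∞ :=
  ∫⁻ x, ‖f x‖ₑ ^ 2 ∂μ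

section SqInt

variable {X : Type*} [MeasurableSpace X] {μ ν : Measure X} {f g : X → ℝ}

lemma enorm_sq_eq_ofReal (a : ℝ) : ‖a‖ₑ ^ 2 = ENNReal.ofReal (a ^ 2) := by
  rw [Real.enorm_eq_ofReal_abs, ← ENNReal.ofReal_pow (abs_nonneg a), sq_abs]

lemma sqInt_eq_eLpNorm_sq (f : X → ℝ) : sqInt μ f = eLpNorm f 2 μ ^ 2 := by
  rw [eLpNorm_eq_lintegral_rpow_enorm_toReal two_ne_zero ENNReal.ofNat_ne_top, sqInt,
    ← ENNReal.rpow_natCast, ← ENNReal.rpow_mul]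
  simp

lemma sqInt_mono_measure (h : μ ≤ ν) (f : X → ℝ) : sqInt μ f ≤ sqInt ν f :=
  lintegral_mono' h le_rfl

lemma sqInt_congr (h : f =ᵐ[μ] g) : sqInt μ f = sqInt μ g :=
  lintegral_congr_ae (h.mono fun x hx => by simp [hx])

lemma sqInt_neg (f : X → ℝ) : sqInt μ (-f) = sqInt μ f := by
  simp [sqInt]

lemma sqInt_sub_comm (f g : X → ℝ) : sqInt μ (f - g) = sqInt μ (g - f) := by
  rw [← neg_sub, sqInt_neg]

lemma enorm_add_sq_le (a b : ℝ) : ‖a + b‖ₑ ^ 2 ≤ 2 * ‖a‖ₑ ^ 2 + 2 * ‖b‖ₑ ^ 2 := by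
  simp only [enorm_sq_eq_ofReal]
  rw [show (2 : ℝ≥0∞) = ENNReal.ofReal 2 by simp, ← ENNReal.ofReal_mul (by norm_num),
    ← ENNReal.ofReal_mul (by norm_num), ← ENNReal.ofReal_add (by positivity) (by positivity)]
  exact ENNReal.ofReal_le_ofReal (by nlinarith [sq_nonneg (a - b)])

lemma sqInt_add_le (hf : AEMeasurable f μ) (g : X → ℝ) :
    sqInt μ (f + g) ≤ 2 * sqInt μ f + 2 * sqInt μ g := by
  simp only [sqInt]
  rw [← lintegral_const_mul' _ _ ENNReal.ofNat_ne_top,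
    ← lintegral_const_mul' _ _ ENNReal.ofNat_ne_top,
    ← lintegral_add_left' ((hf.enorm.pow_const 2).const_mul 2)]
  exact lintegral_mono fun x => enorm_add_sq_le _ _

lemma sqInt_sub_le (hf : AEMeasurable f μ) (g : X → ℝ) :
    sqInt μ (f - g) ≤ 2 * sqInt μ f + 2 * sqInt μ g := by
  rw [sub_eq_add_neg, ← sqInt_neg g]
  exact sqInt_add_le hf _

lemma ofReal_integral_sq (hf : MemLp f 2 μ) :
    ENNReal.ofReal (∫ x, f x ^ 2 ∂μ) = sqInt μ f := by
  rw [ofReal_integral_eq_lintegral_ofReal hf.integrable_sq (ae_of_all _ fun x => sq_nonneg _)]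
  simp [sqInt, enorm_sq_eq_ofReal]

lemma tendsto_eLpNorm_two_iff {F : ℕ → X → ℝ} :
    Tendsto (fun n => eLpNorm (F n) 2 μ) atTop (𝓝 0) ↔
      Tendsto (fun n => sqInt μ (F n)) atTop (𝓝 0) := by
  simp only [sqInt_eq_eLpNorm_sq]
  constructor
  · intro h
    simpa using h.ennrpow_const (r := 2)
  · intro h
    have := h.ennrpow_const (r := 1 / 2)
    have h2 : ∀ a : ℝ≥0∞, (a ^ 2) ^ (1 / 2 : ℝ) = a := fun a => by
      rw [← ENNReal.rpow_natCast, ← ENNReal.rpow_mul]; simp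
    simpa only [h2, ENNReal.zero_rpow_of_pos (show (0 : ℝ) < 1 / 2 by norm_num)] using this

/-- Jensen's inequality for the square. -/
lemma sq_lintegral_le [IsProbabilityMeasure μ] {f : X → ℝ≥0∞} (hf : AEMeasurable f μ) :
    (∫⁻ x, f x ∂μ) ^ 2 ≤ ∫⁻ x, f x ^ 2 ∂μ := by
  have := ENNReal.lintegral_mul_le_Lp_mul_Lq μ Real.HolderConjugate.two_two hf
    (aemeasurable_const (b := (1 : ℝ≥0∞)))
  simp only [Pi.mul_apply, mul_one, ENNReal.one_rpow, lintegral_const, measure_univ] at this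
  calc (∫⁻ x, f x ∂μ) ^ 2 ≤ ((∫⁻ x, f x ^ (2 : ℝ) ∂μ) ^ (1 / 2 : ℝ)) ^ 2 := by gcongr
    _ = ∫⁻ x, f x ^ 2 ∂μ := by
      rw [← ENNReal.rpow_natCast, ← ENNReal.rpow_mul]; simp

lemma enorm_integral_sq_le [IsProbabilityMeasure μ] (hf : AEMeasurable f μ) :
    ‖∫ x, f x ∂μ‖ₑ ^ 2 ≤ sqInt μ f := by
  refine le_trans ?_ (sq_lintegral_le hf.enorm)
  gcongr
  exact enorm_integral_le_lintegral_enorm f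

end SqInt

/-! ### Classical derivatives -/

section Derivatives

variable {d : ℕ}

lemma contDiff_pderiv {i : Fin d} {φ : Pt d → ℝ} (h : ContDiff ℝ ∞ φ) :
    ContDiff ℝ ∞ (pderiv i φ) :=
  (h.fderiv_right (m := ∞) le_rfl).clm_apply contDiff_const

lemma pderiv_add {i : Fin d} {φ ψ : Pt d → ℝ} (h : Differentiable ℝ φ) (h' : Differentiable ℝ ψ) :
    pderiv i (φ + ψ) = pderiv i φ + pderiv i ψ := by
  ext x; simp [pderiv, fderiv_add (h x) (h' x)]

lemma pderiv_sub {i : Fin d} {φ ψ : Pt d → ℝ} (h : Differentiable ℝ φ) (h' : Differentiable ℝ ψ) :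
    pderiv i (φ - ψ) = pderiv i φ - pderiv i ψ := by
  ext x; simp [pderiv, fderiv_sub (h x) (h' x)]

lemma pderiv_mul {i : Fin d} {φ ψ : Pt d → ℝ} (h : Differentiable ℝ φ) (h' : Differentiable ℝ ψ) :
    pderiv i (φ * ψ) = pderiv i φ * ψ + φ * pderiv i ψ := by
  ext x; simp [pderiv, fderiv_mul (h x) (h' x)]; ring

lemma pderiv_comm (i j : Fin d) {φ : Pt d → ℝ} (h : ContDiff ℝ ∞ φ) :
    pderiv i (pderiv j φ) = pderiv j (pderiv i φ) := by
  ext x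
  have hs : IsSymmSndFDerivAt ℝ φ x :=
    h.contDiffAt.isSymmSndFDerivAt (by simpa using WithTop.coe_le_coe.2 (le_top : (2 : ℕ∞) ≤ ⊤))
  have hd : DifferentiableAt ℝ (fderiv ℝ φ) x :=
    (h.fderiv_right (m := ∞) le_rfl).differentiable (by simp) x
  have key : ∀ a b : Fin d, pderiv a (pderiv b φ) x =
      fderiv ℝ (fderiv ℝ φ) x (EuclideanSpace.single a 1) (EuclideanSpace.single b 1) := by
    intro a b
    unfold pderiv
    rw [fderiv_clm_apply hd (differentiableAt_const _)]
    simp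
  rw [key, key]
  exact hs _ _

lemma contDiff_iterate_pderiv {i : Fin d} (m : ℕ) {φ : Pt d → ℝ} (h : ContDiff ℝ ∞ φ) :
    ContDiff ℝ ∞ ((pderiv i)^[m] φ) := by
  induction m with
  | zero => exact h
  | succ m ih => rw [Function.iterate_succ_apply']; exact contDiff_pderiv ih

lemma iterate_pderiv_comm (i j : Fin d) (m : ℕ) {φ : Pt d → ℝ} (h : ContDiff ℝ ∞ φ) :
    (pderiv i)^[m] (pderiv j φ) = pderiv j ((pderiv i)^[m] φ) := by
  induction m with
  | zero => rfl
  | succ m ih =>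
    rw [Function.iterate_succ_apply', Function.iterate_succ_apply', ih,
      pderiv_comm _ _ (contDiff_iterate_pderiv m h)]

lemma contDiff_foldr_pderiv (l : List (Fin d)) (α : Fin d → ℕ) {φ : Pt d → ℝ}
    (h : ContDiff ℝ ∞ φ) : ContDiff ℝ ∞ (l.foldr (fun i ψ => (pderiv i)^[α i] ψ) φ) := by
  induction l with
  | nil => exact h
  | cons a l ih => exact contDiff_iterate_pderiv _ ih

lemma contDiff_multiDeriv (α : Fin d → ℕ) {φ : Pt d → ℝ} (h : ContDiff ℝ ∞ φ) :
    ContDiff ℝ ∞ (multiDeriv α φ) :=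
  contDiff_foldr_pderiv _ _ h

lemma foldr_pderiv_comm (l : List (Fin d)) (α : Fin d → ℕ) (j : Fin d) {φ : Pt d → ℝ}
    (h : ContDiff ℝ ∞ φ) : l.foldr (fun i ψ => (pderiv i)^[α i] ψ) (pderiv j φ) =
      pderiv j (l.foldr (fun i ψ => (pderiv i)^[α i] ψ) φ) := by
  induction l with
  | nil => rfl
  | cons a l ih =>
    simp only [List.foldr_cons, ih]
    exact iterate_pderiv_comm _ _ _ (contDiff_foldr_pderiv _ _ h)

/-- The index `j` occurs at most once in a list without duplicates; the extra derivative it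
contributes there commutes with all the others and can be moved to the innermost place. -/
lemma foldr_pderiv_add_single (l : List (Fin d)) (hl : l.Nodup) (α : Fin d → ℕ) (j : Fin d)
    {φ : Pt d → ℝ} (h : ContDiff ℝ ∞ φ) :
    l.foldr (fun i ψ => (pderiv i)^[(α + Pi.single j 1 : Fin d → ℕ) i] ψ) φ =
      if j ∈ l then l.foldr (fun i ψ => (pderiv i)^[α i] ψ) (pderiv j φ)
      else l.foldr (fun i ψ => (pderiv i)^[α i] ψ) φ := by
  induction l with
  | nil => simp
  | cons a l ih =>
    obtain ⟨ha, hl⟩ := List.nodup_cons.1 hl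
    simp only [List.foldr_cons, ih hl, List.mem_cons]
    by_cases haj : j = a
    · subst haj
      simp only [ha, if_false, true_or, if_true, Pi.add_apply, Pi.single_eq_same,
        Function.iterate_succ_apply]
      rw [foldr_pderiv_comm l α j h]
    · simp only [haj, false_or, Pi.add_apply, Pi.single_eq_of_ne (Ne.symm haj), add_zero]
      split_ifs <;> rfl

/-- This lets a test function `∂ⱼφ` be inserted into the definition of a weak derivative, which is
how weak derivatives are composed. -/
lemma multiDeriv_add_single (α : Fin d → ℕ) (j : Fin d) {φ : Pt d → ℝ} (h : ContDiff ℝ ∞ φ) :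
    multiDeriv (α + Pi.single j 1) φ = multiDeriv α (pderiv j φ) := by
  rw [multiDeriv, foldr_pderiv_add_single _ (List.nodup_finRange d) α j h]
  simp [multiDeriv]

lemma multiDeriv_pderiv (α : Fin d → ℕ) (j : Fin d) {φ : Pt d → ℝ} (h : ContDiff ℝ ∞ φ) :
    multiDeriv α (pderiv j φ) = pderiv j (multiDeriv α φ) :=
  foldr_pderiv_comm _ _ _ h

lemma multiDeriv_zero (φ : Pt d → ℝ) : multiDeriv 0 φ = φ := by
  simp [multiDeriv]

lemma multiDeriv_single (j : Fin d) {φ : Pt d → ℝ} (h : ContDiff ℝ ∞ φ) :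
    multiDeriv (Pi.single j 1) φ = pderiv j φ := by
  rw [← zero_add (Pi.single j 1), multiDeriv_add_single _ _ h, multiDeriv_zero]

lemma tsupport_pderiv_subset {i : Fin d} (φ : Pt d → ℝ) : tsupport (pderiv i φ) ⊆ tsupport φ :=
  (tsupport_fderiv_apply_subset ℝ _)

lemma hasCompactSupport_pderiv {i : Fin d} {φ : Pt d → ℝ} (h : HasCompactSupport φ) :
    HasCompactSupport (pderiv i φ) :=
  h.fderiv_apply ℝ _

end Derivatives

/-! ### Surface measure on hyperplanes -/

section Hyperplane

variable {n : ℕ}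

lemma finrank_orthogonal_unit {ν : Pt (n + 1)} (hν : ‖ν‖ = 1) :
    Module.finrank ℝ ((ℝ ∙ ν)ᗮ : Submodule ℝ (Pt (n + 1))) = n := by
  have h0 : ν ≠ 0 := by rintro rfl; simp at hν
  have : Fact (Module.finrank ℝ (Pt (n + 1)) = n + 1) := ⟨by simp⟩
  exact Submodule.finrank_orthogonal_span_singleton h0

/-- The parametrization by the orthogonal complement is an isometry onto the hyperplane, and
Hausdorff measure of the right dimension on an inner product space is Lebesgue measure. Integrals
over faces thereby become Lebesgue integrals. -/
lemma surface_restrict_hyperplane {ν : Pt (n + 1)} (hν : ‖ν‖ = 1) (x₀ : Pt (n + 1)) :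
    (surface (n + 1)).restrict {x | ⟪ν, x - x₀⟫_ℝ = 0} =
      Measure.map (fun w : ((ℝ ∙ ν)ᗮ : Submodule ℝ (Pt (n + 1))) => x₀ + (w : Pt (n + 1)))
        volume := by
  have hi : Isometry (fun w : ((ℝ ∙ ν)ᗮ : Submodule ℝ (Pt (n + 1))) => x₀ + (w : Pt (n + 1))) :=
    Isometry.of_dist_eq fun a b => by simp [Subtype.dist_eq]
  have hr : range (fun w : ((ℝ ∙ ν)ᗮ : Submodule ℝ (Pt (n + 1))) => x₀ + (w : Pt (n + 1))) =
      {x | ⟪ν, x - x₀⟫_ℝ = 0} := by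
    ext x
    constructor
    · rintro ⟨w, rfl⟩
      simpa using Submodule.mem_orthogonal_singleton_iff_inner_right.1 w.2
    · intro hx
      exact ⟨⟨x - x₀, Submodule.mem_orthogonal_singleton_iff_inner_right.2 hx⟩, by simp⟩
  have := hi.map_euclideanHausdorffMeasure (d := n)
  rw [hr] at this
  change (μHE[n] : Measure (Pt (n + 1))).restrict _ = _
  rw [← this]
  congr 1
  have h2 := InnerProductSpace.euclideanHausdorffMeasure_eq_volume
    (V := ((ℝ ∙ ν)ᗮ : Submodule ℝ (Pt (n + 1))))
  rw [finrank_orthogonal_unit hν] at h2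
  exact h2

/-- Fubini's theorem in the directions along and orthogonal to a unit vector. -/
lemma lintegral_eq_lintegral_orthogonal {ν : Pt (n + 1)} (hν : ‖ν‖ = 1) (x₀ : Pt (n + 1))
    {g : Pt (n + 1) → ℝ≥0∞} (hg : Measurable g) :
    ∫⁻ x, g x = ∫⁻ t : ℝ, ∫⁻ w : ((ℝ ∙ ν)ᗮ : Submodule ℝ (Pt (n + 1))), g (x₀ + t • ν + w) := by
  have h1 := (ℝ ∙ ν).measurePreserving_measurableEquivProd x₀
  rw [InnerProductSpace.euclideanHausdorffMeasure_eq_volume] at h1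
  have hm : Measurable fun a => g (((ℝ ∙ ν).measurableEquivProd x₀).symm a) :=
    hg.comp (MeasurableEquiv.measurable _)
  rw [← h1.symm.lintegral_comp hg, Measure.volume_eq_prod, lintegral_prod _ hm.aemeasurable,
    ← (LinearIsometryEquiv.toSpanUnitSingleton ν hν).measurePreserving.lintegral_comp]
  · refine lintegral_congr fun t => lintegral_congr fun w => ?_
    rw [Submodule.measurableEquivProd_symm_apply]
    congr 1
    simp [add_comm, add_left_comm]
  · exact hm.lintegral_prod_right'

end Hyperplane

/-! ### Coordinate lines and where they cross a hyperplane -/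

section Lines

variable {n : ℕ}

/-- The point with `i`-th coordinate `s` and the other coordinates `y`. -/
def linePt (i : Fin (n + 1)) (y : Pt n) (s : ℝ) : Pt (n + 1) :=
  WithLp.toLp 2 (i.insertNth s y.ofLp)

@[simp] lemma linePt_apply_same (i : Fin (n + 1)) (y : Pt n) (s : ℝ) : linePt i y s i = s := by
  simp [linePt]

@[simp] lemma linePt_apply_succAbove (i : Fin (n + 1)) (y : Pt n) (s : ℝ) (j : Fin n) :
    linePt i y s (i.succAbove j) = y j := by
  simp [linePt]

lemma linePt_add (i : Fin (n + 1)) (y : Pt n) (s t : ℝ) :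
    linePt i y (s + t) = linePt i y s + t • EuclideanSpace.single i 1 := by
  ext j
  rcases Fin.eq_self_or_eq_succAbove i j with rfl | ⟨j, rfl⟩ <;> simp

lemma inner_linePt (ν : Pt (n + 1)) (i : Fin (n + 1)) (y : Pt n) (s : ℝ) :
    ⟪ν, linePt i y s⟫_ℝ = ν i * s + ∑ j, ν (i.succAbove j) * y j := by
  rw [PiLp.inner_apply, Fin.sum_univ_succAbove _ i]
  simp [mul_comm]

lemma measurePreserving_linePt (i : Fin (n + 1)) :
    MeasurePreserving (fun p : Pt n × ℝ => linePt i p.1 p.2) (volume.prod volume) volume := by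
  have h1 : MeasurePreserving (fun p : Pt n × ℝ => (p.2, p.1.ofLp)) (volume.prod volume)
      (volume.prod volume) :=
    ((MeasurePreserving.id volume).prod (PiLp.volume_preserving_ofLp (Fin n))).comp
      Measure.measurePreserving_swap
  have h2 := (volume_preserving_piFinSuccAbove (fun _ : Fin (n + 1) => ℝ) i).symm
  have h3 := PiLp.volume_preserving_toLp (Fin (n + 1))
  exact h3.comp (h2.comp h1)

lemma continuous_linePt (i : Fin (n + 1)) :
    Continuous (fun p : Pt n × ℝ => linePt i p.1 p.2) := by
  unfold linePt
  fun_prop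

/-- The measurable equivalence behind `linePt`. -/
lemma measurableEmbedding_linePt (i : Fin (n + 1)) :
    MeasurableEmbedding (fun p : Pt n × ℝ => linePt i p.1 p.2) := by
  refine (continuous_linePt i).measurableEmbedding ?_
  rintro ⟨y, s⟩ ⟨y', s'⟩ h
  have h1 := congrArg (fun x : Pt (n + 1) => x i) h
  have h2 := fun j => congrArg (fun x : Pt (n + 1) => x (i.succAbove j)) h
  simp only [linePt_apply_same, linePt_apply_succAbove] at h1 h2
  exact Prod.ext (PiLp.ext h2) h1

/-- The height at which the line in direction `i` over `y` meets the hyperplane `⟪ν, x⟫ = a`. -/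
def crossHeight (ν : Pt (n + 1)) (a : ℝ) (i : Fin (n + 1)) (y : Pt n) : ℝ :=
  (a - ∑ j, ν (i.succAbove j) * y j) / ν i

lemma inner_linePt_eq_iff {ν : Pt (n + 1)} {i : Fin (n + 1)} (hi : ν i ≠ 0) (a : ℝ) (y : Pt n)
    (s : ℝ) : ⟪ν, linePt i y s⟫_ℝ = a ↔ s = crossHeight ν a i y := by
  rw [inner_linePt, crossHeight, eq_div_iff hi]
  constructor <;> intro h <;> linarith

/-- The projection along a coordinate direction of a hyperplane onto `ℝⁿ` scales surface measure by
the corresponding component of the unit normal. -/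
lemma map_crossHeight {ν : Pt (n + 1)} (hν : ‖ν‖ = 1) {i : Fin (n + 1)} (hi : ν i ≠ 0) (a : ℝ) :
    Measure.map (fun y => linePt i y (crossHeight ν a i y)) volume =
      ENNReal.ofReal |ν i| • (surface (n + 1)).restrict {x | ⟪ν, x⟫_ℝ = a} := by
  let ℓ : Pt n →ₗ[ℝ] Pt (n + 1) :=
    { toFun := fun y => linePt i y (crossHeight ν 0 i y)
      map_add' := fun y z => by
        ext j
        rcases Fin.eq_self_or_eq_succAbove i j with rfl | ⟨j, rfl⟩
        · simp [crossHeight, mul_add, Finset.sum_add_distrib]; ring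
        · simp
      map_smul' := fun c y => by
        ext j
        rcases Fin.eq_self_or_eq_succAbove i j with rfl | ⟨j, rfl⟩
        · simp [crossHeight, mul_left_comm, ← Finset.mul_sum]; ring
        · simp }
  -- The Gram matrix of the lift is `1 + w wᵀ` with `w = ν' / ν i`, where `ν'` collects the other
  -- components. Its determinant `1 + |w|²` equals `1 / (ν i)²` because `ν` is a unit vector.
  have hdet : ENNReal.ofReal |ν i| * ENNReal.ofReal ℓ.normDet = 1 := by
    have hsq := ℓ.normDet_sq_eq_det_gram (EuclideanSpace.basisFun (Fin n) ℝ)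
    have hgram : Matrix.gram ℝ (fun j => ℓ (EuclideanSpace.basisFun (Fin n) ℝ j)) =
        1 + Matrix.replicateCol Unit (fun j => ν (i.succAbove j) / ν i) *
          Matrix.replicateRow Unit (fun j => ν (i.succAbove j) / ν i) := by
      ext j k
      rw [Matrix.gram_apply, PiLp.inner_apply, Fin.sum_univ_succAbove _ i]
      simp [ℓ, crossHeight, Matrix.mul_apply, Matrix.one_apply]
      ring
    rw [hgram, Matrix.det_one_add_replicateCol_mul_replicateRow] at hsq
    have hn : (ν i) ^ 2 + ∑ j, ν (i.succAbove j) ^ 2 = 1 := by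
      have := EuclideanSpace.real_norm_sq_eq ν
      rw [hν, Fin.sum_univ_succAbove _ i] at this
      linarith
    have hdot : (1 : ℝ) + (fun j => ν (i.succAbove j) / ν i) ⬝ᵥ
        (fun j => ν (i.succAbove j) / ν i) = 1 / (ν i) ^ 2 := by
      simp only [dotProduct, ← sq, div_pow, ← Finset.sum_div]
      field_simp
      linarith
    rw [hdot] at hsq
    rw [← ENNReal.ofReal_mul (abs_nonneg _)]
    have h0 := ℓ.normDet_nonneg
    have : (|ν i| * ℓ.normDet) ^ 2 = 1 := by
      rw [mul_pow, sq_abs]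
      have : ℓ.normDet ^ 2 = 1 / (ν i) ^ 2 := by simpa using hsq
      rw [this]; field_simp
    rw [(pow_eq_one_iff_of_nonneg (mul_nonneg (abs_nonneg (ν i)) h0) two_ne_zero).1 this]
    simp
  have hlift : ∀ y, linePt i y (crossHeight ν a i y) =
      (a / ν i) • EuclideanSpace.single i 1 + ℓ y := by
    intro y
    ext j
    rcases Fin.eq_self_or_eq_succAbove i j with rfl | ⟨j, rfl⟩
    · simp [ℓ, crossHeight]; ring
    · simp [ℓ]
  have hcont : Continuous (fun y => linePt i y (crossHeight ν a i y)) := by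
    refine (continuous_linePt i).comp (continuous_id.prodMk ?_)
    simp only
    fun_prop
  ext B hB
  rw [Measure.map_apply hcont.measurable hB, Measure.smul_apply, Measure.restrict_apply hB,
    smul_eq_mul]
  have himg : B ∩ {x | ⟪ν, x⟫_ℝ = a} = (fun z => (a / ν i) • EuclideanSpace.single i 1 + z) ''
      (ℓ '' ((fun y => linePt i y (crossHeight ν a i y)) ⁻¹' B)) := by
    rw [image_image]
    simp only [← hlift]
    rw [image_preimage_eq_inter_range]
    congr 1
    ext x
    constructor
    · intro hx
      have hx' : x = linePt i (WithLp.toLp 2 (fun j => x (i.succAbove j))) (x i) := by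
        ext j
        rcases Fin.eq_self_or_eq_succAbove i j with rfl | ⟨j, rfl⟩ <;> simp
      refine ⟨WithLp.toLp 2 (fun j => x (i.succAbove j)), ?_⟩
      simp only
      rw [← (inner_linePt_eq_iff hi a _ (x i)).1 (by rw [← hx']; exact hx), ← hx']
    · rintro ⟨y, rfl⟩
      exact (inner_linePt_eq_iff hi a y _).2 rfl
  have hm := ℓ.euclideanHausdorffMeasure_image_eq_normDet_mul_volume
    ((fun y => linePt i y (crossHeight ν a i y)) ⁻¹' B)
  rw [finrank_euclideanSpace_fin] at hm
  rw [himg]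
  change _ = _ * μHE[n] _
  rw [(isometry_add_left _).euclideanHausdorffMeasure_image, hm, ← mul_assoc, hdet, one_mul]

end Lines

/-! ### The trace inequality on a pyramid -/

section Pyramid

variable {n : ℕ}

lemma lintegral_comp_smul_of_pos {F : Type*} [NormedAddCommGroup F] [NormedSpace ℝ F]
    [MeasurableSpace F] [BorelSpace F] [FiniteDimensional ℝ F] (μ : Measure F)
    [μ.IsAddHaarMeasure] {r : ℝ} (hr : 0 < r) (g : F → ℝ≥0∞) :
    ∫⁻ x, g x ∂μ = ENNReal.ofReal (r ^ Module.finrank ℝ F) * ∫⁻ x, g (r • x) ∂μ := by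
  have h1 : ∫⁻ x, g (r • x) ∂μ = ∫⁻ y, g y ∂(μ.map (r • ·)) :=
    ((Homeomorph.smulOfNeZero r hr.ne').measurableEmbedding.lintegral_map _).symm
  rw [h1, Measure.map_addHaar_smul μ hr.ne', lintegral_smul_measure, smul_eq_mul, ← mul_assoc,
    ← ENNReal.ofReal_mul (by positivity), abs_of_pos (by positivity),
    mul_inv_cancel₀ (by positivity)]
  simp

/-- Integration over the pyramid with base `e` and apex `A` in polar coordinates around `A`. -/
lemma lintegral_pyramid_le {ν : Pt (n + 1)} (hν : ‖ν‖ = 1) {e T : Set (Pt (n + 1))}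
    (he : MeasurableSet e) (hT : MeasurableSet T) {A : Pt (n + 1)} {H : ℝ} (hH : 0 < H)
    (hflat : ∀ x ∈ e, ⟪ν, x - A⟫_ℝ = H)
    (hsub : ∀ x ∈ e, ∀ t ∈ Ioo (0 : ℝ) 1, A + t • (x - A) ∈ T)
    {g : Pt (n + 1) → ℝ≥0∞} (hg : Measurable g) :
    ENNReal.ofReal H * ∫⁻ x in e, (∫⁻ t in Ioo (0 : ℝ) 1,
      ENNReal.ofReal (t ^ n) * g (A + t • (x - A))) ∂(surface (n + 1)) ≤ ∫⁻ x in T, g x := by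
  set x₀ : Pt (n + 1) := A + H • ν with hx₀
  have hsubset : e ⊆ {x | ⟪ν, x - x₀⟫_ℝ = 0} := by
    intro x hx
    have := hflat x hx
    simp only [mem_ofPred_eq, hx₀, ← sub_sub, inner_sub_right, inner_smul_right,
      real_inner_self_eq_norm_sq, hν] at this ⊢
    linarith
  have hrestr : (surface (n + 1)).restrict e =
      (Measure.map (fun w : ((ℝ ∙ ν)ᗮ : Submodule ℝ (Pt (n + 1))) => x₀ + (w : Pt (n + 1)))
        volume).restrict e := by
    rw [← surface_restrict_hyperplane hν, Measure.restrict_restrict_of_subset hsubset]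
  have hmeas : Measurable (fun p : Pt (n + 1) × ℝ =>
      ENNReal.ofReal (p.2 ^ n) * g (A + p.2 • (p.1 - A))) := by fun_prop
  have hmeas1 : Measurable (fun x : Pt (n + 1) => ∫⁻ t in Ioo (0 : ℝ) 1,
      ENNReal.ofReal (t ^ n) * g (A + t • (x - A))) := hmeas.lintegral_prod_right'
  rw [hrestr, ← lintegral_indicator he, lintegral_map (hmeas1.indicator he) (by fun_prop)]
  have hW := finrank_orthogonal_unit hν
  -- In coordinates `x = A + H ν + w` on the base, the ray point `A + t (x - A)` is `A + (H t) ν + t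
  -- w`.
  have hstep : ∀ w : ((ℝ ∙ ν)ᗮ : Submodule ℝ (Pt (n + 1))),
      e.indicator (fun x => ∫⁻ t in Ioo (0 : ℝ) 1,
        ENNReal.ofReal (t ^ n) * g (A + t • (x - A))) (x₀ + w) ≤
      ∫⁻ t in Ioo (0 : ℝ) 1,
        ENNReal.ofReal (t ^ n) * T.indicator g (A + (H * t) • ν + t • w) := by
    intro w
    by_cases hw : x₀ + (w : Pt (n + 1)) ∈ e
    · rw [indicator_of_mem hw]
      refine setLIntegral_mono' measurableSet_Ioo fun t ht => ?_
      have h1 : A + t • (x₀ + (w : Pt (n + 1)) - A) = A + (H * t) • ν + t • (w : Pt (n + 1)) := by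
        rw [hx₀]; module
      rw [h1, indicator_of_mem (h1 ▸ hsub _ hw t ht)]
    · rw [indicator_of_notMem hw]; exact zero_le
  have hgT : Measurable (T.indicator g) := hg.indicator hT
  calc ENNReal.ofReal H * ∫⁻ w : ((ℝ ∙ ν)ᗮ : Submodule ℝ (Pt (n + 1))),
        e.indicator (fun x => ∫⁻ t in Ioo (0 : ℝ) 1,
          ENNReal.ofReal (t ^ n) * g (A + t • (x - A))) (x₀ + w)
      ≤ ENNReal.ofReal H * ∫⁻ w : ((ℝ ∙ ν)ᗮ : Submodule ℝ (Pt (n + 1))), ∫⁻ t in Ioo (0 : ℝ) 1,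
        ENNReal.ofReal (t ^ n) * T.indicator g (A + (H * t) • ν + t • w) := by
        gcongr with w; exact hstep w
    _ = ENNReal.ofReal H * ∫⁻ t in Ioo (0 : ℝ) 1,
        ∫⁻ w : ((ℝ ∙ ν)ᗮ : Submodule ℝ (Pt (n + 1))),
        ENNReal.ofReal (t ^ n) * T.indicator g (A + (H * t) • ν + t • w) := by
        rw [lintegral_lintegral_swap (Measurable.aemeasurable (by fun_prop))]
    -- The substitution of `w` for `t w` on the `n`-dimensional complement absorbs exactly the
    -- weight `t ^ n`.
    _ = ENNReal.ofReal H * ∫⁻ t in Ioo (0 : ℝ) 1,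
        ∫⁻ w : ((ℝ ∙ ν)ᗮ : Submodule ℝ (Pt (n + 1))), T.indicator g (A + (H * t) • ν + w) := by
        congr 1
        refine setLIntegral_congr_fun measurableSet_Ioo fun t ht => ?_
        rw [lintegral_const_mul' _ _ ENNReal.ofReal_ne_top,
          lintegral_comp_smul_of_pos volume ht.1 (fun w : ((ℝ ∙ ν)ᗮ : Submodule ℝ (Pt (n + 1))) =>
            T.indicator g (A + (H * t) • ν + w)), hW]
        rfl
    _ ≤ ENNReal.ofReal H * ∫⁻ t : ℝ,
        ∫⁻ w : ((ℝ ∙ ν)ᗮ : Submodule ℝ (Pt (n + 1))), T.indicator g (A + (H * t) • ν + w) := by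
        gcongr; exact Measure.restrict_le_self
    -- The substitution `s = H t` absorbs the factor `H`.
    _ = ∫⁻ s : ℝ, ∫⁻ w : ((ℝ ∙ ν)ᗮ : Submodule ℝ (Pt (n + 1))),
        T.indicator g (A + s • ν + w) := by
        rw [lintegral_comp_smul_of_pos volume hH (fun s => ∫⁻ w : ((ℝ ∙ ν)ᗮ : Submodule ℝ _),
          T.indicator g (A + s • ν + w))]
        simp
    _ = ∫⁻ x in T, g x := by
        rw [← lintegral_eq_lintegral_orthogonal hν A hgT, lintegral_indicator hT]

lemma fderiv_apply_eq_sum {d : ℕ} (φ : Pt d → ℝ) (x v : Pt d) :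
    fderiv ℝ φ x v = ∑ i, v i * pderiv i φ x := by
  conv_lhs => rw [← (EuclideanSpace.basisFun (Fin d) ℝ).sum_repr v]
  simp [pderiv]

lemma sq_fderiv_apply_le {d : ℕ} (φ : Pt d → ℝ) (x v : Pt d) :
    (fderiv ℝ φ x v) ^ 2 ≤ ‖v‖ ^ 2 * ∑ i, (pderiv i φ x) ^ 2 := by
  rw [fderiv_apply_eq_sum, EuclideanSpace.real_norm_sq_eq]
  exact Finset.sum_mul_sq_le_sq_mul_sq _ _ _

/-- The trace inequality on a pyramid with base `e`, apex `A` and height `H`. -/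
lemma trace_inequality {ν : Pt (n + 1)} (hν : ‖ν‖ = 1) {e T : Set (Pt (n + 1))}
    (he : MeasurableSet e) (hT : MeasurableSet T) {A : Pt (n + 1)} {H : ℝ} (hH : 0 < H)
    (hflat : ∀ x ∈ e, ⟪ν, x - A⟫_ℝ = H)
    (hsub : ∀ x ∈ e, ∀ t ∈ Ioo (0 : ℝ) 1, A + t • (x - A) ∈ T)
    {h : ℝ} (hh : ∀ x ∈ e, ‖x - A‖ ≤ h) {φ : Pt (n + 1) → ℝ} (hφ : ContDiff ℝ ∞ φ) :
    ENNReal.ofReal H * sqInt ((surface (n + 1)).restrict e) φ ≤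
      (n + 2 : ℕ) * sqInt (volume.restrict T) φ +
        ENNReal.ofReal (h ^ 2) * ∑ i, sqInt (volume.restrict T) (pderiv i φ) := by
  have hc := hφ.continuous
  have hci : ∀ i, Continuous (pderiv i φ) := fun i => (contDiff_pderiv hφ).continuous
  -- The coefficient `n + 2` is `n + 1` from differentiating `t ^ (n + 1)`, plus one from Young's
  -- inequality for the cross term.
  set G : Pt (n + 1) → ℝ := fun y => (n + 2 : ℕ) * φ y ^ 2 + h ^ 2 * ∑ i, pderiv i φ y ^ 2 with hG
  have hGc : Continuous G := by fun_prop
  have hG0 : ∀ y, 0 ≤ G y := fun y => by positivity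
  have hpt : ∀ x ∈ e, ‖φ x‖ₑ ^ 2 ≤ ∫⁻ t in Ioo (0 : ℝ) 1,
      ENNReal.ofReal (t ^ n) * ENNReal.ofReal (G (A + t • (x - A))) := by
    intro x hx
    -- The factor `t ^ (n + 1)` kills the value at the apex, and its derivative leaves the weight `t
    -- ^ n`, which is the Jacobian of polar coordinates around the apex.
    have hder : ∀ t ∈ uIcc (0 : ℝ) 1, HasDerivAt (fun t : ℝ => t ^ (n + 1) * φ (A + t • (x - A)) ^ 2)
        (((n + 1 : ℕ) * t ^ n) * φ (A + t • (x - A)) ^ 2 + t ^ (n + 1) *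
          (2 * φ (A + t • (x - A)) * fderiv ℝ φ (A + t • (x - A)) (x - A))) t := by
      intro t _
      have h1 : HasDerivAt (fun t : ℝ => A + t • (x - A)) (x - A) t := by
        simpa using ((hasDerivAt_id t).smul_const (x - A)).const_add A
      have h2 := ((hφ.differentiable (by simp)) (A + t • (x - A))).hasFDerivAt.comp_hasDerivAt t h1
      have h3 := (hasDerivAt_pow (n + 1) t).mul (h2.pow 2)
      convert! h3 using 1
      simp
    have hcd : Continuous (fderiv ℝ φ) := hφ.continuous_fderiv (by simp)
    have hint := intervalIntegral.integral_eq_sub_of_hasDerivAt hder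
      (Continuous.intervalIntegrable (by fun_prop) _ _)
    have hle : φ x ^ 2 ≤ ∫ t in (0 : ℝ)..1, t ^ n * G (A + t • (x - A)) := by
      have : φ x ^ 2 = (1 : ℝ) ^ (n + 1) * φ (A + (1 : ℝ) • (x - A)) ^ 2 -
          (0 : ℝ) ^ (n + 1) * φ (A + (0 : ℝ) • (x - A)) ^ 2 := by simp
      rw [this, ← hint]
      refine intervalIntegral.integral_mono_on zero_le_one
        (Continuous.intervalIntegrable (by fun_prop) _ _)
        (Continuous.intervalIntegrable (by fun_prop) _ _) fun t ht => ?_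
      set y := A + t • (x - A)
      have h1 := sq_fderiv_apply_le φ y (x - A)
      have h2 : ‖x - A‖ ^ 2 * ∑ i, pderiv i φ y ^ 2 ≤ h ^ 2 * ∑ i, pderiv i φ y ^ 2 := by
        gcongr
        exact hh x hx
      have h3 : 2 * t * φ y * fderiv ℝ φ y (x - A) ≤ φ y ^ 2 + h ^ 2 * ∑ i, pderiv i φ y ^ 2 := by
        have ht2 : t ^ 2 ≤ 1 := by nlinarith [ht.1, ht.2]
        have h4 : t ^ 2 * (fderiv ℝ φ y (x - A)) ^ 2 ≤ (fderiv ℝ φ y (x - A)) ^ 2 :=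
          mul_le_of_le_one_left (sq_nonneg _) ht2
        nlinarith [sq_nonneg (φ y - t * fderiv ℝ φ y (x - A))]
      have h5 := mul_le_mul_of_nonneg_left h3 (pow_nonneg ht.1 n)
      simp only [hG]
      push_cast
      have h6 : t ^ (n + 1) * (2 * φ y * fderiv ℝ φ y (x - A)) =
          t ^ n * (2 * t * φ y * fderiv ℝ φ y (x - A)) := by ring
      rw [h6]
      linarith
    rw [enorm_sq_eq_ofReal]
    refine (ENNReal.ofReal_le_ofReal hle).trans ?_
    have hcont : Continuous fun t : ℝ => t ^ n * G (A + t • (x - A)) := by fun_prop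
    rw [intervalIntegral.integral_of_le zero_le_one, integral_Ioc_eq_integral_Ioo,
      ofReal_integral_eq_lintegral_ofReal
        (hcont.integrableOn_Icc.mono_set Ioo_subset_Icc_self)
        (ae_restrict_of_forall_mem measurableSet_Ioo fun t ht =>
          mul_nonneg (pow_nonneg ht.1.le _) (hG0 _))]
    refine (setLIntegral_congr_fun measurableSet_Ioo fun t ht => ?_).le
    rw [ENNReal.ofReal_mul (pow_nonneg ht.1.le _)]
  calc ENNReal.ofReal H * sqInt ((surface (n + 1)).restrict e) φ
      ≤ ENNReal.ofReal H * ∫⁻ x in e, (∫⁻ t in Ioo (0 : ℝ) 1,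
        ENNReal.ofReal (t ^ n) * ENNReal.ofReal (G (A + t • (x - A)))) ∂(surface (n + 1)) := by
        gcongr
        exact setLIntegral_mono' he hpt
    _ ≤ ∫⁻ x in T, ENNReal.ofReal (G x) :=
        lintegral_pyramid_le hν he hT hH hflat hsub (g := fun x => ENNReal.ofReal (G x))
          (by fun_prop)
    _ = ∫⁻ x in T, ((n + 2 : ℕ) * ‖φ x‖ₑ ^ 2 +
          ENNReal.ofReal (h ^ 2) * ∑ i, ‖pderiv i φ x‖ₑ ^ 2) := by
        refine lintegral_congr fun x => ?_
        simp only [hG, enorm_sq_eq_ofReal]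
        rw [ENNReal.ofReal_add (by positivity) (by positivity), ENNReal.ofReal_mul (by positivity),
          ENNReal.ofReal_mul (by positivity), ENNReal.ofReal_natCast,
          ENNReal.ofReal_sum_of_nonneg fun i _ => by positivity]
    _ = _ := by
        rw [lintegral_add_left (by fun_prop), lintegral_const_mul' _ _ (by simp),
          lintegral_const_mul' _ _ ENNReal.ofReal_ne_top, lintegral_finsetSum _ (by fun_prop)]
        rfl

end Pyramid

/-! ### The divergence theorem on polytopes -/

section Divergence

/-- A preconnected set that avoids the frontier of `A` lies in `A` or in its complement. -/
lemma preconnected_subset_or_compl {X : Type*} [TopologicalSpace X] {U A : Set X}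
    (hU : IsPreconnected U) (h : Disjoint U (frontier A)) : U ⊆ A ∨ U ⊆ Aᶜ := by
  have hsub : U ⊆ interior A ∪ interior Aᶜ := by
    intro x hx
    by_contra hc
    rw [mem_union, not_or, interior_compl, mem_compl_iff, not_not] at hc
    exact h.le_bot ⟨hx, hc.2, hc.1⟩
  rcases hU.subset_or_subset isOpen_interior isOpen_interior
    (disjoint_compl_right.mono interior_subset interior_subset) hsub with h | h
  · exact Or.inl (h.trans interior_subset)
  · exact Or.inr (h.trans interior_subset)

/-- The fundamental theorem of calculus on a compact set of reals with finite frontier, at each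
point of which the set lies on one side only. -/
lemma setIntegral_deriv_eq_sum {ι : Type*} (I : Finset ι) (z s : ι → ℝ)
    (hs : ∀ j ∈ I, s j = 1 ∨ s j = -1) (hz : Set.InjOn z I) {A : Set ℝ} (hA : IsCompact A)
    (hfr : ∀ t ∈ frontier A, ∃ j ∈ I, z j = t)
    (hloc : ∀ j ∈ I, ∀ᶠ t in 𝓝[>] (0 : ℝ), z j - t * s j ∈ A ∧ z j + t * s j ∉ A)
    {f f' : ℝ → ℝ} (hf : ∀ t, HasDerivAt f (f' t) t) (hf' : Continuous f') :
    ∫ t in A, f' t = ∑ j ∈ I, s j * f (z j) := by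
  classical
  -- Each right endpoint (`s j = 1`) adds one and each left endpoint subtracts one for points to its
  -- left, so `J` should count whether `t` lies in `A`.
  set J : ℝ → ℝ := fun t => ∑ j ∈ I, if t < z j then s j else 0 with hJ
  -- The right-continuous modification of `A`: it differs from `A` only on the frontier, and its
  -- indicator is continuous from the right, as `J` is.
  set A' : Set ℝ := {t | ∀ᶠ u in 𝓝[>] t, u ∈ A} with hA'
  have hfin : (z '' I).Finite := I.finite_toSet.image z
  have hfrfin : (frontier A).Finite := hfin.subset fun t ht => by
    obtain ⟨j, hj, rfl⟩ := hfr t ht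
    exact ⟨j, hj, rfl⟩
  have havoid : ∀ x : ℝ, ∀ᶠ u in 𝓝[≠] x, u ∉ frontier A := fun x => by
    have h1 : (frontier A \ {x})ᶜ ∈ 𝓝 x :=
      (hfrfin.subset sdiff_subset).isClosed.isOpen_compl.mem_nhds fun h => h.2 rfl
    filter_upwards [nhdsWithin_le_nhds h1, self_mem_nhdsWithin] with u hu hux huA
    exact hu ⟨huA, hux⟩
  have hR : ∀ x : ℝ, (∀ᶠ u in 𝓝[>] x, u ∈ A) ∨ ∀ᶠ u in 𝓝[>] x, u ∉ A := by
    intro x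
    have h1 : ∀ᶠ u in 𝓝[>] x, u ∉ frontier A :=
      (havoid x).filter_mono (nhdsWithin_mono _ fun y (hy : x < y) => hy.ne')
    obtain ⟨b, hb, hsub⟩ := (mem_nhdsGT_iff_exists_Ioo_subset).1 h1
    have h2 : Disjoint (Ioo x b) (frontier A) := Set.disjoint_left.2 fun y hy => hsub hy
    have h3 : Ioo x b ∈ 𝓝[>] x := Ioo_mem_nhdsGT hb
    rcases preconnected_subset_or_compl isPreconnected_Ioo h2 with h | h
    · exact Or.inl (mem_of_superset h3 h)
    · exact Or.inr (mem_of_superset h3 h)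
  have hmem : ∀ y, A ∈ 𝓝 y → y ∈ A' := fun y hy => nhdsWithin_le_nhds hy
  have hnot : ∀ y, Aᶜ ∈ 𝓝 y → y ∉ A' := fun y hy hy' => by
    have h1 : ∀ᶠ u in 𝓝[>] y, u ∈ Aᶜ := nhdsWithin_le_nhds hy
    obtain ⟨u, hu, hu'⟩ := (h1.and hy').exists
    exact hu hu'
  have hev : ∀ (B : Set ℝ) (x : ℝ) (S : Set ℝ), IsOpen S → (∀ᶠ u in 𝓝[S] x, u ∈ B) →
      ∀ᶠ y in 𝓝[S] x, B ∈ 𝓝 y := by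
    intro B x S hS h
    filter_upwards [eventually_eventually_nhdsWithin.2 h, self_mem_nhdsWithin] with y hy hyS
    rwa [hS.nhdsWithin_eq hyS] at hy
  -- The jumps of the indicator and of `J` cancel at every point, so `g` is locally constant. It
  -- vanishes far to the right, hence everywhere.
  set g : ℝ → ℝ := fun t => A'.indicator 1 t - J t with hg
  have hright : ∀ x, ∀ᶠ y in 𝓝[>] x, g y = g x := by
    intro x
    have h1 : ∀ᶠ y in 𝓝[>] x, J y = J x := by
      have : ∀ j ∈ I, ∀ᶠ y in 𝓝[>] x, (if y < z j then s j else 0) =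
          if x < z j then s j else 0 := by
        intro j _
        rcases lt_or_ge x (z j) with h | h
        · filter_upwards [nhdsWithin_le_nhds (Iio_mem_nhds h)] with y (hy : y < z j)
          rw [if_pos hy, if_pos h]
        · filter_upwards [self_mem_nhdsWithin] with y (hy : x < y)
          rw [if_neg (by linarith), if_neg (by linarith)]
      filter_upwards [(Finset.eventually_all I).2 this] with y hy
      exact Finset.sum_congr rfl hy
    rcases hR x with h | h
    · filter_upwards [h1, hev A x (Ioi x) isOpen_Ioi h] with y hy hyA
      simp [hg, hy, indicator_of_mem (hmem y hyA), indicator_of_mem (show x ∈ A' from h)]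
    · have hx : x ∉ A' := fun h' => by
        obtain ⟨u, hu, hu'⟩ := (h.and h').exists
        exact hu hu'
      filter_upwards [h1, hev Aᶜ x (Ioi x) isOpen_Ioi h] with y hy hyA
      simp [hg, hy, indicator_of_notMem (hnot y hyA), indicator_of_notMem hx]
  have hleft : ∀ x, ∀ᶠ y in 𝓝[<] x, g y = g x := by
    intro x
    have h1 : ∀ᶠ y in 𝓝[<] x, J y = J x + ∑ j ∈ I, if z j = x then s j else 0 := by
      have : ∀ j ∈ I, ∀ᶠ y in 𝓝[<] x, (if y < z j then s j else 0) =
          (if x < z j then s j else 0) + if z j = x then s j else 0 := by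
        intro j _
        rcases lt_trichotomy x (z j) with h | h | h
        · filter_upwards [self_mem_nhdsWithin] with y (hy : y < x)
          rw [if_pos (hy.trans h), if_pos h, if_neg h.ne', add_zero]
        · filter_upwards [self_mem_nhdsWithin] with y (hy : y < x)
          rw [if_pos (h ▸ hy), if_neg h.not_lt, if_pos h.symm, zero_add]
        · filter_upwards [nhdsWithin_le_nhds (Ioi_mem_nhds h)] with y (hy : z j < y)
          rw [if_neg (by linarith), if_neg (by linarith), if_neg h.ne, add_zero]
      filter_upwards [(Finset.eventually_all I).2 this] with y hy
      rw [hJ, ← Finset.sum_add_distrib]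
      exact Finset.sum_congr rfl hy
    by_cases hx : ∃ j ∈ I, z j = x
    · obtain ⟨j, hj, rfl⟩ := hx
      have h2 : ∑ i ∈ I, (if z i = z j then s i else 0) = s j := by
        rw [Finset.sum_eq_single_of_mem j hj, if_pos rfl]
        intro i hi hij
        rw [if_neg fun h => hij (hz hi hj h)]
      rw [h2] at h1
      have ht : Tendsto (fun u => u - z j) (𝓝[>] (z j)) (𝓝[>] 0) := by
        refine tendsto_nhdsWithin_iff.2 ⟨?_, ?_⟩
        · have : Tendsto (fun u => u - z j) (𝓝 (z j)) (𝓝 (z j - z j)) :=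
            (continuous_id.sub continuous_const).tendsto _
          rw [sub_self] at this
          exact this.mono_left nhdsWithin_le_nhds
        · filter_upwards [self_mem_nhdsWithin] with u (hu : z j < u)
          exact sub_pos.2 hu
      have ht' : Tendsto (fun u => z j - u) (𝓝[<] (z j)) (𝓝[>] 0) := by
        refine tendsto_nhdsWithin_iff.2 ⟨?_, ?_⟩
        · have : Tendsto (fun u => z j - u) (𝓝 (z j)) (𝓝 (z j - z j)) :=
            (continuous_const.sub continuous_id).tendsto _
          rw [sub_self] at this
          exact this.mono_left nhdsWithin_le_nhds
        · filter_upwards [self_mem_nhdsWithin] with u (hu : u < z j)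
          exact sub_pos.2 hu
      have hr := ht.eventually (hloc j hj)
      have hl := ht'.eventually (hloc j hj)
      rcases hs j hj with h | h
      · simp only [h, mul_one] at hr hl h1
        have hxA : z j ∉ A' := fun h' => by
          obtain ⟨u, hu, hu'⟩ := (hr.and h').exists
          exact hu.2 (by simpa using hu')
        have hlA : ∀ᶠ u in 𝓝[<] (z j), u ∈ A := hl.mono fun u hu => by simpa using hu.1
        filter_upwards [h1, hev A _ (Iio _) isOpen_Iio hlA] with y hy hyA
        simp [hg, hy, indicator_of_mem (hmem y hyA), indicator_of_notMem hxA]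
      · simp only [h] at hr hl h1
        have hxA : z j ∈ A' := hr.mono fun u hu => by
          have := hu.1; ring_nf at this; exact this
        have hlA : ∀ᶠ u in 𝓝[<] (z j), u ∈ Aᶜ := hl.mono fun u hu => by
          have := hu.2; ring_nf at this; exact this
        filter_upwards [h1, hev Aᶜ _ (Iio _) isOpen_Iio hlA] with y hy hyA
        simp [hg, hy, indicator_of_notMem (hnot y hyA), indicator_of_mem hxA]
        ring
    · have h2 : ∑ i ∈ I, (if z i = x then s i else 0) = 0 :=
        Finset.sum_eq_zero fun i hi => if_neg fun h => hx ⟨i, hi, h⟩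
      rw [h2] at h1
      have hxf : x ∉ frontier A := fun h => hx (hfr x h)
      have hcases : A ∈ 𝓝 x ∨ Aᶜ ∈ 𝓝 x := by
        rw [frontier_eq_closure_inter_closure, mem_inter_iff, not_and_or,
          ← mem_compl_iff, ← mem_compl_iff, ← interior_compl, ← interior_compl, compl_compl,
          mem_interior_iff_mem_nhds, mem_interior_iff_mem_nhds] at hxf
        exact hxf.symm
      rcases hcases with h | h
      · filter_upwards [h1, nhdsWithin_le_nhds (eventually_mem_nhds_iff.2 h)] with y hy hyA
        simp [hg, hy, indicator_of_mem (hmem y hyA), indicator_of_mem (hmem x h)]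
      · filter_upwards [h1, nhdsWithin_le_nhds (eventually_mem_nhds_iff.2 h)] with y hy hyA
        simp [hg, hy, indicator_of_notMem (hnot y hyA), indicator_of_notMem (hnot x h)]
  have hconst : ∀ x y, g x = g y := by
    have : IsLocallyConstant g := by
      rw [IsLocallyConstant.iff_eventually_eq]
      intro x
      rw [← nhdsLT_sup_nhdsGE, ← nhdsGT_sup_nhdsWithin_singleton, eventually_sup, eventually_sup]
      refine ⟨hleft x, hright x, by simp⟩
    intro x y
    exact this.apply_eq_of_preconnectedSpace x y
  obtain ⟨R, hRA, hRz⟩ : ∃ R : ℝ, A ⊆ Ioo (-R) R ∧ ∀ j ∈ I, z j ∈ Ioo (-R) R := by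
    obtain ⟨R, hR⟩ := ((hA.isBounded.union hfin.isBounded)).subset_ball 0
    rw [Real.ball_zero_eq_Ioo] at hR
    exact ⟨R, subset_union_left.trans hR, fun j hj => hR (Or.inr ⟨j, hj, rfl⟩)⟩
  have hgR : g R = 0 := by
    have h1 : R ∉ A' := fun h => by
      have h' : ∀ᶠ u in 𝓝[>] R, u ∈ A := h
      obtain ⟨u, hu, hu'⟩ := (h'.and self_mem_nhdsWithin).exists
      exact absurd (hRA hu).2 (not_lt.2 (le_of_lt hu'))
    have h2 : J R = 0 := Finset.sum_eq_zero fun j hj => if_neg (not_lt.2 (hRz j hj).2.le)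
    simp [hg, h1, h2]
  have hJA : ∀ t, A'.indicator 1 t = J t := fun t => by
    have := (hconst t R).trans hgR
    simp only [hg] at this
    linarith
  -- Evaluate `J` to the left of everything, where the indicator is zero. This cancels the
  -- contributions of the lower limit `-R` below.
  have hsum : ∑ j ∈ I, s j = 0 := by
    rcases isEmpty_or_nonempty I with hI | hI
    · have : I = ∅ := by simpa [Finset.isEmpty_coe_sort] using hI
      simp [this]
    obtain ⟨j₀, hj₀⟩ := hI
    have hlt : -R < R := (hRz j₀ hj₀).1.trans (hRz j₀ hj₀).2
    have h1 : (-R) ∉ A' := by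
      refine hnot _ ?_
      exact hA.isClosed.isOpen_compl.mem_nhds fun h => lt_irrefl _ (hRA h).1
    have h2 := hJA (-R)
    rw [indicator_of_notMem h1] at h2
    rw [h2]
    exact Finset.sum_congr rfl fun j hj => (if_pos (hRz j hj).1).symm
  -- The indicator of `A` is thus an alternating sum of indicators of intervals with common left end
  -- `-R`, to each of which the ordinary fundamental theorem applies.
  have hae : ∀ᵐ t : ℝ, A.indicator f' t = ∑ j ∈ I, s j * (Ioo (-R) (z j)).indicator f' t := by
    have hnull : ∀ᵐ t : ℝ, t ∉ frontier A := by
      rw [ae_iff]; simpa using hfrfin.measure_zero volume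
    filter_upwards [hnull] with t ht
    have hiff : t ∈ A ↔ t ∈ A' := by
      rw [frontier_eq_closure_inter_closure, mem_inter_iff, not_and_or,
          ← mem_compl_iff, ← mem_compl_iff, ← interior_compl, ← interior_compl, compl_compl,
          mem_interior_iff_mem_nhds, mem_interior_iff_mem_nhds] at ht
      rcases ht with ht | ht
      · exact ⟨fun h => absurd h (mem_of_mem_nhds ht), fun h => absurd h (hnot t ht)⟩
      · exact ⟨fun _ => hmem t ht, fun _ => mem_of_mem_nhds ht⟩
    have h1 : A.indicator f' t = A'.indicator 1 t * f' t := by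
      by_cases h : t ∈ A
      · simp [h, hiff.1 h]
      · simp [h, mt hiff.2 h]
    rw [h1, hJA]
    simp only [hJ]
    rcases lt_or_ge (-R) t with htR | htR
    · rw [Finset.sum_mul]
      refine Finset.sum_congr rfl fun j _ => ?_
      by_cases htz : t < z j
      · simp [htz, htR]
      · simp [htz]
    · have : ∀ j ∈ I, (if t < z j then s j else 0) = s j := fun j hj =>
        if_pos (htR.trans_lt (hRz j hj).1)
      rw [Finset.sum_congr rfl this, hsum, zero_mul]
      refine (Finset.sum_eq_zero fun j _ => ?_).symm
      rw [indicator_of_notMem (fun h => absurd h.1 (not_lt.2 htR)), mul_zero]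
  rw [← integral_indicator hA.measurableSet, integral_congr_ae hae, integral_finsetSum]
  · have : ∀ j ∈ I, ∫ t, s j * (Ioo (-R) (z j)).indicator f' t = s j * f (z j) - s j * f (-R) := by
      intro j hj
      rw [integral_const_mul, integral_indicator measurableSet_Ioo, ← integral_Ioc_eq_integral_Ioo,
        ← intervalIntegral.integral_of_le (hRz j hj).1.le,
        intervalIntegral.integral_eq_sub_of_hasDerivAt (fun t _ => hf t)
          (hf'.intervalIntegrable _ _), mul_sub]
    rw [Finset.sum_congr rfl this, Finset.sum_sub_distrib, ← Finset.sum_mul, hsum]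
    simp
  · intro j _
    refine Integrable.const_mul ?_ _
    rw [integrable_indicator_iff measurableSet_Ioo]
    exact hf'.integrableOn_Icc.mono_set Ioo_subset_Icc_self

end Divergence

/-! ### Half balls at the faces, and Fubini along coordinate lines -/

section Divergence

lemma volume_hyperplane_eq_zero {d : ℕ} {ν : Pt d} (hν : ν ≠ 0) (a : ℝ) :
    volume {x : Pt d | ⟪ν, x⟫_ℝ = a} = 0 := by
  rcases Set.eq_empty_or_nonempty {x : Pt d | ⟪ν, x⟫_ℝ = a} with h | ⟨x₀, hx₀⟩
  · rw [h, measure_empty]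
  have hx₀' : ⟪ν, x₀⟫_ℝ = a := hx₀
  have hset : {x : Pt d | ⟪ν, x⟫_ℝ = a} = (AffineSubspace.mk' x₀ (ℝ ∙ ν)ᗮ : Set (Pt d)) := by
    ext x
    rw [SetLike.mem_coe, AffineSubspace.mem_mk', vsub_eq_sub,
      Submodule.mem_orthogonal_singleton_iff_inner_right, inner_sub_right, hx₀', sub_eq_zero]
    rfl
  rw [hset]
  refine Measure.addHaar_affineSubspace _ _ fun htop => ?_
  have h1 : x₀ + ν ∈ AffineSubspace.mk' x₀ (ℝ ∙ ν)ᗮ := htop ▸ AffineSubspace.mem_top ℝ _ _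
  rw [AffineSubspace.mem_mk', Submodule.mem_orthogonal_singleton_iff_inner_right] at h1
  simp only [vsub_eq_sub, add_sub_cancel_left, inner_self_eq_zero] at h1
  exact hν h1

lemma volume_flat_eq_zero {d : ℕ} {ν : Pt d} (hν : ‖ν‖ = 1) {e : Set (Pt d)}
    (hflat : ∀ x ∈ e, ∀ y ∈ e, ⟪ν, x - y⟫_ℝ = 0) : volume e = 0 := by
  rcases e.eq_empty_or_nonempty with rfl | ⟨x₀, hx₀⟩
  · simp
  refine measure_mono_null (fun x hx => ?_)
    (volume_hyperplane_eq_zero (ν := ν) (by rintro rfl; simp at hν) ⟪ν, x₀⟫_ℝ)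
  have := hflat x hx x₀ hx₀
  rw [inner_sub_right, sub_eq_zero] at this
  exact this

/-- Near a point of exactly one face, with outward normal `ν`, the set `T` is a half ball. -/
lemma eventually_mem_of_outward {d : ℕ} {T e : Set (Pt d)} {K : Set (Pt d)} (hK : IsClosed K)
    (hcover : frontier T ⊆ e ∪ K) {ν x : Pt d} (hν : ‖ν‖ = 1)
    (hflat : ∀ y ∈ e, ⟪ν, y - x⟫_ℝ = 0) (hxK : x ∉ K)
    (hout : ∀ᶠ t : ℝ in 𝓝[>] 0, x + t • ν ∉ T ∧ x - t • ν ∈ interior T)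
    {v : Pt d} (hv : 0 < ⟪ν, v⟫_ℝ) :
    ∀ᶠ t : ℝ in 𝓝[>] 0, x - t • v ∈ T ∧ x + t • v ∉ T := by
  obtain ⟨r, hr, hball⟩ := Metric.isOpen_iff.1 hK.isOpen_compl x hxK
  have hconv : ∀ s : ℝ, Convex ℝ {y : Pt d | 0 < s * ⟪ν, y - x⟫_ℝ} := by
    intro s
    have : {y : Pt d | 0 < s * ⟪ν, y - x⟫_ℝ} = {y : Pt d | s * ⟪ν, x⟫_ℝ < ⟪s • ν, y⟫_ℝ} := by
      ext y
      simp only [mem_ofPred_eq, inner_sub_right, inner_smul_left, mul_sub, sub_pos]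
      rfl
    rw [this]
    exact convex_halfSpace_gt (innerSL ℝ (s • ν)).isLinear _
  -- An open half ball off the hyperplane of `e` and away from `K` does not meet the frontier of
  -- `T`; being convex, it lies on one side of it.
  have hside : ∀ s : ℝ,
      Metric.ball x r ∩ {y | 0 < s * ⟪ν, y - x⟫_ℝ} ⊆ T ∨
      Metric.ball x r ∩ {y | 0 < s * ⟪ν, y - x⟫_ℝ} ⊆ Tᶜ := by
    intro s
    refine preconnected_subset_or_compl ((convex_ball x r).inter (hconv s)).isPreconnected
      (Set.disjoint_left.2 fun y hy hyT => ?_)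
    rcases hcover hyT with h | h
    · have h2 := hy.2
      simp only [mem_ofPred_eq, hflat y h, mul_zero, lt_irrefl] at h2
    · exact hball hy.1 h
  have hsmall : ∀ (w : Pt d) (s : ℝ), 0 < s * ⟪ν, w⟫_ℝ → ∀ᶠ t : ℝ in 𝓝[>] 0,
      x + t • w ∈ Metric.ball x r ∩ {y | 0 < s * ⟪ν, y - x⟫_ℝ} := by
    intro w s hs
    have hc : Continuous fun t : ℝ => x + t • w := by fun_prop
    have h1 : ∀ᶠ t : ℝ in 𝓝[>] 0, x + t • w ∈ Metric.ball x r :=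
      nhdsWithin_le_nhds (hc.continuousAt.eventually_mem
        (Metric.isOpen_ball.mem_nhds (by simpa using hr)))
    filter_upwards [h1, self_mem_nhdsWithin] with t ht (ht0 : 0 < t)
    refine ⟨ht, ?_⟩
    simp only [mem_ofPred_eq, add_sub_cancel_left, inner_smul_right]
    nlinarith [mul_pos ht0 hs]
  have hνν : ⟪ν, ν⟫_ℝ = 1 := by rw [real_inner_self_eq_norm_sq, hν]; norm_num
  have hpos := hsmall ν 1 (by rw [hνν]; norm_num)
  have hneg := hsmall (-ν) (-1) (by rw [inner_neg_right, hνν]; norm_num)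
  -- The behaviour along `±ν`, which is known, decides on which side each half ball lies; any
  -- direction `v` with positive normal component then follows.
  have hupper : Metric.ball x r ∩ {y | 0 < 1 * ⟪ν, y - x⟫_ℝ} ⊆ Tᶜ := by
    refine (hside 1).resolve_left fun h => ?_
    obtain ⟨t, ht, ht'⟩ := (hpos.and hout).exists
    exact ht'.1 (h ht)
  have hlower : Metric.ball x r ∩ {y | 0 < (-1) * ⟪ν, y - x⟫_ℝ} ⊆ T := by
    refine (hside (-1)).resolve_right fun h => ?_
    obtain ⟨t, ht, ht'⟩ := (hneg.and hout).exists
    refine h ht ?_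
    rw [smul_neg, ← sub_eq_add_neg]
    exact interior_subset ht'.2
  filter_upwards [hsmall v 1 (by simpa using hv), hsmall (-v) (-1) (by simpa using hv)]
    with t h1 h2
  refine ⟨?_, hupper h1⟩
  rw [smul_neg, ← sub_eq_add_neg] at h2
  exact hlower h2

variable {n : ℕ}

lemma hasDerivAt_comp_linePt (i : Fin (n + 1)) (y : Pt n) {F : Pt (n + 1) → ℝ}
    (hF : Differentiable ℝ F) (s : ℝ) :
    HasDerivAt (fun s => F (linePt i y s)) (pderiv i F (linePt i y s)) s := by
  have h1 : HasDerivAt (fun s => linePt i y s) (EuclideanSpace.single i 1) s := by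
    have : (fun s => linePt i y s) =
        fun s : ℝ => linePt i y 0 + s • EuclideanSpace.single i (1 : ℝ) := by
      funext s; rw [← linePt_add, zero_add]
    rw [this]
    simpa using ((hasDerivAt_id s).smul_const (EuclideanSpace.single i (1 : ℝ))).const_add
      (linePt i y 0)
  exact (hF (linePt i y s)).hasFDerivAt.comp_hasDerivAt s h1

/-- The divergence theorem on a polytope with flat faces, for the field `F eᵢ`. -/
theorem setIntegral_pderiv_eq_sum_faces {T : Set (Pt (n + 1))} (hT : IsCompact T)
    (I : Finset (Set (Pt (n + 1)))) (ν : Set (Pt (n + 1)) → Pt (n + 1))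
    (hν : ∀ e ∈ I, ‖ν e‖ = 1) (hcpt : ∀ e ∈ I, IsCompact e)
    (hflat : ∀ e ∈ I, ∀ x ∈ e, ∀ y ∈ e, ⟪ν e, x - y⟫_ℝ = 0)
    (hcover : frontier T ⊆ ⋃ e ∈ I, e)
    (hov : ∀ e ∈ I, ∀ e' ∈ I, e ≠ e' → surface (n + 1) (e ∩ e') = 0)
    (hfin : ∀ e ∈ I, surface (n + 1) e < ⊤)
    (hout : ∀ e ∈ I, ∀ᵐ x ∂((surface (n + 1)).restrict e), ∀ᶠ t : ℝ in 𝓝[>] 0,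
      x + t • ν e ∉ T ∧ x - t • ν e ∈ interior T)
    (i : Fin (n + 1)) {F : Pt (n + 1) → ℝ} (hF : ContDiff ℝ ∞ F) :
    ∫ x in T, pderiv i F x = ∑ e ∈ I, ν e i * ∫ x in e, F x ∂(surface (n + 1)) := by
  classical
  have ha : ∀ e : Set (Pt (n + 1)), ∃ a : ℝ, e ∈ I → ∀ x ∈ e, ⟪ν e, x⟫_ℝ = a := by
    intro e
    rcases e.eq_empty_or_nonempty with rfl | ⟨x₀, hx₀⟩
    · exact ⟨0, by simp⟩
    · refine ⟨⟪ν e, x₀⟫_ℝ, fun he x hx => ?_⟩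
      have := hflat e he x hx x₀ hx₀
      rwa [inner_sub_right, sub_eq_zero] at this
  choose a ha using ha
  set pt : Set (Pt (n + 1)) → Pt n → Pt (n + 1) := fun e y =>
    linePt i y (crossHeight (ν e) (a e) i y) with hpt
  have hptm : ∀ e, Measurable (pt e) := fun e => by
    refine ((continuous_linePt i).comp (continuous_id.prodMk ?_)).measurable
    simp only
    fun_prop
  -- almost every line in direction `i` meets each face transversally, and one face at a time
  have hgood1 : ∀ e ∈ I, ν e i ≠ 0 → ∀ᵐ y : Pt n, pt e y ∈ e →
      (∀ e' ∈ I, e ≠ e' → pt e y ∉ e') ∧ ∀ᶠ t : ℝ in 𝓝[>] 0,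
        pt e y + t • ν e ∉ T ∧ pt e y - t • ν e ∈ interior T := by
    intro e he hei
    have h1 : ∀ᵐ x ∂((surface (n + 1)).restrict e), ∀ e' ∈ I, e ≠ e' → x ∉ e' := by
      rw [Finset.eventually_all]
      intro e' he'
      by_cases hee : e = e'
      · exact ae_of_all _ fun x h => absurd hee h
      · rw [ae_restrict_iff' (hcpt e he).measurableSet]
        have : ∀ᵐ x ∂(surface (n + 1)), x ∉ e ∩ e' := measure_eq_zero_iff_ae_notMem.1
          (hov e he e' he' hee)
        filter_upwards [this] with x hx hxe _ hxe'
        exact hx ⟨hxe, hxe'⟩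
    have h2 := h1.and (hout e he)
    rw [ae_restrict_iff' (hcpt e he).measurableSet] at h2
    -- A surface-null exceptional set on the face is carried to a Lebesgue-null set of lines, since
    -- the projection of the face scales surface measure by `|ν e i|`.
    have h3 := Measure.ae_smul_measure (ae_restrict_of_ae (s := {x | ⟪ν e, x⟫_ℝ = a e}) h2)
      (ENNReal.ofReal |ν e i|)
    rw [← map_crossHeight (hν e he) hei (a e)] at h3
    exact ae_of_ae_map (hptm e).aemeasurable h3
  -- Lines parallel to a face meet it only if their base point lies in a hyperplane of `ℝⁿ`, a null
  -- set.
  have hgood2 : ∀ e ∈ I, ν e i = 0 → ∀ᵐ y : Pt n, ∀ s, linePt i y s ∉ e := by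
    intro e he hei
    set m : Pt n := WithLp.toLp 2 (fun j => ν e (i.succAbove j)) with hm
    have hm0 : m ≠ 0 := by
      intro h0
      have h1 : ν e = 0 := by
        ext j
        rcases Fin.eq_self_or_eq_succAbove i j with rfl | ⟨j, rfl⟩
        · simpa using hei
        · simpa [hm] using congrArg (fun x : Pt n => x j) h0
      have := hν e he
      simp [h1] at this
    filter_upwards [measure_eq_zero_iff_ae_notMem.1 (volume_hyperplane_eq_zero hm0 (a e))]
      with y hy s hs
    refine hy ?_
    have := ha e he _ hs
    rw [inner_linePt, hei, zero_mul, zero_add] at this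
    rw [PiLp.inner_apply]
    simpa [hm, mul_comm] using this
  have hgood1' : ∀ᵐ y : Pt n, ∀ e ∈ I, ν e i ≠ 0 → pt e y ∈ e →
      (∀ e' ∈ I, e ≠ e' → pt e y ∉ e') ∧ ∀ᶠ t : ℝ in 𝓝[>] 0,
        pt e y + t • ν e ∉ T ∧ pt e y - t • ν e ∈ interior T := by
    rw [Finset.eventually_all]
    intro e he
    by_cases h : ν e i = 0
    · exact ae_of_all _ fun y h' => absurd h h'
    · filter_upwards [hgood1 e he h] with y hy _ using hy
  have hgood2' : ∀ᵐ y : Pt n, ∀ e ∈ I, ν e i = 0 → ∀ s, linePt i y s ∉ e := by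
    rw [Finset.eventually_all]
    intro e he
    by_cases h : ν e i = 0
    · filter_upwards [hgood2 e he h] with y hy _ using hy
    · exact ae_of_all _ fun y h' => absurd h' h
  have hdF : Continuous (pderiv i F) := (contDiff_pderiv hF).continuous
  -- On a generic line the slice of `T` is a compact set of reals whose endpoints are the crossings
  -- with faces; the sign of `ν e i` tells a right endpoint from a left one.
  have hinner : ∀ᵐ y : Pt n, ∫ s, T.indicator (pderiv i F) (linePt i y s) =
      ∑ e ∈ I, SignType.sign (ν e i) * e.indicator F (pt e y) := by
    filter_upwards [hgood1', hgood2'] with y hy1 hy2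
    have hly : Continuous fun s => linePt i y s :=
      (continuous_linePt i).comp (continuous_const.prodMk continuous_id)
    set A : Set ℝ := (fun s => linePt i y s) ⁻¹' T with hA
    have hAc : IsCompact A := by
      refine Metric.isCompact_of_isClosed_isBounded (hT.isClosed.preimage hly) ?_
      refine (((hT.image (show Continuous fun x : Pt (n + 1) => x i by fun_prop))).isBounded).subset
        fun s hs => ⟨_, hs, by simp⟩
    set Iy : Finset (Set (Pt (n + 1))) := I.filter fun e => ν e i ≠ 0 ∧ pt e y ∈ e with hIy
    have hmemIy : ∀ e ∈ Iy, e ∈ I ∧ ν e i ≠ 0 ∧ pt e y ∈ e := fun e he => by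
      simpa [hIy] using he
    have hmain := setIntegral_deriv_eq_sum Iy (fun e => crossHeight (ν e) (a e) i y)
      (fun e => (SignType.sign (ν e i) : ℝ)) ?_ ?_ hAc ?_ ?_
      (hasDerivAt_comp_linePt i y (hF.differentiable (by simp))) (hdF.comp hly)
    · have h1 : ∫ s, T.indicator (pderiv i F) (linePt i y s) =
          ∫ s in A, pderiv i F (linePt i y s) := by
        rw [← integral_indicator hAc.measurableSet]
        rfl
      rw [h1]
      refine hmain.trans ?_
      rw [hIy, Finset.sum_filter]
      refine Finset.sum_congr rfl fun e _ => ?_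
      split_ifs with h
      · rw [indicator_of_mem h.2]
      · by_cases h0 : ν e i = 0
        · simp [h0]
        · rw [indicator_of_notMem fun h' => h ⟨h0, h'⟩, mul_zero]
    · intro e he
      rcases (hmemIy e he).2.1.lt_or_gt with h | h
      · right; simp [sign_neg h]
      · left; simp [sign_pos h]
    · intro e he e' he' hee
      by_contra hne
      obtain ⟨heI, hei, hpe⟩ := hmemIy e he
      obtain ⟨heI', hei', hpe'⟩ := hmemIy e' he'
      refine (hy1 e heI hei hpe).1 e' heI' hne ?_
      have : pt e y = pt e' y := congrArg (linePt i y) hee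
      rwa [this]
    · intro s hs
      have h1 : linePt i y s ∈ frontier T := hly.frontier_preimage_subset T hs
      obtain ⟨e, he, hse⟩ := mem_iUnion₂.1 (hcover h1)
      have hei : ν e i ≠ 0 := fun h => hy2 e he h s hse
      have hsc := (inner_linePt_eq_iff hei (a e) y s).1 (ha e he _ hse)
      refine ⟨e, ?_, hsc.symm⟩
      simp only [hIy, Finset.mem_filter]
      refine ⟨he, hei, ?_⟩
      simp only [hpt]
      rwa [← hsc]
    · intro e he
      obtain ⟨heI, hei, hpe⟩ := hmemIy e he
      obtain ⟨h1, h2⟩ := hy1 e heI hei hpe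
      have hK : IsClosed (⋃ e' ∈ I.erase e, e') :=
        isClosed_biUnion_finset fun e' he' => (hcpt e' (Finset.mem_of_mem_erase he')).isClosed
      have hcov : frontier T ⊆ e ∪ ⋃ e' ∈ I.erase e, e' := by
        intro x hx
        obtain ⟨e', he', hxe'⟩ := mem_iUnion₂.1 (hcover hx)
        by_cases hee : e' = e
        · left; rwa [← hee]
        · right; exact mem_iUnion₂.2 ⟨e', Finset.mem_erase.2 ⟨hee, he'⟩, hxe'⟩
      have hxK : pt e y ∉ ⋃ e' ∈ I.erase e, e' := by
        intro hx
        obtain ⟨e', he', hxe'⟩ := mem_iUnion₂.1 hx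
        exact h1 e' (Finset.mem_of_mem_erase he') (Finset.ne_of_mem_erase he').symm hxe'
      -- The direction is the coordinate vector multiplied by the sign of `ν e i`; its inner product
      -- with the normal is `|ν e i| > 0`.
      have := eventually_mem_of_outward hK hcov (hν e heI) (fun z hz => hflat e heI z hz _ hpe) hxK
        h2 (v := (SignType.sign (ν e i) : ℝ) • EuclideanSpace.single i 1)
        (by
          rw [inner_smul_right]
          have : ⟪ν e, EuclideanSpace.single i (1 : ℝ)⟫_ℝ = ν e i := by
            simp [EuclideanSpace.inner_single_right]
          rw [this, sign_mul_self]
          exact abs_pos.2 hei)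
      refine this.mono fun t ht => ?_
      simp only [hA, mem_preimage, sub_eq_add_neg, ← neg_mul, linePt_add]
      simp only [hpt, sub_eq_add_neg, smul_smul, ← neg_smul, ← neg_mul] at ht
      exact ht
  have hint : Integrable (T.indicator (pderiv i F)) := by
    rw [integrable_indicator_iff hT.measurableSet]
    exact hdF.continuousOn.integrableOn_compact hT
  have hmp := measurePreserving_linePt (n := n) i
  have hfub : ∫ x in T, pderiv i F x = ∫ y, ∫ s, T.indicator (pderiv i F) (linePt i y s) := by
    rw [← integral_indicator hT.measurableSet,
      ← hmp.integral_comp (measurableEmbedding_linePt i), integral_prod]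
    exact (hmp.integrable_comp_emb (measurableEmbedding_linePt i)).2 hint
  -- Integrating a crossing value over all lines gives the face integral with weight `|ν e i|`;
  -- multiplied by the sign from the endpoint rule this becomes `ν e i`.
  have hmap : ∀ e ∈ I, ν e i ≠ 0 → Integrable (fun y => e.indicator F (pt e y)) ∧
      ∫ y, e.indicator F (pt e y) = |ν e i| * ∫ x in e, F x ∂(surface (n + 1)) := by
    intro e he hei
    have hm := map_crossHeight (hν e he) hei (a e)
    have hsub : e ⊆ {x | ⟪ν e, x⟫_ℝ = a e} := fun x hx => ha e he x hx
    have hmeas : StronglyMeasurable (e.indicator F) :=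
      hF.continuous.stronglyMeasurable.indicator (hcpt e he).measurableSet
    have hFe : IntegrableOn F e (surface (n + 1)) := by
      obtain ⟨C, hC⟩ := (hcpt e he).exists_bound_of_continuousOn hF.continuous.continuousOn
      exact Measure.integrableOn_of_bounded (hfin e he).ne hF.continuous.aestronglyMeasurable
        (M := C) (ae_restrict_of_forall_mem (hcpt e he).measurableSet hC)
    have hi2 : Integrable (e.indicator F) (Measure.map (pt e) volume) := by
      rw [hm]
      refine Integrable.smul_measure ?_ ENNReal.ofReal_ne_top
      exact ((integrable_indicator_iff (hcpt e he).measurableSet).2 hFe).mono_measure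
        Measure.restrict_le_self
    refine ⟨hi2.comp_measurable (hptm e), ?_⟩
    rw [← integral_map (hptm e).aemeasurable hmeas.aestronglyMeasurable]
    rw [hm, integral_smul_measure, ENNReal.toReal_ofReal (abs_nonneg _),
      integral_indicator (hcpt e he).measurableSet, Measure.restrict_restrict_of_subset hsub]
    rfl
  rw [hfub, integral_congr_ae hinner, integral_finsetSum]
  · refine Finset.sum_congr rfl fun e he => ?_
    by_cases hei : ν e i = 0
    · simp [hei]
    · rw [integral_const_mul, (hmap e he hei).2, ← mul_assoc, sign_mul_abs]
  · intro e he
    by_cases hei : ν e i = 0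
    · simp [hei]
    · exact (hmap e he hei).1.const_mul _

end Divergence

/-! ### Mollification -/

section Mollify

variable {d : ℕ}

/-- Translations act continuously on `L²`. -/
lemma tendsto_sqInt_translate {v : Pt d → ℝ} (hv : MemLp v 2 volume) :
    Tendsto (fun z : Pt d => sqInt volume (fun x => v (x - z) - v x)) (𝓝 0) (𝓝 0) := by
  -- Continuity of the translation in the compact-open topology is what continuity of composition on
  -- `Lp` asks for.
  let g : Pt d → C(Pt d, Pt d) := fun z => ⟨fun x => x - z, by fun_prop⟩
  have hg : Continuous g := by
    have : Continuous (Function.uncurry fun (z x : Pt d) => x - z) := by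
      simp only [Function.uncurry_def]; fun_prop
    exact (ContinuousMap.curry ⟨_, this⟩).continuous
  have hgm : ∀ z, MeasurePreserving (g z) volume volume := fun z =>
    measurePreserving_sub_right volume z
  have h1 : Tendsto (fun z => Lp.compMeasurePreserving (g z) (hgm z) (hv.toLp v)) (𝓝 0)
      (𝓝 (Lp.compMeasurePreserving (g 0) (hgm 0) (hv.toLp v))) :=
    Tendsto.compMeasurePreservingLp tendsto_const_nhds (hg.tendsto 0) hgm (hgm 0) (by simp)
  rw [tendsto_iff_edist_tendsto_0] at h1
  simp only [Lp.toLp_compMeasurePreserving, Lp.edist_toLp_toLp] at h1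
  have h2 := h1.ennrpow_const (r := 2)
  simp only [ENNReal.rpow_ofNat, ← sqInt_eq_eLpNorm_sq] at h2
  have h3 : ∀ z, sqInt volume (fun x => v (x - z) - v x) = sqInt volume (v ∘ g z - v ∘ g 0) := by
    intro z
    congr 1
    funext x
    simp [g]
  simp only [h3]
  simpa using h2

/-- Mollification with nonnegative kernels of mass one whose supports shrink to the origin converges
in `L²`. -/
lemma tendsto_sqInt_convolution {v : Pt d → ℝ} (hv : MemLp v 2 volume) {K : ℕ → Pt d → ℝ}
    (hKc : ∀ m, Continuous (K m)) (hK0 : ∀ m z, 0 ≤ K m z) (hK1 : ∀ m, ∫ z, K m z = 1)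
    {δ : ℕ → ℝ} (hδ : Tendsto δ atTop (𝓝 0)) (hKs : ∀ m z, δ m < ‖z‖ → K m z = 0) :
    Tendsto (fun m => sqInt volume (fun x => (∫ y, v y * K m (x - y)) - v x)) atTop (𝓝 0) := by
  wlog hvm : StronglyMeasurable v generalizing v
  -- Passing to a measurable representative changes neither the convolution nor the seminorm; joint
  -- measurability is needed for Tonelli below.
  · have hae := hv.1.ae_eq_mk
    have h1 := this (v := hv.1.mk v) ((memLp_congr_ae hae).1 hv) hv.1.stronglyMeasurable_mk
    refine h1.congr fun m => sqInt_congr ?_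
    filter_upwards [hae] with x hx
    rw [← hx]
    congr 1
    refine integral_congr_ae ?_
    filter_upwards [hae] with y hy
    rw [hy]
  have hcs : ∀ m, HasCompactSupport (K m) := fun m => by
    refine HasCompactSupport.of_support_subset_isCompact (isCompact_closedBall 0 (δ m)) ?_
    intro z hz
    rw [mem_closedBall_zero_iff]
    by_contra hc
    exact hz (hKs m z (not_le.1 hc))
  have hKi : ∀ m, Integrable (K m) := fun m => (hKc m).integrable_of_hasCompactSupport (hcs m)
  have hvl : LocallyIntegrable v volume := hv.locallyIntegrable (by norm_num)
  set τ : Pt d → ℝ≥0∞ := fun z => sqInt volume (fun x => v (x - z) - v x) with hτ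
  have hbound : ∀ m, sqInt volume (fun x => (∫ y, v y * K m (x - y)) - v x) ≤
      ∫⁻ z, ENNReal.ofReal (K m z) * τ z := by
    intro m
    -- The kernel is regarded as a probability measure, so that the error is an average of
    -- translation differences and Jensen's inequality applies.
    set κ : Measure (Pt d) := volume.withDensity (fun z => ((K m z).toNNReal : ℝ≥0∞)) with hκ
    have hKm : Measurable fun z => (K m z).toNNReal := (hKc m).measurable.real_toNNReal
    have : IsProbabilityMeasure κ := by
      refine ⟨?_⟩
      rw [hκ, withDensity_apply _ MeasurableSet.univ, Measure.restrict_univ]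
      change ∫⁻ z, ENNReal.ofReal (K m z) = 1
      rw [← ofReal_integral_eq_lintegral_ofReal (hKi m) (ae_of_all _ (hK0 m)), hK1]
      simp
    have hpt : ∀ x, (∫ y, v y * K m (x - y)) - v x = ∫ z, (v (x - z) - v x) ∂κ := by
      intro x
      rw [hκ, integral_withDensity_eq_integral_smul hKm]
      have h1 : ∫ y, v y * K m (x - y) = ∫ z, v (x - z) * K m z := by
        rw [← integral_sub_left_eq_self (fun y => v y * K m (x - y)) volume x]
        simp
      have h2 : Integrable (fun z => v (x - z) * K m z) := by
        have := (hcs m).convolutionExists_right (ContinuousLinearMap.mul ℝ ℝ) hvl (hKc m) x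
        have h3 := this.integrable_swap
        simpa using h3
      rw [h1]
      have h4 : ∀ z, (K m z).toNNReal • (v (x - z) - v x) = v (x - z) * K m z - v x * K m z := by
        intro z
        rw [NNReal.smul_def, Real.coe_toNNReal _ (hK0 m z), smul_eq_mul]; ring
      simp only [h4]
      rw [integral_sub h2 ((hKi m).const_mul _), integral_const_mul, hK1, mul_one]
    have hmeas : Measurable fun p : Pt d × Pt d => ‖v (p.1 - p.2) - v p.1‖ₑ ^ 2 := by
      have := hvm.measurable
      fun_prop
    calc sqInt volume (fun x => (∫ y, v y * K m (x - y)) - v x)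
        ≤ ∫⁻ x, ∫⁻ z, ‖v (x - z) - v x‖ₑ ^ 2 ∂κ := by
          refine lintegral_mono fun x => ?_
          simp only [hpt]
          refine enorm_integral_sq_le (Measurable.aemeasurable ?_)
          have := hvm.measurable
          fun_prop
      _ = ∫⁻ z, τ z ∂κ := by
          rw [lintegral_lintegral_swap hmeas.aemeasurable]
          rfl
      _ = ∫⁻ z, ENNReal.ofReal (K m z) * τ z := by
          rw [hκ, lintegral_withDensity_eq_lintegral_mul _ hKm.coe_nnreal_ennreal]
          · rfl
          · exact (hmeas.comp measurable_swap).lintegral_prod_right'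
  have hτ0 := tendsto_sqInt_translate hv
  rw [ENNReal.tendsto_nhds_zero] at hτ0 ⊢
  intro ε hε
  obtain ⟨r, hr, hball⟩ := Metric.eventually_nhds_iff.1 (hτ0 ε hε)
  filter_upwards [hδ.eventually (gt_mem_nhds hr)] with m hm
  refine (hbound m).trans ?_
  calc ∫⁻ z, ENNReal.ofReal (K m z) * τ z ≤ ∫⁻ z, ENNReal.ofReal (K m z) * ε := by
        refine lintegral_mono fun z => ?_
        by_cases hz : δ m < ‖z‖
        · simp [hKs m z hz]
        · have : dist z 0 < r := by rw [dist_zero_right]; exact (not_lt.1 hz).trans_lt hm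
          gcongr
          exact hball this
    _ = ε := by
        rw [lintegral_mul_const _ (hKc m).measurable.ennreal_ofReal,
          ← ofReal_integral_eq_lintegral_ofReal (hKi m) (ae_of_all _ (hK0 m)), hK1]
        simp

/-- The partial derivatives of a convolution with a test function. -/
lemma pderiv_convolution {v : Pt d → ℝ} (hv : LocallyIntegrable v volume) {K : Pt d → ℝ}
    (hK : ContDiff ℝ ∞ K) (hKc : HasCompactSupport K) (i : Fin d) :
    ContDiff ℝ ∞ (fun x => ∫ y, v y * K (x - y)) ∧
      ∀ x, pderiv i (fun x => ∫ y, v y * K (x - y)) x = ∫ y, v y * pderiv i K (x - y) := by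
  refine ⟨hKc.contDiff_convolution_right (ContinuousLinearMap.mul ℝ ℝ) hv hK, fun x => ?_⟩
  have h1 := hKc.hasFDerivAt_convolution_right (ContinuousLinearMap.mul ℝ ℝ) hv
    (hK.of_le (by simp)) x
  have h2 : fderiv ℝ (fun x => ∫ y, v y * K (x - y)) x = _ := h1.fderiv
  rw [pderiv, h2, convolution_precompR_apply _ hv (hKc.fderiv ℝ) (hK.continuous_fderiv (by simp))]
  rfl

end Mollify

/-! ### Lipschitz domains -/

section Domain

variable {n : ℕ} {Ω : Set (Pt (n + 1))}

/-- The uniform interior cone condition. -/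
lemma IsLipschitzDomain.exists_cone (hΩ : IsLipschitzDomain Ω) {x₀ : Pt (n + 1)}
    (hx₀ : x₀ ∈ closure Ω) : ∃ (r s : ℝ) (ν : Pt (n + 1)), 0 < r ∧ 0 < s ∧ s ≤ 1 ∧ ‖ν‖ = 1 ∧
      ∀ y ∈ Ω ∩ Metric.ball x₀ r, ∀ z, ‖z‖ < s → ∀ t ∈ Icc (0 : ℝ) r, y + t • (ν + z) ∈ Ω := by
  by_cases hx : x₀ ∈ Ω
  · obtain ⟨R, hR, hball⟩ := Metric.isOpen_iff.1 hΩ.isOpen x₀ hx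
    refine ⟨R / 3, 1, EuclideanSpace.single 0 1, by positivity, one_pos, le_rfl, by simp, ?_⟩
    intro y hy z hz t ht
    refine hball ?_
    have h1 : ‖EuclideanSpace.single (0 : Fin (n + 1)) (1 : ℝ) + z‖ ≤ 2 :=
      (norm_add_le _ _).trans (by simp; linarith)
    have h2 : ‖y - x₀‖ < R / 3 := by simpa [dist_eq_norm] using hy.2
    rw [mem_ball_iff_norm, add_sub_right_comm]
    calc ‖y - x₀ + t • (EuclideanSpace.single (0 : Fin (n + 1)) (1 : ℝ) + z)‖
        ≤ ‖y - x₀‖ + t * ‖EuclideanSpace.single (0 : Fin (n + 1)) (1 : ℝ) + z‖ := by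
          refine (norm_add_le _ _).trans ?_
          rw [norm_smul, Real.norm_of_nonneg ht.1]
      _ < R := by nlinarith [ht.1, ht.2]
  · have hfr : x₀ ∈ frontier Ω := by
      rw [frontier, hΩ.isOpen.interior_eq]; exact ⟨hx₀, hx⟩
    obtain ⟨R, ν, φ, L, hR, hν, hφ, hiff⟩ := hΩ.lipschitz_boundary x₀ hfr
    have hL : (0 : ℝ) ≤ L := L.2
    -- Along `t (ν + z)` the height grows by at least `t (1 - ‖z‖)` and the graph by at most `t L
    -- ‖z‖`, so `(L + 1) ‖z‖ ≤ 1` keeps the point above the graph. As `‖ν + z‖ ≤ 2`, the radius `R /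
    -- 3` keeps it in the ball.
    refine ⟨R / 3, 1 / (L + 1), ν, by positivity, by positivity, ?_, hν, ?_⟩
    · rw [div_le_one (by positivity)]; linarith
    intro y hy z hz t ht
    have hs1 : 1 / ((L : ℝ) + 1) ≤ 1 := by rw [div_le_one (by positivity)]; linarith
    have hyR : ‖y - x₀‖ < R / 3 := by simpa [dist_eq_norm] using hy.2
    have hνz : ‖ν + z‖ ≤ 2 := (norm_add_le _ _).trans (by linarith)
    have hball : y + t • (ν + z) ∈ Metric.ball x₀ R := by
      rw [mem_ball_iff_norm, add_sub_right_comm]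
      calc ‖y - x₀ + t • (ν + z)‖ ≤ ‖y - x₀‖ + t * ‖ν + z‖ := by
            refine (norm_add_le _ _).trans ?_
            rw [norm_smul, Real.norm_of_nonneg ht.1]
        _ < R := by nlinarith [ht.1, ht.2]
    rw [hiff _ hball]
    have hyΩ := (hiff y (by rw [mem_ball_iff_norm]; linarith)).1 hy.1
    have hνν : ⟪ν, ν⟫_ℝ = 1 := by rw [real_inner_self_eq_norm_sq, hν]; norm_num
    have hinner : ⟪ν, y + t • (ν + z)⟫_ℝ = ⟪ν, y⟫_ℝ + t * (1 + ⟪ν, z⟫_ℝ) := by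
      rw [inner_add_right, inner_smul_right, inner_add_right, hνν]
    have hzν : |⟪ν, z⟫_ℝ| ≤ ‖z‖ := by
      have := abs_real_inner_le_norm ν z
      rwa [hν, one_mul] at this
    have hdiff : y + t • (ν + z) - ⟪ν, y + t • (ν + z)⟫_ℝ • ν - (y - ⟪ν, y⟫_ℝ • ν) =
        t • (z - ⟪ν, z⟫_ℝ • ν) := by
      rw [hinner]; module
    have hproj : ‖z - ⟪ν, z⟫_ℝ • ν‖ ≤ ‖z‖ := by
      have h1 : ‖z - ⟪ν, z⟫_ℝ • ν‖ ^ 2 = ‖z‖ ^ 2 - ⟪ν, z⟫_ℝ ^ 2 := by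
        rw [norm_sub_sq_real, inner_smul_right, norm_smul, hν, real_inner_comm z ν]
        simp
        ring
      have h2 : ‖z - ⟪ν, z⟫_ℝ • ν‖ ^ 2 ≤ ‖z‖ ^ 2 := by rw [h1]; nlinarith [sq_nonneg ⟪ν, z⟫_ℝ]
      exact le_of_sq_le_sq h2 (norm_nonneg _)
    have hφd := hφ.dist_le_mul (y + t • (ν + z) - ⟪ν, y + t • (ν + z)⟫_ℝ • ν)
      (y - ⟪ν, y⟫_ℝ • ν)
    rw [dist_eq_norm, dist_eq_norm, hdiff, norm_smul, Real.norm_of_nonneg ht.1] at hφd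
    have h3 := (le_abs_self _).trans hφd
    rw [hinner] at h3 ⊢
    have h4 : (L : ℝ) * (t * ‖z - ⟪ν, z⟫_ℝ • ν‖) ≤ t * (L * ‖z‖) := by
      have := mul_le_mul_of_nonneg_left hproj (mul_nonneg hL ht.1)
      nlinarith
    have h5 : (L + 1 : ℝ) * ‖z‖ ≤ 1 := by
      rw [lt_div_iff₀ (by positivity)] at hz
      linarith
    have h6 : t * (L * ‖z‖) ≤ t * (1 + ⟪ν, z⟫_ℝ) := by
      refine mul_le_mul_of_nonneg_left ?_ ht.1
      have := neg_le_of_abs_le hzν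
      linarith
    linarith

/-- Just below a boundary point there is an open region strictly under the graph, which misses `Ω`;
so a boundary point cannot be interior to the closure. Consequently interiors of mesh elements,
which are only known to lie in the closure, lie in `Ω`. -/
lemma IsLipschitzDomain.interior_closure_subset (hΩ : IsLipschitzDomain Ω) :
    interior (closure Ω) ⊆ Ω := by
  intro x hx
  by_contra hxΩ
  have hfr : x ∈ frontier Ω := by
    rw [frontier, hΩ.isOpen.interior_eq]; exact ⟨interior_subset hx, hxΩ⟩
  obtain ⟨R, ν, φ, L, hR, hν, hφ, hiff⟩ := hΩ.lipschitz_boundary x hfr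
  have hνν : ⟪ν, ν⟫_ℝ = 1 := by rw [real_inner_self_eq_norm_sq, hν]; norm_num
  have hx0 : ⟪ν, x⟫_ℝ ≤ φ (x - ⟪ν, x⟫_ℝ • ν) :=
    not_lt.1 fun h => hxΩ ((hiff x (Metric.mem_ball_self hR)).2 h)
  have hc : Continuous fun t : ℝ => x - t • ν := by fun_prop
  have h1 : ∀ᶠ t : ℝ in 𝓝[>] 0, x - t • ν ∈ closure Ω :=
    nhdsWithin_le_nhds (hc.continuousAt.eventually_mem (mem_interior_iff_mem_nhds.1 (by simpa)))
  have h2 : ∀ᶠ t : ℝ in 𝓝[>] 0, x - t • ν ∈ Metric.ball x R :=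
    nhdsWithin_le_nhds (hc.continuousAt.eventually_mem
      (Metric.isOpen_ball.mem_nhds (by simpa using hR)))
  obtain ⟨t, ⟨ht1, ht2⟩, ht0⟩ := ((h1.and h2).and self_mem_nhdsWithin).exists
  have ht0 : 0 < t := ht0
  have hval : ⟪ν, x - t • ν⟫_ℝ < φ (x - t • ν - ⟪ν, x - t • ν⟫_ℝ • ν) := by
    have h3 : ⟪ν, x - t • ν⟫_ℝ = ⟪ν, x⟫_ℝ - t := by
      rw [inner_sub_right, inner_smul_right, hνν, mul_one]
    have h4 : x - t • ν - ⟪ν, x - t • ν⟫_ℝ • ν = x - ⟪ν, x⟫_ℝ • ν := by rw [h3]; module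
    rw [h4, h3]; linarith
  have hopen : IsOpen (Metric.ball x R ∩ {y | ⟪ν, y⟫_ℝ < φ (y - ⟪ν, y⟫_ℝ • ν)}) := by
    refine Metric.isOpen_ball.inter (isOpen_lt (by fun_prop) (hφ.continuous.comp (by fun_prop)))
  obtain ⟨y, ⟨hy1, hy2⟩, hyΩ⟩ := mem_closure_iff.1 ht1 _ hopen ⟨ht2, hval⟩
  exact lt_asymm hy2 ((hiff y hy1).1 hyΩ)

end Domain

/-! ### Density of smooth functions -/

section Density

variable {n : ℕ} {Ω : Set (Pt (n + 1))}

/-- `u` is a limit in `L²(Ω)` of functions that are smooth on the whole space, with first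
derivatives that converge to `G`. -/
def SmoothApprox {d : ℕ} (Ω : Set (Pt d)) (u : Pt d → ℝ) (G : Fin d → Pt d → ℝ) : Prop :=
  ∃ φ : ℕ → Pt d → ℝ, (∀ m, ContDiff ℝ ∞ (φ m)) ∧
    Tendsto (fun m => sqInt (volume.restrict Ω) (φ m - u)) atTop (𝓝 0) ∧
    ∀ i, Tendsto (fun m => sqInt (volume.restrict Ω) (pderiv i (φ m) - G i)) atTop (𝓝 0)

lemma integral_mul_pderiv_of_hasWeakDeriv {d : ℕ} {Ω : Set (Pt d)} {u g : Pt d → ℝ} {i : Fin d}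
    (h : HasWeakDeriv Ω (Pi.single i 1) u g) {φ : Pt d → ℝ} (hφ : ContDiff ℝ ∞ φ)
    (hc : HasCompactSupport φ) (hs : tsupport φ ⊆ Ω) :
    ∫ x in Ω, u x * pderiv i φ x = -∫ x in Ω, g x * φ x := by
  have := h φ hφ hc hs
  rw [multiDeriv_single i hφ] at this
  simpa using this

lemma memLp_smooth_mul {d : ℕ} {μ : Measure (Pt d)} {η u : Pt d → ℝ} (hη : Continuous η)
    (hc : HasCompactSupport η) (hu : MemLp u 2 μ) : MemLp (fun x => η x * u x) 2 μ := by
  have : MemLp η ⊤ μ := by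
    obtain ⟨C, hC⟩ := hc.exists_bound_of_continuous hη
    exact memLp_top_of_bound hη.aestronglyMeasurable C (ae_of_all _ hC)
  exact hu.mul' this

/-- Smooth approximation of a localized `H¹` function, by mollification with shifted kernels. -/
lemma smoothApprox_localized (hΩ : IsOpen Ω) {x₀ ν : Pt (n + 1)} {r s : ℝ} (hr : 0 < r)
    (hs : 0 < s) (hs1 : s ≤ 1) (hν : ‖ν‖ = 1)
    (hcone : ∀ y ∈ Ω ∩ Metric.ball x₀ r, ∀ z, ‖z‖ < s → ∀ t ∈ Icc (0 : ℝ) r, y + t • (ν + z) ∈ Ω)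
    {η : Pt (n + 1) → ℝ} (hη : ContDiff ℝ ∞ η) (hηs : tsupport η ⊆ Metric.ball x₀ (r / 2))
    {u : Pt (n + 1) → ℝ} {G : Fin (n + 1) → Pt (n + 1) → ℝ}
    (hu : MemLp u 2 (volume.restrict Ω)) (hG : ∀ i, MemLp (G i) 2 (volume.restrict Ω))
    (hw : ∀ i, HasWeakDeriv Ω (Pi.single i 1) u (G i)) :
    SmoothApprox Ω (fun x => η x * u x) (fun i x => η x * G i x + pderiv i η x * u x) := by
  have hηc : HasCompactSupport η := HasCompactSupport.of_support_subset_isCompact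
    (isCompact_closedBall x₀ (r / 2))
    ((subset_tsupport η).trans (hηs.trans Metric.ball_subset_closedBall))
  set U : Pt (n + 1) → ℝ := Ω.indicator (fun x => η x * u x) with hU
  set G' : Fin (n + 1) → Pt (n + 1) → ℝ := fun i =>
    Ω.indicator (fun x => η x * G i x + pderiv i η x * u x) with hG'
  have hUL : MemLp U 2 volume :=
    (memLp_indicator_iff_restrict hΩ.measurableSet).2 (memLp_smooth_mul hη.continuous hηc hu)
  have hGL : ∀ i, MemLp (G' i) 2 volume := fun i =>
    (memLp_indicator_iff_restrict hΩ.measurableSet).2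
      ((memLp_smooth_mul hη.continuous hηc (hG i)).add
        (memLp_smooth_mul (contDiff_pderiv hη).continuous (hasCompactSupport_pderiv hηc) hu))
  set t : ℕ → ℝ := fun m => r / 8 / (m + 1) with ht
  have ht0 : ∀ m, 0 < t m := fun m => by positivity
  have htr : ∀ m, t m ≤ r / 8 := fun m => by
    simp only [ht]
    rw [div_le_iff₀ (by positivity)]
    nlinarith [show (0 : ℝ) ≤ m from Nat.cast_nonneg m]
  have htend : Tendsto t atTop (𝓝 0) := by
    have := (tendsto_one_div_add_atTop_nhds_zero_nat (𝕜 := ℝ)).const_mul (r / 8)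
    simpa [ht, div_eq_mul_inv] using this
  -- The kernel is centred at `-t ν` rather than at the origin, so that the mollified function at
  -- `x` samples points near `x + t ν`, inside the interior cone.
  let B : ∀ m, ContDiffBump (-(t m) • ν) := fun m =>
    ⟨s * t m / 4, s * t m / 2, by have := ht0 m; positivity, by nlinarith [mul_pos hs (ht0 m)]⟩
  set K : ℕ → Pt (n + 1) → ℝ := fun m => (B m).normed volume with hK
  have hKd : ∀ m, ContDiff ℝ ∞ (K m) := fun m => (B m).contDiff_normed
  have hKc : ∀ m, HasCompactSupport (K m) := fun m => (B m).hasCompactSupport_normed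
  have hKt : ∀ m, tsupport (K m) = Metric.closedBall (-(t m) • ν) (s * t m / 2) := fun m =>
    (B m).tsupport_normed_eq
  have hKsmall : ∀ m z, 2 * t m < ‖z‖ → K m z = 0 := by
    intro m z hz
    refine image_eq_zero_of_notMem_tsupport fun h => ?_
    rw [hKt, mem_closedBall_iff_norm] at h
    have h1 : ‖z‖ ≤ ‖z - -(t m) • ν‖ + ‖-(t m) • ν‖ := by
      simpa using norm_add_le (z - -(t m) • ν) (-(t m) • ν)
    rw [norm_smul, hν, Real.norm_eq_abs, abs_neg, abs_of_pos (ht0 m)] at h1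
    nlinarith [ht0 m]
  have hconv : ∀ v : Pt (n + 1) → ℝ, MemLp v 2 volume →
      Tendsto (fun m => sqInt volume (fun x => (∫ y, v y * K m (x - y)) - v x)) atTop (𝓝 0) :=
    fun v hv => tendsto_sqInt_convolution hv (fun m => (B m).continuous_normed)
      (fun m z => (B m).nonneg_normed z) (fun m => (B m).integral_normed)
      (δ := fun m => 2 * t m) (by simpa using htend.const_mul 2) hKsmall
  have hUl : LocallyIntegrable U volume := hUL.locallyIntegrable (by norm_num)
  have hpd := fun m i => pderiv_convolution hUl (hKd m) (hKc m) i
  have hres : ∀ (f g : ℕ → Pt (n + 1) → ℝ),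
      (∀ m, ∀ x ∈ Ω, f m x = g m x) → Tendsto (fun m => sqInt volume (g m)) atTop (𝓝 0) →
      Tendsto (fun m => sqInt (volume.restrict Ω) (f m)) atTop (𝓝 0) := by
    intro f g hfg hg
    refine tendsto_of_tendsto_of_tendsto_of_le_of_le tendsto_const_nhds hg (fun _ => zero_le)
      fun m => ?_
    simp only
    rw [sqInt_congr ((ae_restrict_iff' hΩ.measurableSet).2 (ae_of_all _ (hfg m)))]
    exact sqInt_mono_measure Measure.restrict_le_self _
  refine ⟨fun m x => ∫ y, U y * K m (x - y), fun m => (hpd m 0).1, ?_, fun i => ?_⟩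
  · refine hres _ _ (fun m x hx => ?_) (hconv U hUL)
    simp [hU, indicator_of_mem hx]
  · refine hres _ _ (fun m x hx => ?_) (hconv (G' i) (hGL i))
    rw [Pi.sub_apply, (hpd m i).2]
    have hGx : G' i x = η x * G i x + pderiv i η x * u x := indicator_of_mem hx _
    rw [hGx]
    congr 1
    set ψ : Pt (n + 1) → ℝ := fun y => K m (x - y) with hψ
    have hψd : ContDiff ℝ ∞ ψ := (hKd m).comp (contDiff_const.sub contDiff_id)
    have hψp : ∀ y, pderiv i ψ y = -pderiv i (K m) (x - y) := by
      intro y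
      have h1 : HasFDerivAt ψ ((fderiv ℝ (K m) (x - y)).comp (-ContinuousLinearMap.id ℝ _)) y := by
        have h2 : HasFDerivAt (fun y : Pt (n + 1) => x - y) (-ContinuousLinearMap.id ℝ _) y :=
          (hasFDerivAt_id y).const_sub x
        exact (((hKd m).differentiable (by simp)) (x - y)).hasFDerivAt.comp y h2
      simp [pderiv, h1.fderiv]
    have hηψ : ContDiff ℝ ∞ (η * ψ) := hη.mul hψd
    have hηψc : HasCompactSupport (η * ψ) := hηc.mul_right
    -- This is the purpose of the shift. A point `y` of the support is `x + t (ν + w)` with `‖w‖ <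
    -- s`, so the cone condition puts it in `Ω`. Thus `η ψ` is an admissible test function even when
    -- `x` is close to the boundary.
    have hηψs : tsupport (η * ψ) ⊆ Ω := by
      intro y hy
      have hyη : y ∈ tsupport η := tsupport_mul_subset_left hy
      have hyψ : y ∈ tsupport ψ := tsupport_mul_subset_right hy
      have hyK : x - y ∈ tsupport (K m) := by
        have hc : Continuous fun y : Pt (n + 1) => x - y := by fun_prop
        exact tsupport_comp_subset_preimage (K m) hc hyψ
      rw [hKt, mem_closedBall_iff_norm] at hyK
      set w : Pt (n + 1) := (t m)⁻¹ • (y - x) - ν with hwdef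
      have hyw : y = x + t m • (ν + w) := by
        rw [hwdef, add_sub_cancel, smul_smul, mul_inv_cancel₀ (ht0 m).ne', one_smul,
          add_sub_cancel]
      have hwn : ‖w‖ < s := by
        have h1 : t m • w = -(x - y - -(t m) • ν) := by
          rw [hwdef, smul_sub, smul_smul, mul_inv_cancel₀ (ht0 m).ne']; module
        have h2 : t m * ‖w‖ ≤ s * t m / 2 := by
          have := congrArg norm h1
          rw [norm_smul, norm_neg, Real.norm_of_nonneg (ht0 m).le] at this
          rw [this]; exact hyK
        nlinarith [ht0 m, norm_nonneg w]
      have hνw : ‖ν + w‖ ≤ 2 := (norm_add_le _ _).trans (by linarith)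
      have hxr : x ∈ Metric.ball x₀ r := by
        have h1 := hηs hyη
        rw [mem_ball_iff_norm] at h1 ⊢
        have h2 : x - x₀ = (y - x₀) - t m • (ν + w) := by rw [hyw]; abel
        rw [h2]
        refine (norm_sub_le _ _).trans_lt ?_
        rw [norm_smul, Real.norm_of_nonneg (ht0 m).le]
        nlinarith [ht0 m, htr m]
      rw [hyw]
      exact hcone x ⟨hx, hxr⟩ w hwn (t m) ⟨(ht0 m).le, by linarith [htr m]⟩
    have hweak := integral_mul_pderiv_of_hasWeakDeriv (hw i) hηψ hηψc hηψs
    rw [pderiv_mul (hη.differentiable (by simp)) (hψd.differentiable (by simp))] at hweak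
    have hψcs : HasCompactSupport ψ := (hKc m).comp_homeomorph (Homeomorph.subLeft x)
    have hli : ∀ (ζ f : Pt (n + 1) → ℝ), Continuous ζ → HasCompactSupport ζ →
        MemLp f 2 (volume.restrict Ω) → Integrable (fun y => f y * ζ y) (volume.restrict Ω) := by
      intro ζ f hζ hζc hf
      have h2 : MemLp ζ 2 (volume.restrict Ω) := hζ.memLp_of_hasCompactSupport hζc
      exact hf.integrable_mul h2
    have e1 : ∫ y, U y * pderiv i (K m) (x - y) =
        -∫ y in Ω, u y * (η y * pderiv i ψ y) := by
      rw [← integral_neg, ← integral_indicator hΩ.measurableSet]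
      refine integral_congr_ae (ae_of_all _ fun y => ?_)
      by_cases hy : y ∈ Ω
      · simp only [hU, indicator_of_mem hy, hψp]; ring
      · simp [hU, indicator_of_notMem hy]
    have e2 : ∫ y, G' i y * K m (x - y) =
        (∫ y in Ω, G i y * (η y * ψ y)) + ∫ y in Ω, u y * (pderiv i η y * ψ y) := by
      rw [← integral_add, ← integral_indicator hΩ.measurableSet]
      · refine integral_congr_ae (ae_of_all _ fun y => ?_)
        by_cases hy : y ∈ Ω
        · simp only [hG', indicator_of_mem hy, hψ]; ring
        · simp [hG', indicator_of_notMem hy]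
      · exact hli _ _ hηψ.continuous hηψc (hG i)
      · exact hli _ _ ((contDiff_pderiv hη).continuous.mul hψd.continuous)
          (hasCompactSupport_pderiv hηc).mul_right hu
    have e3 : ∫ y in Ω, u y * (pderiv i η * ψ + η * pderiv i ψ) y =
        (∫ y in Ω, u y * (pderiv i η y * ψ y)) + ∫ y in Ω, u y * (η y * pderiv i ψ y) := by
      rw [← integral_add]
      · simp [mul_add]
      · exact hli _ _ ((contDiff_pderiv hη).continuous.mul hψd.continuous)
          (hasCompactSupport_pderiv hηc).mul_right hu
      · exact hli _ _ (hη.continuous.mul (contDiff_pderiv hψd).continuous) hηc.mul_right hu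
    rw [e1, e2]
    rw [e3] at hweak
    simp only [Pi.mul_apply] at hweak
    linarith

lemma SmoothApprox.zero {d : ℕ} {Ω : Set (Pt d)} : SmoothApprox Ω 0 0 := by
  refine ⟨fun _ => 0, fun _ => contDiff_const, ?_, fun i => ?_⟩
  · simp [sqInt]
  · have : pderiv i (0 : Pt d → ℝ) = 0 := by
      funext x
      change fderiv ℝ (fun _ => (0 : ℝ)) x _ = 0
      simp
    simp [sqInt, this]

lemma SmoothApprox.add {d : ℕ} {Ω : Set (Pt d)} {u v : Pt d → ℝ} {G H : Fin d → Pt d → ℝ}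
    (hu : SmoothApprox Ω u G) (hv : SmoothApprox Ω v H)
    (hum : AEMeasurable u (volume.restrict Ω)) (hGm : ∀ i, AEMeasurable (G i) (volume.restrict Ω)) :
    SmoothApprox Ω (u + v) (G + H) := by
  obtain ⟨φ, hφ, hφu, hφG⟩ := hu
  obtain ⟨ψ, hψ, hψu, hψG⟩ := hv
  have key : ∀ (a b : ℕ → Pt d → ℝ) (f g : Pt d → ℝ), (∀ m, Continuous (a m)) →
      AEMeasurable f (volume.restrict Ω) →
      Tendsto (fun m => sqInt (volume.restrict Ω) (a m - f)) atTop (𝓝 0) →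
      Tendsto (fun m => sqInt (volume.restrict Ω) (b m - g)) atTop (𝓝 0) →
      Tendsto (fun m => sqInt (volume.restrict Ω) (a m + b m - (f + g))) atTop (𝓝 0) := by
    intro a b f g ha hf h1 h2
    have h3 : Tendsto (fun m => 2 * sqInt (volume.restrict Ω) (a m - f) +
        2 * sqInt (volume.restrict Ω) (b m - g)) atTop (𝓝 0) := by
      simpa using (ENNReal.Tendsto.const_mul h1 (Or.inr ENNReal.ofNat_ne_top)).add
        (ENNReal.Tendsto.const_mul h2 (Or.inr ENNReal.ofNat_ne_top))
    refine tendsto_of_tendsto_of_tendsto_of_le_of_le tendsto_const_nhds h3 (fun _ => zero_le)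
      fun m => ?_
    rw [add_sub_add_comm]
    exact sqInt_add_le ((ha m).measurable.aemeasurable.sub hf) _
  refine ⟨fun m => φ m + ψ m, fun m => (hφ m).add (hψ m),
    key φ ψ u v (fun m => (hφ m).continuous) hum hφu hψu, fun i => ?_⟩
  have := key (fun m => pderiv i (φ m)) (fun m => pderiv i (ψ m)) (G i) (H i)
    (fun m => (contDiff_pderiv (hφ m)).continuous) (hGm i) (hφG i) (hψG i)
  refine this.congr fun m => ?_
  rw [pderiv_add ((hφ m).differentiable (by simp)) ((hψ m).differentiable (by simp))]
  rfl

lemma SmoothApprox.congr {d : ℕ} {Ω : Set (Pt d)} {u v : Pt d → ℝ} {G H : Fin d → Pt d → ℝ}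
    (hu : SmoothApprox Ω u G) (h1 : u =ᵐ[volume.restrict Ω] v)
    (h2 : ∀ i, G i =ᵐ[volume.restrict Ω] H i) : SmoothApprox Ω v H := by
  obtain ⟨φ, hφ, hφu, hφG⟩ := hu
  refine ⟨φ, hφ, hφu.congr fun m => sqInt_congr ?_, fun i => (hφG i).congr fun m =>
    sqInt_congr ?_⟩
  · filter_upwards [h1] with x hx; simp [hx]
  · filter_upwards [h2 i] with x hx; simp [hx]

lemma SmoothApprox.sum {d : ℕ} {Ω : Set (Pt d)} {ι : Type*} (s : Finset ι) {u : ι → Pt d → ℝ}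
    {G : ι → Fin d → Pt d → ℝ} (h : ∀ j, SmoothApprox Ω (u j) (G j))
    (hum : ∀ j, AEMeasurable (u j) (volume.restrict Ω))
    (hGm : ∀ j i, AEMeasurable (G j i) (volume.restrict Ω)) :
    SmoothApprox Ω (∑ j ∈ s, u j) (∑ j ∈ s, G j) := by
  classical
  induction s using Finset.induction_on with
  | empty => simpa using SmoothApprox.zero
  | insert a s ha ih =>
    rw [Finset.sum_insert ha, Finset.sum_insert ha]
    exact (h a).add ih (hum a) (hGm a)

/-- Functions smooth on the whole space are dense in `H¹(Ω)` if `Ω` is a Lipschitz domain. -/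
theorem IsLipschitzDomain.smoothApprox (hΩ : IsLipschitzDomain Ω)
    {u : Pt (n + 1) → ℝ} {G : Fin (n + 1) → Pt (n + 1) → ℝ}
    (hu : MemLp u 2 (volume.restrict Ω)) (hG : ∀ i, MemLp (G i) 2 (volume.restrict Ω))
    (hw : ∀ i, HasWeakDeriv Ω (Pi.single i 1) u (G i)) : SmoothApprox Ω u G := by
  choose! r s ν hr hs hs1 hν hcone using fun x (hx : x ∈ closure Ω) => hΩ.exists_cone hx
  have hcpt : IsCompact (closure Ω) := hΩ.isBounded.isCompact_closure
  obtain ⟨J, hJ, hcov⟩ := hcpt.elim_nhds_subcover (fun x => Metric.ball x (r x / 2))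
    fun x hx => Metric.ball_mem_nhds x (half_pos (hr x hx))
  obtain ⟨f, hf⟩ := SmoothPartitionOfUnity.exists_isSubordinate
    (modelWithCornersSelf ℝ (Pt (n + 1))) isClosed_closure
    (fun x : J => Metric.ball (x : Pt (n + 1)) (r x / 2)) (fun _ => Metric.isOpen_ball)
    (by simpa [iUnion_subtype] using hcov)
  have hfd : ∀ j, ContDiff ℝ ∞ (f j) := fun j => (f j).contMDiff.contDiff
  have hloc : ∀ j : J, SmoothApprox Ω (fun x => f j x * u x)
      (fun i x => f j x * G i x + pderiv i (f j) x * u x) := fun j =>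
    smoothApprox_localized hΩ.isOpen (hr j (hJ j j.2)) (hs j (hJ j j.2)) (hs1 j (hJ j j.2))
      (hν j (hJ j j.2)) (hcone j (hJ j j.2)) (hfd j) (hf j) hu hG hw
  have hpm : ∀ (j : J) (i : Fin (n + 1)), Measurable (pderiv i (f j)) := fun j i =>
    (contDiff_pderiv (hfd j)).continuous.measurable
  have hfm : ∀ j : J, Measurable (f j) := fun j => (hfd j).continuous.measurable
  have hsum1 : ∀ x ∈ Ω, ∑ j, f j x = 1 := fun x hx => by
    rw [← finsum_eq_sum_of_fintype]; exact f.sum_eq_one (subset_closure hx)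
  -- The partition functions sum to one on the open set `Ω`, so the product-rule terms with
  -- differentiated cut-offs cancel in the sum.
  have hsumd : ∀ i, ∀ x ∈ Ω, ∑ j, pderiv i (f j) x = 0 := by
    intro i x hx
    have h1 : HasFDerivAt (fun y => ∑ j, f j y) (∑ j, fderiv ℝ (f j) x) x :=
      HasFDerivAt.fun_sum fun j _ => ((hfd j).differentiable (by simp) x).hasFDerivAt
    have h2 : HasFDerivAt (fun y => ∑ j, f j y) (0 : Pt (n + 1) →L[ℝ] ℝ) x := by
      refine (hasFDerivAt_const (1 : ℝ) x).congr_of_eventuallyEq ?_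
      filter_upwards [hΩ.isOpen.mem_nhds hx] with y hy using hsum1 y hy
    have h3 := congrArg (fun L => L (EuclideanSpace.single i (1 : ℝ))) (h1.unique h2)
    simpa [pderiv] using h3
  refine (SmoothApprox.sum Finset.univ hloc
    (fun j => (hfm j).aemeasurable.mul hu.1.aemeasurable)
    (fun j i => ((hfm j).aemeasurable.mul (hG i).1.aemeasurable).add
      ((hpm j i).aemeasurable.mul hu.1.aemeasurable))).congr ?_ fun i => ?_
  · filter_upwards [ae_restrict_mem hΩ.isOpen.measurableSet] with x hx
    rw [Finset.sum_apply, ← Finset.sum_mul, hsum1 x hx, one_mul]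
  · filter_upwards [ae_restrict_mem hΩ.isOpen.measurableSet] with x hx
    rw [Finset.sum_apply, Finset.sum_apply, Finset.sum_add_distrib, ← Finset.sum_mul,
      ← Finset.sum_mul, hsum1 x hx, hsumd i x hx, one_mul, zero_mul, add_zero]

end Density

/-! ### Polynomials -/

section Polynomials

variable {d : ℕ}

/-- The polynomial function on `ℝ^d` defined by `P`. -/
def evalPt (P : MvPolynomial (Fin d) ℝ) : Pt d → ℝ := fun x => MvPolynomial.eval (fun i => x i) P

lemma evalPt_add (P Q : MvPolynomial (Fin d) ℝ) : evalPt (P + Q) = evalPt P + evalPt Q := by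
  funext x; simp [evalPt]

lemma evalPt_mul (P Q : MvPolynomial (Fin d) ℝ) : evalPt (P * Q) = evalPt P * evalPt Q := by
  funext x; simp [evalPt]

lemma evalPt_C (a : ℝ) : evalPt (MvPolynomial.C a : MvPolynomial (Fin d) ℝ) = fun _ => a := by
  funext x; simp [evalPt]

lemma contDiff_evalPt (P : MvPolynomial (Fin d) ℝ) : ContDiff ℝ ∞ (evalPt P) := by
  induction P using MvPolynomial.induction_on with
  | C a => rw [evalPt_C]; exact contDiff_const
  | add p q hp hq => rw [evalPt_add]; exact hp.add hq
  | mul_X p i hp =>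
    rw [evalPt_mul]
    refine hp.mul ?_
    have : evalPt (MvPolynomial.X i : MvPolynomial (Fin d) ℝ) = fun x : Pt d => x i := by
      funext x; simp [evalPt]
    rw [this]
    fun_prop

lemma pderiv_evalPt (i : Fin d) (P : MvPolynomial (Fin d) ℝ) :
    pderiv i (evalPt P) = evalPt (MvPolynomial.pderiv i P) := by
  have hd : ∀ Q : MvPolynomial (Fin d) ℝ, Differentiable ℝ (evalPt Q) := fun Q =>
    (contDiff_evalPt Q).differentiable (by simp)
  induction P using MvPolynomial.induction_on with
  | C a =>
    rw [evalPt_C, MvPolynomial.pderiv_C]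
    funext x
    simp [pderiv, evalPt]
  | add p q hp hq => rw [evalPt_add, pderiv_add (hd p) (hd q), hp, hq, map_add, evalPt_add]
  | mul_X p j hp =>
    have hX : pderiv i (evalPt (MvPolynomial.X j : MvPolynomial (Fin d) ℝ)) =
        evalPt (MvPolynomial.pderiv i (MvPolynomial.X j)) := by
      have h1 : evalPt (MvPolynomial.X j : MvPolynomial (Fin d) ℝ) =
          fun x : Pt d => EuclideanSpace.proj (𝕜 := ℝ) j x := by
        funext x; simp [evalPt]
      rw [h1]
      funext x
      rw [pderiv, ContinuousLinearMap.fderiv, MvPolynomial.pderiv_X]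
      simp [evalPt, Pi.single_apply]
    rw [evalPt_mul, pderiv_mul (hd _) (hd _), hp, hX, Derivation.leibniz, evalPt_add]
    simp only [smul_eq_mul, evalPt_mul]
    ring

lemma isPoly_iff {k : ℕ} {p : Pt d → ℝ} :
    IsPoly k p ↔ ∃ P : MvPolynomial (Fin d) ℝ, P.totalDegree ≤ k ∧ p = evalPt P := by
  simp only [IsPoly, funext_iff, evalPt]

lemma IsPoly.contDiff {k : ℕ} {p : Pt d → ℝ} (h : IsPoly k p) : ContDiff ℝ ∞ p := by
  obtain ⟨P, -, rfl⟩ := isPoly_iff.1 h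
  exact contDiff_evalPt P

lemma IsPoly.continuous {k : ℕ} {p : Pt d → ℝ} (h : IsPoly k p) : Continuous p :=
  h.contDiff.continuous

lemma isPoly_const (k : ℕ) (a : ℝ) : IsPoly k (fun _ : Pt d => a) :=
  isPoly_iff.2 ⟨MvPolynomial.C a, by simp, (evalPt_C a).symm⟩

lemma isPoly_zero (k : ℕ) : IsPoly k (0 : Pt d → ℝ) := isPoly_const k 0

lemma IsPoly.add {k : ℕ} {p q : Pt d → ℝ} (hp : IsPoly k p) (hq : IsPoly k q) :
    IsPoly k (p + q) := by
  obtain ⟨P, hP, rfl⟩ := isPoly_iff.1 hp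
  obtain ⟨Q, hQ, rfl⟩ := isPoly_iff.1 hq
  exact isPoly_iff.2 ⟨P + Q, (MvPolynomial.totalDegree_add P Q).trans (max_le hP hQ),
    (evalPt_add P Q).symm⟩

lemma IsPoly.const_mul {k : ℕ} {p : Pt d → ℝ} (hp : IsPoly k p) (a : ℝ) :
    IsPoly k (fun x => a * p x) := by
  obtain ⟨P, hP, rfl⟩ := isPoly_iff.1 hp
  refine isPoly_iff.2 ⟨MvPolynomial.C a * P, (MvPolynomial.totalDegree_mul _ _).trans (by simpa), ?_⟩
  rw [evalPt_mul, evalPt_C]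
  rfl

lemma IsPoly.neg {k : ℕ} {p : Pt d → ℝ} (hp : IsPoly k p) : IsPoly k (-p) := by
  have := hp.const_mul (-1)
  simpa [Pi.neg_def] using this

lemma IsPoly.sub {k : ℕ} {p q : Pt d → ℝ} (hp : IsPoly k p) (hq : IsPoly k q) :
    IsPoly k (p - q) := by
  rw [sub_eq_add_neg]; exact hp.add hq.neg

lemma IsPoly.sum {k : ℕ} {ι : Type*} (s : Finset ι) {p : ι → Pt d → ℝ}
    (h : ∀ j ∈ s, IsPoly k (p j)) : IsPoly k (fun x => ∑ j ∈ s, p j x) := by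
  classical
  induction s using Finset.induction_on with
  | empty => simpa using isPoly_const (d := d) k 0
  | insert a s ha ih =>
    simp only [Finset.sum_insert ha]
    exact (h a (by simp)).add (ih fun j hj => h j (by simp [hj]))

lemma totalDegree_pderiv_le (i : Fin d) (P : MvPolynomial (Fin d) ℝ) :
    (MvPolynomial.pderiv i P).totalDegree ≤ P.totalDegree := by
  conv_lhs => rw [P.as_sum, map_sum]
  refine MvPolynomial.totalDegree_finsetSum_le fun s hs => ?_
  rw [MvPolynomial.pderiv_monomial]
  refine (MvPolynomial.totalDegree_monomial_le _ _).trans ?_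
  refine le_trans ?_ (MvPolynomial.le_totalDegree hs)
  rw [Finsupp.sum_fintype _ _ (by simp), Finsupp.sum_fintype _ _ (by simp)]
  exact Finset.sum_le_sum fun j _ => by simp

lemma IsPoly.pderiv {k : ℕ} {p : Pt d → ℝ} (hp : IsPoly k p) (i : Fin d) :
    IsPoly k (pderiv i p) := by
  obtain ⟨P, hP, rfl⟩ := isPoly_iff.1 hp
  exact isPoly_iff.2 ⟨_, (totalDegree_pderiv_le i P).trans hP, pderiv_evalPt i P⟩

lemma IsPoly.mono {k l : ℕ} {p : Pt d → ℝ} (hp : IsPoly k p) (h : k ≤ l) : IsPoly l p :=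
  let ⟨P, hP, he⟩ := hp
  ⟨P, hP.trans h, he⟩

lemma IsPoly.mul {k l : ℕ} {p q : Pt d → ℝ} (hp : IsPoly k p) (hq : IsPoly l q) :
    IsPoly (k + l) (p * q) := by
  obtain ⟨P, hP, rfl⟩ := isPoly_iff.1 hp
  obtain ⟨Q, hQ, rfl⟩ := isPoly_iff.1 hq
  exact isPoly_iff.2 ⟨P * Q, (MvPolynomial.totalDegree_mul P Q).trans (add_le_add hP hQ),
    (evalPt_mul P Q).symm⟩

lemma IsPoly.pow {k : ℕ} {p : Pt d → ℝ} (hp : IsPoly k p) (m : ℕ) : IsPoly (m * k) (p ^ m) := by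
  induction m with
  | zero => simpa using! isPoly_const (d := d) 0 1
  | succ m ih => rw [pow_succ, Nat.succ_mul]; exact ih.mul hp

lemma IsPoly.prod {ι : Type*} (s : Finset ι) {m : ι → ℕ} {p : ι → Pt d → ℝ}
    (h : ∀ j ∈ s, IsPoly (m j) (p j)) : IsPoly (∑ j ∈ s, m j) (∏ j ∈ s, p j) := by
  classical
  induction s using Finset.induction_on with
  | empty => simpa using! isPoly_const (d := d) 0 1
  | insert a s ha ih =>
    rw [Finset.sum_insert ha, Finset.prod_insert ha]
    exact (h a (by simp)).mul (ih fun j hj => h j (by simp [hj]))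

lemma isPoly_coord (i : Fin d) : IsPoly 1 (fun x : Pt d => x i) :=
  ⟨MvPolynomial.X i, by simp, fun x => by simp⟩

lemma IsPoly.comp_affine {k : ℕ} {p : Pt d → ℝ} (hp : IsPoly k p) (a : Pt d) (t : ℝ) :
    IsPoly k (fun x => p (a + t • x)) := by
  obtain ⟨P, hP, he⟩ := hp
  have h1 : (fun x => p (a + t • x)) = fun x => ∑ s ∈ P.support, P.coeff s *
      (∏ i, (fun y : Pt d => a i + t * y i) ^ s i) x := by
    funext x
    rw [he, MvPolynomial.eval_eq']
    simp
  rw [h1]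
  refine IsPoly.sum _ fun s hs => IsPoly.const_mul ?_ _
  have h2 : ∀ i : Fin d, IsPoly (s i) ((fun y : Pt d => a i + t * y i) ^ s i) := fun i => by
    simpa using! (((isPoly_const 1 (a i)).add ((isPoly_coord i).const_mul t)).pow (s i))
  refine (IsPoly.prod Finset.univ fun i _ => h2 i).mono ?_
  have := MvPolynomial.le_totalDegree hs
  rw [Finsupp.sum_fintype _ _ (by simp)] at this
  omega

/-- The formal derivative of multi-index `α`. -/
def mvDeriv (l : List (Fin d)) (α : Fin d → ℕ) :
    MvPolynomial (Fin d) ℝ →ₗ[ℝ] MvPolynomial (Fin d) ℝ :=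
  l.foldr (fun i L => ((MvPolynomial.pderiv i).toLinearMap ^ (α i)) ∘ₗ L) LinearMap.id

lemma foldr_pderiv_evalPt (l : List (Fin d)) (α : Fin d → ℕ) (P : MvPolynomial (Fin d) ℝ) :
    l.foldr (fun i ψ => (pderiv i)^[α i] ψ) (evalPt P) = evalPt (mvDeriv l α P) := by
  have hit : ∀ (i : Fin d) (m : ℕ) (Q : MvPolynomial (Fin d) ℝ),
      (pderiv i)^[m] (evalPt Q) = evalPt (((MvPolynomial.pderiv i).toLinearMap ^ m) Q) := by
    intro i m Q
    induction m with
    | zero => simp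
    | succ m ih =>
      rw [Function.iterate_succ_apply', ih, pderiv_evalPt, pow_succ']
      rfl
  induction l with
  | nil => rfl
  | cons a l ih => rw [List.foldr_cons, ih, hit]; rfl

lemma multiDeriv_evalPt (α : Fin d → ℕ) (P : MvPolynomial (Fin d) ℝ) :
    multiDeriv α (evalPt P) = evalPt (mvDeriv (List.finRange d) α P) :=
  foldr_pderiv_evalPt _ _ _

lemma pderiv_pow_monomial (i : Fin d) (m : ℕ) (s : Fin d →₀ ℕ) (a : ℝ) :
    ((MvPolynomial.pderiv i).toLinearMap ^ m) (MvPolynomial.monomial s a) =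
      MvPolynomial.monomial (s - Finsupp.single i m) (a * (s i).descFactorial m) := by
  induction m with
  | zero => simp
  | succ m ih =>
    rw [pow_succ', Module.End.mul_apply, ih]
    change MvPolynomial.pderiv i _ = _
    rw [MvPolynomial.pderiv_monomial, Nat.descFactorial_succ]
    have h1 : s - Finsupp.single i m - Finsupp.single i 1 = s - Finsupp.single i (m + 1) := by
      rw [tsub_tsub, ← Finsupp.single_add]
    have h2 : ((s - Finsupp.single i m : Fin d →₀ ℕ) i : ℕ) = s i - m := by simp
    rw [h1, h2]
    congr 1
    push_cast
    ring

/-- Each partial derivative produces a falling factorial, which vanishes when the order exceeds the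
exponent. Derivatives are therefore triangular on monomials, which is what makes prescribed averages
solvable. -/
lemma mvDeriv_monomial (l : List (Fin d)) (hl : l.Nodup) (α : Fin d → ℕ) (s : Fin d →₀ ℕ) (a : ℝ) :
    ∃ s' : Fin d →₀ ℕ, (∀ j ∉ l, s' j = s j) ∧ (∀ j ∈ l, s' j = s j - α j) ∧
      mvDeriv l α (MvPolynomial.monomial s a) = MvPolynomial.monomial s'
        (a * (l.map fun i => ((s i).descFactorial (α i) : ℝ)).prod) := by
  induction l with
  | nil => exact ⟨s, by simp, by simp, by simp [mvDeriv]⟩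
  | cons b l ih =>
    obtain ⟨hb, hl⟩ := List.nodup_cons.1 hl
    obtain ⟨s', h1, h2, h3⟩ := ih hl
    refine ⟨s' - Finsupp.single b (α b), ?_, ?_, ?_⟩
    · intro j hj
      rw [List.mem_cons, not_or] at hj
      simp [h1 j hj.2, Ne.symm hj.1]
    · intro j hj
      rcases List.mem_cons.1 hj with rfl | hj
      · simp [h1 j hb]
      · have : b ≠ j := by rintro rfl; exact hb hj
        simp [h2 j hj, this]
    · have : mvDeriv (b :: l) α (MvPolynomial.monomial s a) =
        ((MvPolynomial.pderiv b).toLinearMap ^ (α b)) (mvDeriv l α (MvPolynomial.monomial s a)) := rfl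
      rw [this, h3, pderiv_pow_monomial, h1 b hb, List.map_cons, List.prod_cons]
      congr 1
      ring

lemma mvDeriv_monomial_eq_zero {α : Fin d → ℕ} {s : Fin d →₀ ℕ} (h : ∃ i, s i < α i) (a : ℝ) :
    mvDeriv (List.finRange d) α (MvPolynomial.monomial s a) = 0 := by
  obtain ⟨s', -, -, h3⟩ := mvDeriv_monomial _ (List.nodup_finRange d) α s a
  obtain ⟨i, hi⟩ := h
  have : (List.map (fun i => ((s i).descFactorial (α i) : ℝ)) (List.finRange d)).prod = 0 := by
    rw [List.prod_eq_zero_iff, List.mem_map]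
    exact ⟨i, List.mem_finRange i, by simpa [Nat.descFactorial_eq_zero_iff_lt] using hi⟩
  rw [h3, this]
  simp

/-- The diagonal entries of this triangular system are products of factorials, hence nonzero. -/
lemma mvDeriv_monomial_self (s : Fin d →₀ ℕ) : ∃ c : ℝ, c ≠ 0 ∧ ∀ a : ℝ,
    mvDeriv (List.finRange d) s (MvPolynomial.monomial s a) = MvPolynomial.C (a * c) := by
  refine ⟨(List.map (fun i => ((s i).descFactorial (s i) : ℝ)) (List.finRange d)).prod, ?_, ?_⟩
  · rw [Ne, List.prod_eq_zero_iff, List.mem_map]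
    rintro ⟨i, -, hi⟩
    simp [Nat.descFactorial_self, Nat.factorial_ne_zero] at hi
  · intro a
    obtain ⟨s', -, h2, h3⟩ := mvDeriv_monomial _ (List.nodup_finRange d) s s a
    have : s' = 0 := by
      ext j; rw [h2 j (List.mem_finRange j)]; simp
    rw [h3, this]
    rfl

lemma exists_lt_of_sum_lt {s α : Fin d → ℕ} (h : ∑ i, s i < ∑ i, α i) : ∃ i, s i < α i := by
  by_contra hc
  push Not at hc
  exact absurd h (not_lt.2 (Finset.sum_le_sum fun i _ => hc i))

lemma IsPoly.multiDeriv_eq_zero {k : ℕ} {p : Pt d → ℝ} (hp : IsPoly k p) {α : Fin d → ℕ}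
    (hα : k < ∑ i, α i) : multiDeriv α p = 0 := by
  obtain ⟨P, hP, rfl⟩ := isPoly_iff.1 hp
  rw [multiDeriv_evalPt]
  have : mvDeriv (List.finRange d) α P = 0 := by
    conv_lhs => rw [P.as_sum, map_sum]
    refine Finset.sum_eq_zero fun s hs => mvDeriv_monomial_eq_zero (exists_lt_of_sum_lt ?_) _
    have := MvPolynomial.le_totalDegree hs
    rw [Finsupp.sum_fintype _ _ (by simp)] at this
    omega
  rw [this]
  funext x; simp [evalPt]

/-- A polynomial of degree at most `k` with prescribed averages of its derivatives. -/
lemma exists_isPoly_integral_multiDeriv (k : ℕ) {B : Set (Pt d)} (hB : Bornology.IsBounded B)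
    (hB0 : volume B ≠ 0) (m : (Fin d → ℕ) → ℝ) :
    ∃ p : Pt d → ℝ, IsPoly k p ∧
      ∀ α : Fin d → ℕ, ∑ i, α i ≤ k → ∫ x in B, multiDeriv α p x = m α := by
  have hfin : volume B < ⊤ := hB.measure_lt_top
  have hvol : volume.real B ≠ 0 := (ENNReal.toReal_pos hB0 hfin.ne).ne'
  have hint : ∀ P : MvPolynomial (Fin d) ℝ, IntegrableOn (evalPt P) B := fun P =>
    ((contDiff_evalPt P).continuous.continuousOn.integrableOn_compact
      hB.isCompact_closure).mono_set subset_closure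
  -- Downward induction on the order: after `j` steps the averages of all derivatives of order at
  -- least `k + 1 - j` are correct.
  suffices h : ∀ j ≤ k + 1, ∃ P : MvPolynomial (Fin d) ℝ, P.totalDegree ≤ k ∧
      ∀ α : Fin d → ℕ, k + 1 ≤ ∑ i, α i + j → ∑ i, α i ≤ k →
        ∫ x in B, evalPt (mvDeriv (List.finRange d) α P) x = m α by
    obtain ⟨P, hP, hPm⟩ := h (k + 1) le_rfl
    refine ⟨evalPt P, isPoly_iff.2 ⟨P, hP, rfl⟩, fun α hα => ?_⟩
    rw [multiDeriv_evalPt]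
    exact hPm α (by omega) hα
  intro j
  induction j with
  | zero => exact fun _ => ⟨0, by simp, fun α h1 h2 => by omega⟩
  | succ j ih =>
    intro hj
    obtain ⟨P, hP, hPm⟩ := ih (by omega)
    let fs : (Fin d → ℕ) → (Fin d →₀ ℕ) := fun α => Finsupp.equivFunOnFinite.symm α
    have hfs : ∀ α : Fin d → ℕ, ((fs α : Fin d →₀ ℕ) : Fin d → ℕ) = α := fun α => rfl
    choose c hc0 hc using fun α : Fin d → ℕ => mvDeriv_monomial_self (fs α)
    let e : (Fin d → ℕ) → ℝ := fun α =>
      (m α - ∫ x in B, evalPt (mvDeriv (List.finRange d) α P) x) / (c α * volume.real B)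
    let Q : MvPolynomial (Fin d) ℝ := ∑ α ∈ Finset.piAntidiag (Finset.univ : Finset (Fin d)) (k - j),
      MvPolynomial.monomial (fs α) (e α)
    have hmem : ∀ α : Fin d → ℕ, α ∈ Finset.piAntidiag (Finset.univ : Finset (Fin d)) (k - j) ↔
        ∑ i, α i = k - j := fun α => by simp
    refine ⟨P + Q, ?_, fun α h1 h2 => ?_⟩
    · refine (MvPolynomial.totalDegree_add _ _).trans (max_le hP ?_)
      refine MvPolynomial.totalDegree_finsetSum_le fun α hα => ?_
      refine (MvPolynomial.totalDegree_monomial_le _ _).trans ?_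
      rw [Finsupp.sum_fintype _ _ (by simp), hfs]
      have := (hmem α).1 hα
      change ∑ i, α i ≤ k
      omega
    · have hQ : mvDeriv (List.finRange d) α Q =
          if ∑ i, α i = k - j then MvPolynomial.C (e α * c α) else 0 := by
        rw [map_sum]
        split_ifs with hα
        · rw [Finset.sum_eq_single_of_mem α ((hmem α).2 hα)]
          · exact hc α (e α)
          · intro β hβ hβα
            refine mvDeriv_monomial_eq_zero ?_ _
            by_contra hcon
            push Not at hcon
            rw [hfs] at hcon
            have hs : ∑ i, α i = ∑ i, β i := by rw [hα, (hmem β).1 hβ]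
            have := (Finset.sum_eq_sum_iff_of_le fun i _ => hcon i).1 hs
            exact hβα (funext fun i => (this i (Finset.mem_univ i)).symm)
        · refine Finset.sum_eq_zero fun β hβ => mvDeriv_monomial_eq_zero
            (exists_lt_of_sum_lt ?_) _
          rw [hfs, (hmem β).1 hβ]
          omega
      rw [map_add, evalPt_add]
      simp only [Pi.add_apply]
      rw [integral_add (hint _) (hint _), hQ]
      split_ifs with hα
      · rw [evalPt_C, setIntegral_const, smul_eq_mul]
        simp only [e]
        have := hc0 α
        field_simp
        ring
      · have : evalPt (0 : MvPolynomial (Fin d) ℝ) = fun _ => (0 : ℝ) := by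
          funext x; simp [evalPt]
        rw [this, hPm α (by omega) h2]
        simp

end Polynomials

/-! ### The Poincaré inequality on star-shaped sets and polynomial approximation -/

section Poincare

variable {d : ℕ}

/-- The Jacobian of the dilation contributes `s ^ (-d)`, which stays below `2 ^ d` as long as `s` is
bounded away from zero. -/
lemma lintegral_comp_add_smul_le {s : ℝ} (hs : 1 / 2 ≤ s) (a : Pt d) (g : Pt d → ℝ≥0∞) :
    ∫⁻ x, g (a + s • x) ≤ 2 ^ d * ∫⁻ x, g x := by
  have hs0 : 0 < s := by linarith
  have h1 : ∫⁻ x, g x = ENNReal.ofReal (s ^ d) * ∫⁻ x, g (a + s • x) := by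
    rw [← lintegral_add_left_eq_self g a, lintegral_comp_smul_of_pos volume hs0]
    simp
  have h2 : (1 : ℝ≥0∞) ≤ 2 ^ d * ENNReal.ofReal (s ^ d) := by
    rw [show (2 : ℝ≥0∞) = ENNReal.ofReal 2 by simp, ← ENNReal.ofReal_pow (by norm_num),
      ← ENNReal.ofReal_mul (by positivity), ← mul_pow, ENNReal.one_le_ofReal]
    exact one_le_pow₀ (by linarith)
  calc ∫⁻ x, g (a + s • x) = 1 * ∫⁻ x, g (a + s • x) := (one_mul _).symm
    _ ≤ 2 ^ d * ENNReal.ofReal (s ^ d) * ∫⁻ x, g (a + s • x) := by gcongr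
    _ = _ := by rw [h1, mul_assoc]

/-- The fundamental theorem of calculus on the segment from `x` to `z`, then Jensen in `t` and
Cauchy–Schwarz for the directional derivative. -/
lemma enorm_sub_sq_le_lintegral {φ : Pt d → ℝ} (hφ : ContDiff ℝ ∞ φ) (x z : Pt d) {R : ℝ}
    (hR : ‖z - x‖ ≤ R) : ‖φ x - φ z‖ₑ ^ 2 ≤ ENNReal.ofReal (R ^ 2) *
      ∫⁻ t in Ioc (0 : ℝ) 1, ∑ i, ‖pderiv i φ (x + t • (z - x))‖ₑ ^ 2 := by
  have hd : ∀ t : ℝ, HasDerivAt (fun t : ℝ => φ (x + t • (z - x)))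
      (fderiv ℝ φ (x + t • (z - x)) (z - x)) t := fun t => by
    have h1 : HasDerivAt (fun t : ℝ => x + t • (z - x)) (z - x) t := by
      simpa using ((hasDerivAt_id t).smul_const (z - x)).const_add x
    exact ((hφ.differentiable (by simp)) _).hasFDerivAt.comp_hasDerivAt t h1
  have hc : Continuous fun t : ℝ => fderiv ℝ φ (x + t • (z - x)) (z - x) :=
    ((hφ.continuous_fderiv (by simp)).comp (by fun_prop)).clm_apply continuous_const
  have hftc := intervalIntegral.integral_eq_sub_of_hasDerivAt (fun t _ => hd t)
    (hc.intervalIntegrable 0 1)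
  have hprob : IsProbabilityMeasure (volume.restrict (Ioc (0 : ℝ) 1)) := ⟨by simp⟩
  have h2 : φ z - φ x = ∫ t in Ioc (0 : ℝ) 1, fderiv ℝ φ (x + t • (z - x)) (z - x) := by
    rw [← intervalIntegral.integral_of_le zero_le_one, hftc]
    simp
  rw [← enorm_neg, neg_sub, h2]
  refine (enorm_integral_sq_le hc.aemeasurable).trans ?_
  rw [← lintegral_const_mul' _ _ ENNReal.ofReal_ne_top]
  refine lintegral_mono fun t => ?_
  simp only [enorm_sq_eq_ofReal]
  rw [← ENNReal.ofReal_sum_of_nonneg fun i _ => sq_nonneg _, ← ENNReal.ofReal_mul (sq_nonneg _)]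
  refine ENNReal.ofReal_le_ofReal ((sq_fderiv_apply_le _ _ _).trans ?_)
  gcongr

/-- The Poincaré inequality on a set `D` that is star-shaped with respect to `B`. -/
lemma poincare_smooth {D B : Set (Pt d)} (hD : MeasurableSet D) (hB : MeasurableSet B)
    (hD1 : volume D ≠ ⊤) (hB0 : volume B ≠ 0) (hBD : B ⊆ D) {R : ℝ}
    (hstar : ∀ x ∈ D, ∀ z ∈ B, ∀ t ∈ Icc (0 : ℝ) 1, x + t • (z - x) ∈ D)
    (hR : ∀ x ∈ D, ∀ z ∈ B, ‖z - x‖ ≤ R) {φ : Pt d → ℝ} (hφ : ContDiff ℝ ∞ φ)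
    (hint : IntegrableOn φ B) :
    sqInt (volume.restrict D) (φ - fun _ => (volume.real B)⁻¹ * ∫ z in B, φ z) ≤
      ENNReal.ofReal (R ^ 2) * 2 ^ d * (1 + volume D / volume B) *
        ∑ i, sqInt (volume.restrict D) (pderiv i φ) := by
  have hB1 : volume B ≠ ⊤ := ne_top_of_le_ne_top hD1 (measure_mono hBD)
  set G : Pt d → ℝ≥0∞ := fun x => ∑ i, ‖pderiv i φ x‖ₑ ^ 2 with hG
  have hGm : Measurable G := Finset.measurable_sum _ fun i _ =>
    ((contDiff_pderiv hφ).continuous.measurable.enorm.pow_const 2)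
  have hGs : ∫⁻ x in D, G x = ∑ i, sqInt (volume.restrict D) (pderiv i φ) := by
    rw [lintegral_finsetSum]
    · rfl
    · exact fun i _ => (contDiff_pderiv hφ).continuous.measurable.enorm.pow_const 2
  set I : ℝ≥0∞ := ∫⁻ x in D, G x with hI
  have hpt : ∀ x ∈ D, ‖φ x - (volume.real B)⁻¹ * ∫ z in B, φ z‖ₑ ^ 2 ≤
      (volume B)⁻¹ * ∫⁻ z in B, ENNReal.ofReal (R ^ 2) *
        ∫⁻ t in Ioc (0 : ℝ) 1, G (x + t • (z - x)) := by
    intro x hx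
    have hprob : IsProbabilityMeasure ((volume B)⁻¹ • volume.restrict B) :=
      ⟨by simp [ENNReal.inv_mul_cancel hB0 hB1]⟩
    have h1 : φ x - (volume.real B)⁻¹ * ∫ z in B, φ z =
        ∫ z, (φ x - φ z) ∂((volume B)⁻¹ • volume.restrict B) := by
      have : IsFiniteMeasure (volume.restrict B) := ⟨by simpa using hB1.lt_top⟩
      rw [integral_smul_measure, integral_sub (integrable_const _) hint, integral_const]
      have : volume.real B ≠ 0 := (ENNReal.toReal_pos hB0 hB1).ne'
      simp only [ENNReal.toReal_inv, measureReal_restrict_apply_univ, smul_eq_mul]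
      rw [← measureReal_def, mul_sub, ← mul_assoc, inv_mul_cancel₀ this, one_mul]
    rw [h1]
    refine (enorm_integral_sq_le
      (aemeasurable_const.sub hφ.continuous.aemeasurable)).trans ?_
    rw [sqInt, lintegral_smul_measure, smul_eq_mul]
    refine mul_le_mul_right ?_ _
    exact setLIntegral_mono' hB fun z hz => enorm_sub_sq_le_lintegral hφ x z (hR x hx z hz)
  have hjoint : Measurable fun p : Pt d × Pt d × ℝ => G (p.1 + p.2.2 • (p.2.1 - p.1)) :=
    hGm.comp (by fun_prop)
  have key : ∀ t ∈ Ioc (0 : ℝ) 1, ∫⁻ x in D, ∫⁻ z in B, G (x + t • (z - x)) ≤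
      2 ^ d * (volume B + volume D) * I := by
    intro t ht
    have hin : ∀ x ∈ D, ∀ z ∈ B, G (x + t • (z - x)) ≤ D.indicator G (x + t • (z - x)) :=
      fun x hx z hz => by rw [indicator_of_mem (hstar x hx z hz t ⟨ht.1.le, ht.2⟩)]
    have hII : ∫⁻ x, D.indicator G x = I := lintegral_indicator hD G
    -- The point `x + t (z - x)` depends on `x` with factor `1 - t` and on `z` with factor `t`.
    -- Integrating first in the variable whose factor is at least one half avoids a singular
    -- Jacobian.
    rcases le_total t (1 / 2) with h | h
    · rw [lintegral_lintegral_swap]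
      · calc ∫⁻ z in B, ∫⁻ x in D, G (x + t • (z - x))
            ≤ ∫⁻ z in B, 2 ^ d * I := by
              refine setLIntegral_mono' hB fun z hz => ?_
              calc ∫⁻ x in D, G (x + t • (z - x))
                  ≤ ∫⁻ x in D, D.indicator G (t • z + (1 - t) • x) := by
                    refine setLIntegral_mono' hD fun x hx => ?_
                    have : t • z + (1 - t) • x = x + t • (z - x) := by module
                    rw [this]; exact hin x hx z hz
                _ ≤ ∫⁻ x, D.indicator G (t • z + (1 - t) • x) := setLIntegral_le_lintegral _ _
                _ ≤ 2 ^ d * I := by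
                    rw [← hII]; exact lintegral_comp_add_smul_le (by linarith) _ _
          _ = 2 ^ d * volume B * I := by
              rw [lintegral_const, Measure.restrict_apply_univ]; ring
          _ ≤ _ := by gcongr; exact le_self_add
      · exact (hjoint.comp (f := fun p : Pt d × Pt d => (p.1, p.2, t)) (by fun_prop)).aemeasurable
    · calc ∫⁻ x in D, ∫⁻ z in B, G (x + t • (z - x))
            ≤ ∫⁻ x in D, 2 ^ d * I := by
              refine setLIntegral_mono' hD fun x hx => ?_
              calc ∫⁻ z in B, G (x + t • (z - x))
                  ≤ ∫⁻ z in B, D.indicator G ((1 - t) • x + t • z) := by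
                    refine setLIntegral_mono' hB fun z hz => ?_
                    have : (1 - t) • x + t • z = x + t • (z - x) := by module
                    rw [this]; exact hin x hx z hz
                _ ≤ ∫⁻ z, D.indicator G ((1 - t) • x + t • z) := setLIntegral_le_lintegral _ _
                _ ≤ 2 ^ d * I := by
                    rw [← hII]; exact lintegral_comp_add_smul_le h _ _
          _ = 2 ^ d * volume D * I := by
              rw [lintegral_const, Measure.restrict_apply_univ]; ring
          _ ≤ _ := by gcongr; exact le_add_self
  calc sqInt (volume.restrict D) (φ - fun _ => (volume.real B)⁻¹ * ∫ z in B, φ z)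
      ≤ ∫⁻ x in D, (volume B)⁻¹ * ∫⁻ z in B, ENNReal.ofReal (R ^ 2) *
        ∫⁻ t in Ioc (0 : ℝ) 1, G (x + t • (z - x)) := setLIntegral_mono' hD hpt
    _ = (volume B)⁻¹ * ENNReal.ofReal (R ^ 2) * ∫⁻ t in Ioc (0 : ℝ) 1, ∫⁻ x in D, ∫⁻ z in B,
          G (x + t • (z - x)) := by
        have h1 : ∀ x : Pt d, ∫⁻ z in B, ENNReal.ofReal (R ^ 2) *
            ∫⁻ t in Ioc (0 : ℝ) 1, G (x + t • (z - x)) = ENNReal.ofReal (R ^ 2) *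
              ∫⁻ t in Ioc (0 : ℝ) 1, ∫⁻ z in B, G (x + t • (z - x)) := fun x => by
          rw [lintegral_const_mul' _ _ ENNReal.ofReal_ne_top, lintegral_lintegral_swap]
          exact (hjoint.comp (f := fun p : Pt d × ℝ => (x, p.1, p.2)) (by fun_prop)).aemeasurable
        simp_rw [h1]
        rw [lintegral_const_mul' _ _ (ENNReal.inv_ne_top.2 hB0),
          lintegral_const_mul' _ _ ENNReal.ofReal_ne_top, mul_assoc]
        congr 2
        rw [lintegral_lintegral_swap]
        refine Measurable.aemeasurable ?_
        refine Measurable.lintegral_prod_right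
          (f := fun (q : Pt d × ℝ) (z : Pt d) => G (q.1 + q.2 • (z - q.1))) ?_
        exact hjoint.comp (f := fun p : (Pt d × ℝ) × Pt d => (p.1.1, p.2, p.1.2)) (by fun_prop)
    _ ≤ (volume B)⁻¹ * ENNReal.ofReal (R ^ 2) * ∫⁻ t in Ioc (0 : ℝ) 1,
          2 ^ d * (volume B + volume D) * I := by
        gcongr _ * ?_
        exact setLIntegral_mono' measurableSet_Ioc key
    _ = ENNReal.ofReal (R ^ 2) * 2 ^ d * ((volume B)⁻¹ * (volume B + volume D)) * I := by
        rw [lintegral_const, Measure.restrict_apply_univ]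
        simp
        ring
    _ = _ := by
        rw [hGs, mul_add, ENNReal.inv_mul_cancel hB0 hB1, mul_comm (volume B)⁻¹, ← div_eq_mul_inv]

/-- The Poincaré inequality for limits of smooth functions in `H¹`. -/
lemma SmoothApprox.poincare {Ω D B : Set (Pt d)} (hD : MeasurableSet D) (hB : MeasurableSet B)
    (hDΩ : D ⊆ Ω) (hDb : Bornology.IsBounded D) (hB0 : volume B ≠ 0) (hBD : B ⊆ D) {R : ℝ}
    (hstar : ∀ x ∈ D, ∀ z ∈ B, ∀ t ∈ Icc (0 : ℝ) 1, x + t • (z - x) ∈ D)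
    (hR : ∀ x ∈ D, ∀ z ∈ B, ‖z - x‖ ≤ R) {w : Pt d → ℝ} {H : Fin d → Pt d → ℝ}
    (hw : SmoothApprox Ω w H) (hwm : MemLp w 2 (volume.restrict Ω))
    (hH : ∀ i, AEMeasurable (H i) (volume.restrict Ω)) (h0 : ∫ x in B, w x = 0) :
    sqInt (volume.restrict D) w ≤
      8 * (ENNReal.ofReal (R ^ 2) * 2 ^ d * (1 + volume D / volume B)) *
        ∑ i, sqInt (volume.restrict D) (H i) := by
  obtain ⟨ψ, hψ, hψw, hψH⟩ := hw
  have hD1 : volume D ≠ ⊤ := hDb.measure_lt_top.ne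
  have hB1 : volume B ≠ ⊤ := ne_top_of_le_ne_top hD1 (measure_mono hBD)
  set P : ℝ≥0∞ := ENNReal.ofReal (R ^ 2) * 2 ^ d * (1 + volume D / volume B) with hP
  have hPt : P ≠ ⊤ := by
    refine ENNReal.mul_ne_top (ENNReal.mul_ne_top ENNReal.ofReal_ne_top (by simp)) ?_
    exact ENNReal.add_ne_top.2 ⟨by simp, ENNReal.div_ne_top hD1 hB0⟩
  set S := ∑ i, sqInt (volume.restrict D) (H i) with hS
  have hDm : volume.restrict D ≤ volume.restrict Ω := Measure.restrict_mono_set _ hDΩ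
  have hBm : volume.restrict B ≤ volume.restrict Ω := Measure.restrict_mono_set _ (hBD.trans hDΩ)
  have hBint : IntegrableOn w B := by
    have : IsFiniteMeasure (volume.restrict B) := ⟨by simpa using hB1.lt_top⟩
    exact (hwm.mono_measure hBm).integrable (by norm_num)
  have hψint : ∀ m, IntegrableOn (ψ m) B := fun m =>
    ((hψ m).continuous.continuousOn.integrableOn_compact
      (hDb.subset hBD).isCompact_closure).mono_set subset_closure
  set a : ℕ → ℝ≥0∞ := fun m => sqInt (volume.restrict Ω) (ψ m - w) with ha
  set b : ℕ → ℝ≥0∞ := fun m => ∑ i, sqInt (volume.restrict Ω) (pderiv i (ψ m) - H i) with hb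
  have hb0 : Tendsto b atTop (𝓝 0) := by
    simpa using tendsto_finsetSum Finset.univ fun i _ => hψH i
  -- Compare `w` with its approximation, that with its mean over `B`, and its gradient with `H`.
  -- Each comparison costs a factor two, which gives the factor eight in the limit.
  have hbound : ∀ m, sqInt (volume.restrict D) w ≤
      2 * a m + 2 * (2 * (P * (2 * b m + 2 * S)) + 2 * ((volume B)⁻¹ * a m * volume D)) := by
    intro m
    set c : ℝ := (volume.real B)⁻¹ * ∫ z in B, ψ m z with hc
    -- Since `w` has mean zero over `B`, the mean of the approximation is the mean of the
    -- approximation error, and tends to zero.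
    have hcm : ‖c‖ₑ ^ 2 ≤ (volume B)⁻¹ * a m := by
      have hprob : IsProbabilityMeasure ((volume B)⁻¹ • volume.restrict B) :=
        ⟨by simp [ENNReal.inv_mul_cancel hB0 hB1]⟩
      have h1 : c = ∫ z, (ψ m - w) z ∂((volume B)⁻¹ • volume.restrict B) := by
        rw [integral_smul_measure, integral_sub' (hψint m) hBint, h0, sub_zero]
        simp [hc, measureReal_def]
      rw [h1]
      refine (enorm_integral_sq_le ?_).trans ?_
      · exact (((hψ m).continuous.aemeasurable).sub
          hBint.aestronglyMeasurable.aemeasurable).smul_measure _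
      · rw [sqInt, lintegral_smul_measure, smul_eq_mul]
        gcongr
        exact sqInt_mono_measure hBm _
    have h1 : sqInt (volume.restrict D) w ≤ 2 * a m + 2 * sqInt (volume.restrict D) (ψ m) := by
      have : w = (w - ψ m) + ψ m := by simp
      conv_lhs => rw [this]
      refine (sqInt_add_le ((hwm.mono_measure hDm).aestronglyMeasurable.aemeasurable.sub
        (hψ m).continuous.aemeasurable) _).trans ?_
      gcongr
      rw [sqInt_sub_comm]
      exact sqInt_mono_measure hDm _
    have h2 : sqInt (volume.restrict D) (ψ m) ≤ 2 * sqInt (volume.restrict D) (ψ m - fun _ => c) +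
        2 * ((volume B)⁻¹ * a m * volume D) := by
      have : ψ m = (ψ m - fun _ => c) + fun _ => c := by simp
      conv_lhs => rw [this]
      refine (sqInt_add_le ((hψ m).continuous.aemeasurable.sub aemeasurable_const) _).trans ?_
      gcongr
      rw [sqInt, lintegral_const, Measure.restrict_apply_univ]
      gcongr
    have h3 := poincare_smooth hD hB hD1 hB0 hBD hstar hR (hψ m) (hψint m)
    have h4 : ∑ i, sqInt (volume.restrict D) (pderiv i (ψ m)) ≤ 2 * b m + 2 * S := by
      rw [hb, hS, Finset.mul_sum, Finset.mul_sum, ← Finset.sum_add_distrib]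
      refine Finset.sum_le_sum fun i _ => ?_
      have : pderiv i (ψ m) = (pderiv i (ψ m) - H i) + H i := by simp
      conv_lhs => rw [this]
      refine (sqInt_add_le ((contDiff_pderiv (hψ m)).continuous.aemeasurable.sub
        ((hH i).mono_measure hDm)) _).trans ?_
      gcongr
      exact sqInt_mono_measure hDm _
    refine h1.trans ?_
    gcongr
    refine h2.trans ?_
    gcongr
    exact h3.trans (by gcongr)
  have hlim : Tendsto (fun m => 2 * a m + 2 * (2 * (P * (2 * b m + 2 * S)) +
      2 * ((volume B)⁻¹ * a m * volume D))) atTop (𝓝 (2 * 0 + 2 * (2 * (P * (2 * 0 + 2 * S)) +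
      2 * ((volume B)⁻¹ * 0 * volume D)))) := by
    have t2 : ∀ {f : ℕ → ℝ≥0∞} {l : ℝ≥0∞}, Tendsto f atTop (𝓝 l) →
        Tendsto (fun m => 2 * f m) atTop (𝓝 (2 * l)) := fun h =>
      ENNReal.Tendsto.const_mul h (Or.inr ENNReal.ofNat_ne_top)
    refine (t2 hψw).add (t2 (Tendsto.add (t2 (ENNReal.Tendsto.const_mul
      ((t2 hb0).add_const _) (Or.inr hPt))) (t2 ?_)))
    exact ENNReal.Tendsto.mul_const (ENNReal.Tendsto.const_mul hψw
      (Or.inr (ENNReal.inv_ne_top.2 hB0))) (Or.inr hD1)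
  refine (ge_of_tendsto' hlim hbound).trans (le_of_eq ?_)
  simp only [mul_zero, zero_mul, add_zero, zero_add]
  ring

lemma SmoothApprox.sub_smooth {Ω : Set (Pt d)} {w p : Pt d → ℝ} {H : Fin d → Pt d → ℝ}
    (hw : SmoothApprox Ω w H) (hp : ContDiff ℝ ∞ p) :
    SmoothApprox Ω (w - p) (fun i => H i - pderiv i p) := by
  obtain ⟨φ, hφ, h1, h2⟩ := hw
  refine ⟨fun m => φ m - p, fun m => (hφ m).sub hp, ?_, fun i => ?_⟩
  · simpa using h1
  · refine (h2 i).congr fun m => ?_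
    rw [pderiv_sub ((hφ m).differentiable (by simp)) (hp.differentiable (by simp)),
      sub_sub_sub_cancel_right]

end Poincare

section WeakDerivatives

variable {d : ℕ} {Ω : Set (Pt d)}

lemma MemSobolev.weakDeriv_spec {m : ℕ} {u : Pt d → ℝ} (hu : MemSobolev Ω m u) {α : Fin d → ℕ}
    (hα : ∑ i, α i ≤ m) : MemLp (weakDeriv Ω α u) 2 (volume.restrict Ω) ∧
      HasWeakDeriv Ω α u (weakDeriv Ω α u) := by
  have h := hu.2 α hα
  rw [weakDeriv, dif_pos h]
  exact h.choose_spec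

lemma sum_add_single (α : Fin d → ℕ) (i : Fin d) :
    ∑ j, (α + Pi.single i 1 : Fin d → ℕ) j = ∑ j, α j + 1 := by
  simp [Finset.sum_add_distrib]

/-- Both sides are `∫ u ∂^(α + eᵢ) φ` up to sign: once by testing order `α` with `∂ᵢφ`, once by
testing order `α + eᵢ` with `φ`. The Poincaré inequality can thus be applied to the derivatives of
`u` in turn. -/
lemma MemSobolev.hasWeakDeriv_weakDeriv {m : ℕ} {u : Pt d → ℝ} (hu : MemSobolev Ω m u)
    {α : Fin d → ℕ} {i : Fin d} (hα : ∑ j, α j + 1 ≤ m) :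
    HasWeakDeriv Ω (Pi.single i 1) (weakDeriv Ω α u) (weakDeriv Ω (α + Pi.single i 1) u) := by
  intro φ hφ hc hs
  have h1 := (hu.weakDeriv_spec (α := α) (by omega)).2 (pderiv i φ) (contDiff_pderiv hφ)
    (hasCompactSupport_pderiv hc) ((tsupport_pderiv_subset φ).trans hs)
  have h2 := (hu.weakDeriv_spec (α := α + Pi.single i 1) (by rwa [sum_add_single])).2 φ hφ hc hs
  rw [multiDeriv_add_single α i hφ, sum_add_single] at h2
  rw [multiDeriv_single i hφ]
  rw [h1, pow_succ] at h2
  have h3 : ((-1 : ℝ) ^ ∑ j, α j) ≠ 0 := pow_ne_zero _ (by norm_num)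
  have h4 : ∑ j, (Pi.single i 1 : Fin d → ℕ) j = 1 := by simp
  rw [h4]
  have h5 := mul_left_cancel₀ h3 (by rw [h2, mul_assoc] :
    ((-1 : ℝ) ^ ∑ j, α j) * ∫ x in Ω, weakDeriv Ω α u x * pderiv i φ x =
      ((-1 : ℝ) ^ ∑ j, α j) * ((-1) * ∫ x in Ω, weakDeriv Ω (α + Pi.single i 1) u x * φ x))
  rw [h5]; ring

/-- Testing against all test functions determines the order-zero derivative almost everywhere. It is
a chosen representative, so estimates for it have to be transferred to `u`. -/
lemma MemSobolev.weakDeriv_zero_ae_eq {m : ℕ} {u : Pt d → ℝ} (hu : MemSobolev Ω m u)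
    (hΩ : IsOpen Ω) (hΩb : Bornology.IsBounded Ω) :
    weakDeriv Ω 0 u =ᵐ[volume.restrict Ω] u := by
  obtain ⟨h1, h2⟩ := hu.weakDeriv_spec (α := 0) (by simp)
  have hfin : IsFiniteMeasure (volume.restrict Ω) := ⟨by simpa using hΩb.measure_lt_top⟩
  have hi : IntegrableOn (weakDeriv Ω 0 u - u) Ω := ((h1.sub hu.1).integrable (by norm_num))
  have h3 : ∀ᵐ x, x ∈ Ω → (weakDeriv Ω 0 u - u) x = 0 := by
    refine hΩ.ae_eq_zero_of_integral_contDiff_smul_eq_zero hi.locallyIntegrableOn ?_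
    intro φ hφ hc hs
    have h4 := h2 φ hφ hc hs
    rw [multiDeriv_zero] at h4
    simp only [Pi.zero_apply, Finset.sum_const_zero, pow_zero, one_mul] at h4
    have h5 : ∀ f : Pt d → ℝ, MemLp f 2 (volume.restrict Ω) → IntegrableOn (fun x => f x * φ x) Ω :=
      fun f hf => ((memLp_smooth_mul hφ.continuous hc hf).integrable (by norm_num)).congr
        (ae_of_all _ fun x => mul_comm _ _)
    rw [← setIntegral_eq_integral_of_forall_compl_eq_zero (s := Ω)]
    · have : (fun x => φ x • (weakDeriv Ω 0 u - u) x) =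
          fun x => weakDeriv Ω 0 u x * φ x - u x * φ x := by
        funext x; simp; ring
      rw [this, integral_sub (h5 _ h1) (h5 _ hu.1), h4, sub_self]
    · intro x hx
      have : φ x = 0 := by
        by_contra hne
        exact hx (hs (subset_tsupport φ hne))
      simp [this]
  rw [Filter.EventuallyEq, ae_restrict_iff' hΩ.measurableSet]
  exact h3.mono fun x hx hxΩ => sub_eq_zero.1 (hx hxΩ)

/-- The sum of the squared `L²` norms of the weak derivatives of order `m` over `D`. -/
def sobolevSq (Ω : Set (Pt d)) (m : ℕ) (u : Pt d → ℝ) (D : Set (Pt d)) : ℝ≥0∞ :=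
  ∑ α ∈ Finset.piAntidiag (Finset.univ : Finset (Fin d)) m,
    sqInt (volume.restrict D) (weakDeriv Ω α u)

end WeakDerivatives

/-- Polynomial approximation of a Sobolev function on a set that is star-shaped with respect
to `B`. -/
lemma exists_isPoly_sqInt_le {n : ℕ} {Ω D B : Set (Pt (n + 1))} (hΩ : IsLipschitzDomain Ω) {k : ℕ}
    {u : Pt (n + 1) → ℝ} (hu : MemSobolev Ω (k + 1) u)
    (hD : MeasurableSet D) (hB : MeasurableSet B)
    (hDΩ : D ⊆ Ω) (hB0 : volume B ≠ 0) (hBD : B ⊆ D) {R : ℝ}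
    (hstar : ∀ x ∈ D, ∀ z ∈ B, ∀ t ∈ Icc (0 : ℝ) 1, x + t • (z - x) ∈ D)
    (hR : ∀ x ∈ D, ∀ z ∈ B, ‖z - x‖ ≤ R) :
    ∃ p : Pt (n + 1) → ℝ, IsPoly k p ∧ ∀ (j : ℕ) (α : Fin (n + 1) → ℕ), ∑ i, α i + j = k + 1 →
      sqInt (volume.restrict D) (weakDeriv Ω α u - multiDeriv α p) ≤
        (8 * (ENNReal.ofReal (R ^ 2) * 2 ^ (n + 1) * (1 + volume D / volume B)) * (n + 1)) ^ j *
          sobolevSq Ω (k + 1) u D := by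
  have hDb := hΩ.isBounded.subset hDΩ
  obtain ⟨p, hp, hpm⟩ := exists_isPoly_integral_multiDeriv k (hDb.subset hBD) hB0
    (fun α => ∫ x in B, weakDeriv Ω α u x)
  -- Induction on `j = k + 1 - |α|`. At top order the derivative of `p` is zero. At lower orders the
  -- difference has mean zero over `B` by the choice of `p`, so one Poincaré inequality reduces it
  -- to order one higher.
  refine ⟨p, hp, fun j => ?_⟩
  induction j with
  | zero =>
    intro α hα
    rw [hp.multiDeriv_eq_zero (by omega), sub_zero, pow_zero, one_mul]
    exact Finset.single_le_sum (f := fun α => sqInt (volume.restrict D) (weakDeriv Ω α u))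
      (fun _ _ => zero_le) (by simp; omega)
  | succ j ih =>
    intro α hα
    have hB1 : volume B ≠ ⊤ := (hDb.subset hBD).measure_lt_top.ne
    have hfin : IsFiniteMeasure (volume.restrict B) := ⟨by simpa using hB1.lt_top⟩
    have hspec := fun (α : Fin (n + 1) → ℕ) (h : ∑ i, α i ≤ k + 1) => (hu.weakDeriv_spec h).1
    have hadd : ∀ i, ∑ l, (α + Pi.single i 1 : Fin (n + 1) → ℕ) l ≤ k + 1 := fun i => by
      rw [sum_add_single]; omega
    have hpsm : ∀ α, ContDiff ℝ ∞ (multiDeriv α p) := fun α => contDiff_multiDeriv α hp.contDiff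
    have hΩb : IsFiniteMeasure (volume.restrict Ω) := ⟨by simpa using hΩ.isBounded.measure_lt_top⟩
    have hpL : MemLp (multiDeriv α p) 2 (volume.restrict Ω) := by
      obtain ⟨C, hC⟩ := hΩ.isBounded.isCompact_closure.exists_bound_of_continuousOn
        (hpsm α).continuous.continuousOn
      refine MemLp.of_bound (hpsm α).continuous.aestronglyMeasurable C ?_
      filter_upwards [ae_restrict_mem hΩ.isOpen.measurableSet] with x hx
      exact hC x (subset_closure hx)
    have hap := (hΩ.smoothApprox (hspec α (by omega)) (fun i => hspec _ (hadd i))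
      (fun i => hu.hasWeakDeriv_weakDeriv (by omega))).sub_smooth (hpsm α)
    have h0 : ∫ x in B, (weakDeriv Ω α u - multiDeriv α p) x = 0 := by
      have hm := Measure.restrict_mono_set (volume : Measure (Pt (n + 1))) (hBD.trans hDΩ)
      rw [integral_sub' (((hspec α (by omega)).mono_measure hm).integrable (by norm_num))
        ((hpL.mono_measure hm).integrable (by norm_num)), hpm α (by omega), sub_self]
    refine (hap.poincare hD hB hDΩ hDb hB0 hBD hstar hR ((hspec α (by omega)).sub hpL)
      (fun i => (hspec _ (hadd i)).aestronglyMeasurable.aemeasurable.sub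
        (contDiff_pderiv (hpsm α)).continuous.aemeasurable) h0).trans ?_
    set P : ℝ≥0∞ := 8 * (ENNReal.ofReal (R ^ 2) * 2 ^ (n + 1) * (1 + volume D / volume B)) with hP
    rw [pow_succ', mul_assoc _ _ (sobolevSq _ _ _ _), mul_assoc P]
    gcongr
    calc ∑ i, sqInt (volume.restrict D) (weakDeriv Ω (α + Pi.single i 1) u -
          pderiv i (multiDeriv α p)) ≤
          ∑ _i : Fin (n + 1), (P * (n + 1)) ^ j * sobolevSq Ω (k + 1) u D := by
          refine Finset.sum_le_sum fun i _ => ?_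
          rw [← multiDeriv_pderiv α i hp.contDiff, ← multiDeriv_add_single α i hp.contDiff]
          exact ih _ (by rw [sum_add_single]; omega)
      _ = _ := by simp

/-! ### Local approximation near the points of a Lipschitz domain -/

section Local

variable {n : ℕ} {Ω : Set (Pt (n + 1))}

/-- A point with positive weight on `a` can be moved freely by moving `a` within `s`; with zero
weight it lies in the open set `t`. -/
lemma isOpen_convexJoin {E : Type*} [NormedAddCommGroup E] [NormedSpace ℝ E] {s t : Set E}
    (hs : IsOpen s) (ht : IsOpen t) (hsn : s.Nonempty) : IsOpen (convexJoin ℝ s t) := by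
  rw [isOpen_iff_mem_nhds]
  intro x hx
  obtain ⟨a, ha, b, hb, hab⟩ := mem_convexJoin.1 hx
  obtain ⟨p, q, hp, hq, hpq, rfl⟩ := hab
  rcases hp.eq_or_lt with rfl | hp
  · obtain rfl : q = 1 := by linarith
    simp only [zero_smul, one_smul, zero_add]
    exact Filter.mem_of_superset (ht.mem_nhds hb) (subset_convexJoin_right hsn)
  · have hc : Tendsto (fun y : E => p⁻¹ • (y - q • b)) (𝓝 (p • a + q • b)) (𝓝 a) := by
      have : Continuous fun y : E => p⁻¹ • (y - q • b) := by fun_prop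
      simpa [smul_smul, hp.ne'] using this.tendsto (p • a + q • b)
    filter_upwards [hc (hs.mem_nhds ha)] with y hy
    refine mem_convexJoin.2 ⟨_, hy, b, hb, p, q, hp.le, hq, hpq, ?_⟩
    simp [smul_smul, hp.ne']

/-- Near each point of a Lipschitz domain, at each small scale `h`, there is a set that is
star-shaped with respect to a ball of radius `h`. -/
lemma IsLipschitzDomain.exists_star_set (hΩ : IsLipschitzDomain Ω) :
    ∃ h₀ Λ : ℝ, 0 < h₀ ∧ 2 ≤ Λ ∧ ∀ x ∈ closure Ω, ∀ h : ℝ, 0 < h → h < h₀ →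
      ∃ (D : Set (Pt (n + 1))) (z₀ : Pt (n + 1)), IsOpen D ∧ D ⊆ Ω ∧
        D ⊆ Metric.ball x (Λ * h) ∧ Ω ∩ Metric.closedBall x h ⊆ D ∧ Metric.ball z₀ h ⊆ D ∧
        ∀ y ∈ D, ∀ z ∈ Metric.ball z₀ h, ∀ t ∈ Icc (0 : ℝ) 1, y + t • (z - y) ∈ D := by
  choose! r s ν hr hs hs1 hν hcone using fun x (hx : x ∈ closure Ω) => hΩ.exists_cone hx
  have hcpt : IsCompact (closure Ω) := hΩ.isBounded.isCompact_closure
  obtain ⟨J, hJ, hcov⟩ := hcpt.elim_nhds_subcover (fun x => Metric.ball x (r x / 2))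
    fun x hx => Metric.ball_mem_nhds x (half_pos (hr x hx))
  have hJne : J.Nonempty := by
    obtain ⟨x, hx⟩ := hΩ.isConnected.nonempty
    obtain ⟨y, hy, -⟩ := mem_iUnion₂.1 (hcov (subset_closure hx))
    exact ⟨y, hy⟩
  -- Compactness makes the cone parameters uniform: the smallest admissible scale and the largest
  -- enlargement factor over a finite cover.
  obtain ⟨j₁, hj₁, hmin⟩ := J.exists_min_image (fun j => r j * s j / 4) hJne
  obtain ⟨j₂, hj₂, hmax⟩ := J.exists_max_image (fun j => 3 / s j + 2) hJne
  have hpos2 := hs j₂ (hJ j₂ hj₂)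
  refine ⟨r j₁ * s j₁ / 4, 3 / s j₂ + 2, ?_, ?_, ?_⟩
  · have := hr j₁ (hJ j₁ hj₁)
    have := hs j₁ (hJ j₁ hj₁)
    positivity
  · have : 0 ≤ 3 / s j₂ := by positivity
    linarith
  intro x hx h hh hhlt
  obtain ⟨j, hj, hxj⟩ := mem_iUnion₂.1 (hcov hx)
  have hrj := hr j (hJ j hj)
  have hsj := hs j (hJ j hj)
  have hsj1 := hs1 j (hJ j hj)
  have hh4 : 4 * h < r j * s j := by have := hmin j hj; linarith
  have hhr : 4 * h < r j := by nlinarith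
  -- The ball is pushed a distance `lam * h` into the cone. A vector from `A` to `B` differs from
  -- `lam * h` times the axis by less than `3 h = lam * h * s`, so the whole segment remains in the
  -- cone at its starting point, hence in `Ω`.
  set lam : ℝ := 3 / s j with hlam
  have hlamp : 0 < lam := by positivity
  have hlams : lam * s j = 3 := by rw [hlam]; field_simp
  have hlamh : lam * h ≤ r j := by
    have : lam * h * s j ≤ r j * s j := by
      rw [mul_right_comm, hlams]; linarith
    exact le_of_mul_le_mul_right this hsj
  set A : Set (Pt (n + 1)) := Ω ∩ Metric.ball x (2 * h) with hA
  set z₀ : Pt (n + 1) := x + (lam * h) • ν j with hz₀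
  set B : Set (Pt (n + 1)) := Metric.ball z₀ h with hB
  have hAo : IsOpen A := hΩ.isOpen.inter Metric.isOpen_ball
  have hAne : A.Nonempty := by
    obtain ⟨y, hy, hxy⟩ := Metric.mem_closure_iff.1 hx (2 * h) (by positivity)
    exact ⟨y, hy, by rwa [Metric.mem_ball']⟩
  have hBne : B.Nonempty := ⟨z₀, Metric.mem_ball_self hh⟩
  have hBD : B ⊆ convexJoin ℝ A B := subset_convexJoin_right hAne
  have hlam2 : lam + 2 ≤ 3 / s j₂ + 2 := hmax j hj
  refine ⟨convexJoin ℝ A B, z₀, isOpen_convexJoin hAo Metric.isOpen_ball hAne, ?_, ?_, ?_, hBD, ?_⟩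
  · intro y hy
    obtain ⟨a, ha, b, hb, hab⟩ := mem_convexJoin.1 hy
    rw [segment_eq_image'] at hab
    obtain ⟨t, ht, rfl⟩ := hab
    have haj : a ∈ Ω ∩ Metric.ball j (r j) := by
      refine ⟨ha.1, ?_⟩
      have h1 := Metric.mem_ball.1 ha.2
      have h2 := Metric.mem_ball.1 hxj
      rw [Metric.mem_ball]
      have := dist_triangle a x j
      linarith
    have key := hcone j (hJ j hj) a haj ((lam * h)⁻¹ • (b - a - (lam * h) • ν j)) ?_
      (t * (lam * h)) ⟨by have := ht.1; positivity, ?_⟩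
    · have hne : lam * h ≠ 0 := by positivity
      have h3 : (t * (lam * h)) • (ν j + (lam * h)⁻¹ • (b - a - (lam * h) • ν j)) = t • (b - a) := by
        rw [mul_smul]
        congr 1
        rw [smul_add, smul_inv_smul₀ hne]
        abel
      rwa [h3] at key
    · have h4 : b - a - (lam * h) • ν j = (b - z₀) + (x - a) := by rw [hz₀]; abel
      rw [norm_smul, norm_inv, Real.norm_of_nonneg (by positivity : 0 ≤ lam * h), h4]
      have h5 : ‖(b - z₀) + (x - a)‖ < 3 * h := by
        have h6 : ‖b - z₀‖ < h := by simpa [dist_eq_norm] using Metric.mem_ball.1 hb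
        have h7 : ‖x - a‖ < 2 * h := by simpa [dist_eq_norm] using Metric.mem_ball'.1 ha.2
        linarith [norm_add_le (b - z₀) (x - a)]
      rw [inv_mul_lt_iff₀ (by positivity)]
      calc _ < 3 * h := h5
        _ = lam * h * s j := by rw [mul_right_comm, hlams]
    · calc t * (lam * h) ≤ 1 * (lam * h) := by gcongr; exact ht.2
        _ ≤ r j := by linarith
  · refine convexJoin_subset ?_ ?_ (convex_ball _ _)
    · exact inter_subset_right.trans (Metric.ball_subset_ball (by nlinarith))
    · refine Metric.ball_subset_ball' ?_
      rw [hz₀, dist_eq_norm, add_sub_cancel_left, norm_smul, hν j (hJ j hj),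
        Real.norm_of_nonneg (by positivity)]
      nlinarith
  · refine (inter_subset_inter_right _ (Metric.closedBall_subset_ball (by linarith))).trans
      (subset_convexJoin_left hBne)
  · intro y hy z hz t ht
    -- Joining with `B` a second time adds nothing, by associativity of the join and convexity of
    -- `B`.
    have h1 : y + t • (z - y) ∈ convexJoin ℝ (convexJoin ℝ A B) B := by
      refine segment_subset_convexJoin hy hz ?_
      rw [segment_eq_image']
      exact ⟨t, ht, rfl⟩
    rw [convexJoin_assoc] at h1
    exact convexJoin_mono_right (convexJoin_subset le_rfl le_rfl (convex_ball _ _)) h1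

lemma sobolevSq_mono {m : ℕ} {u : Pt (n + 1) → ℝ} {D D' : Set (Pt (n + 1))} (h : D ⊆ D') :
    sobolevSq Ω m u D ≤ sobolevSq Ω m u D' :=
  Finset.sum_le_sum fun _ _ => sqInt_mono_measure (Measure.restrict_mono_set _ h) _

lemma sqInt_weakDeriv_le_sobolevSq {m : ℕ} {u : Pt (n + 1) → ℝ} {D : Set (Pt (n + 1))}
    {α : Fin (n + 1) → ℕ} (h : ∑ i, α i < m) :
    sqInt (volume.restrict D) (weakDeriv Ω α u) ≤
      ∑ j ∈ Finset.range m, sobolevSq Ω j u D := by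
  refine le_trans ?_ (Finset.single_le_sum (f := fun j => sobolevSq Ω j u D)
    (fun _ _ => zero_le) (Finset.mem_range.2 h))
  exact Finset.single_le_sum (f := fun α => sqInt (volume.restrict D) (weakDeriv Ω α u))
    (fun _ _ => zero_le) (by simp)

/-- Local polynomial approximation of Sobolev functions on a Lipschitz domain. -/
lemma IsLipschitzDomain.exists_local_approx (hΩ : IsLipschitzDomain Ω) (k : ℕ) :
    ∃ C R : ℝ, 0 < C ∧ 1 ≤ R ∧ ∀ u : Pt (n + 1) → ℝ, MemSobolev Ω (k + 1) u →
      ∀ x ∈ closure Ω, ∀ h : ℝ, 0 < h → ∃ p : Pt (n + 1) → ℝ, IsPoly k p ∧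
        sqInt (volume.restrict (Ω ∩ Metric.closedBall x h)) (u - p) ≤
          ENNReal.ofReal (C * h ^ (2 * k + 2)) *
            ∑ j ∈ Finset.range (k + 2), sobolevSq Ω j u (Ω ∩ Metric.ball x (R * h)) ∧
        ∀ i, sqInt (volume.restrict (Ω ∩ Metric.closedBall x h))
          (weakDeriv Ω (Pi.single i 1) u - pderiv i p) ≤
          ENNReal.ofReal (C * h ^ (2 * k)) *
            ∑ j ∈ Finset.range (k + 2), sobolevSq Ω j u (Ω ∩ Metric.ball x (R * h)) := by
  obtain ⟨h₀, Λ, hh₀, hΛ, hstar⟩ := hΩ.exists_star_set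
  set c : ℝ := 8 * ((2 * Λ) ^ 2 * 2 ^ (n + 1) * (1 + Λ ^ (n + 1))) * (n + 1) with hc
  have hcpos : 0 < c := by positivity
  -- The powers of `c`, the Poincaré constant at unit scale, serve scales below `h₀`; the inverse
  -- powers of `h₀` serve the larger scales.
  refine ⟨max (max (c ^ (k + 1)) (c ^ k)) (max (h₀ ^ (2 * k + 2))⁻¹ (h₀ ^ (2 * k))⁻¹), Λ,
    by positivity, by linarith, ?_⟩
  set C : ℝ := max (max (c ^ (k + 1)) (c ^ k)) (max (h₀ ^ (2 * k + 2))⁻¹ (h₀ ^ (2 * k))⁻¹) with hC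
  have hC1 : c ^ (k + 1) ≤ C := (le_max_left _ _).trans (le_max_left _ _)
  have hC2 : c ^ k ≤ C := (le_max_right _ _).trans (le_max_left _ _)
  have hC3 : (h₀ ^ (2 * k + 2))⁻¹ ≤ C := (le_max_left _ _).trans (le_max_right _ _)
  have hC4 : (h₀ ^ (2 * k))⁻¹ ≤ C := (le_max_right _ _).trans (le_max_right _ _)
  intro u hu x hx h hh
  have hu0 := hu.weakDeriv_zero_ae_eq hΩ.isOpen hΩ.isBounded
  have hV : ∀ s : Set (Pt (n + 1)), volume.restrict (Ω ∩ s) ≤ volume.restrict Ω := fun s =>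
    Measure.restrict_mono_set _ inter_subset_left
  rcases lt_or_ge h h₀ with hlt | hge
  · obtain ⟨D, z₀, hDo, hDΩ, hDx, hVD, hBD, hst⟩ := hstar x hx h hh hlt
    have hB0 : volume (Metric.ball z₀ h) ≠ 0 := (Metric.measure_ball_pos volume z₀ hh).ne'
    obtain ⟨p, hp, hest⟩ := exists_isPoly_sqInt_le hΩ hu hDo.measurableSet
      Metric.isOpen_ball.measurableSet hDΩ hB0 hBD hst (R := 2 * Λ * h) (by
        intro y hy z hz
        have h1 := Metric.mem_ball.1 (hDx hy)
        have h2 := Metric.mem_ball'.1 (hDx (hBD hz))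
        rw [← dist_eq_norm]
        have := dist_triangle_left z y x
        rw [dist_comm y x] at h1
        linarith)
    have hvol : volume D / volume (Metric.ball z₀ h) ≤ ENNReal.ofReal (Λ ^ (n + 1)) := by
      refine ENNReal.div_le_of_le_mul ?_
      refine (measure_mono hDx).trans (le_of_eq ?_)
      rw [Measure.addHaar_ball_of_pos _ _ (by positivity), Measure.addHaar_ball_of_pos _ _ hh,
        ← mul_assoc, ← ENNReal.ofReal_mul (by positivity), finrank_euclideanSpace_fin, mul_pow]
    have hP : 8 * (ENNReal.ofReal ((2 * Λ * h) ^ 2) * 2 ^ (n + 1) *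
        (1 + volume D / volume (Metric.ball z₀ h))) * (n + 1) ≤ ENNReal.ofReal (c * h ^ 2) := by
      calc _ ≤ 8 * (ENNReal.ofReal ((2 * Λ * h) ^ 2) * 2 ^ (n + 1) *
            (1 + ENNReal.ofReal (Λ ^ (n + 1)))) * (n + 1) := by gcongr
        _ = ENNReal.ofReal (c * h ^ 2) := by
          have e8 : (8 : ℝ≥0∞) = ENNReal.ofReal 8 := by simp
          have e2 : (2 : ℝ≥0∞) = ENNReal.ofReal 2 := by simp
          have e1 : (1 : ℝ≥0∞) = ENNReal.ofReal 1 := by simp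
          have en : ((n : ℝ≥0∞) + ENNReal.ofReal 1) = ENNReal.ofReal (n + 1) := by
            rw [ENNReal.ofReal_add (by positivity) (by norm_num)]; simp
          rw [e8, e2, e1, en, ← ENNReal.ofReal_pow (by norm_num), ← ENNReal.ofReal_add (by norm_num)
            (by positivity), ← ENNReal.ofReal_mul (by positivity),
            ← ENNReal.ofReal_mul (by positivity), ← ENNReal.ofReal_mul (by positivity),
            ← ENNReal.ofReal_mul (by positivity)]
          congr 1
          rw [hc]; ring
    have hF : sobolevSq Ω (k + 1) u D ≤
        ∑ j ∈ Finset.range (k + 2), sobolevSq Ω j u (Ω ∩ Metric.ball x (Λ * h)) :=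
      (sobolevSq_mono (subset_inter hDΩ hDx)).trans
        (Finset.single_le_sum (f := fun j => sobolevSq Ω j u (Ω ∩ Metric.ball x (Λ * h)))
          (fun _ _ => zero_le) (by simp))
    have hmain : ∀ (j : ℕ) (α : Fin (n + 1) → ℕ), ∑ i, α i + j = k + 1 → c ^ j ≤ C →
        sqInt (volume.restrict (Ω ∩ Metric.closedBall x h)) (weakDeriv Ω α u - multiDeriv α p) ≤
          ENNReal.ofReal (C * h ^ (2 * j)) *
            ∑ j ∈ Finset.range (k + 2), sobolevSq Ω j u (Ω ∩ Metric.ball x (Λ * h)) := by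
      intro j α hα hcC
      refine (sqInt_mono_measure (Measure.restrict_mono_set _ hVD) _).trans
        ((hest j α hα).trans ?_)
      gcongr ?_ * ?_
      refine (pow_le_pow_left' hP j).trans ?_
      rw [← ENNReal.ofReal_pow (by positivity), mul_pow, ← pow_mul]
      exact ENNReal.ofReal_le_ofReal (by gcongr)
    refine ⟨p, hp, ?_, fun i => ?_⟩
    · have h1 := hmain (k + 1) 0 (by simp) hC1
      rw [multiDeriv_zero, mul_add, mul_one] at h1
      refine le_trans (le_of_eq (sqInt_congr ?_)) h1
      exact (hu0.filter_mono (ae_mono (hV _))).mono fun y hy => by simp [hy]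
    · have h1 := hmain k (Pi.single i 1) (by simp; omega) hC2
      rwa [multiDeriv_single i hp.contDiff] at h1
  · have hbig : ∀ (α : Fin (n + 1) → ℕ) (m : ℕ), ∑ i, α i < k + 2 → (h₀ ^ m)⁻¹ ≤ C →
        sqInt (volume.restrict (Ω ∩ Metric.closedBall x h)) (weakDeriv Ω α u) ≤
          ENNReal.ofReal (C * h ^ m) *
            ∑ j ∈ Finset.range (k + 2), sobolevSq Ω j u (Ω ∩ Metric.ball x (Λ * h)) := by
      intro α m hα hCm
      -- At scales above `h₀` the prefactor is at least one, so the zero polynomial is good enough.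
      have h1 : (1 : ℝ≥0∞) ≤ ENNReal.ofReal (C * h ^ m) := by
        rw [ENNReal.one_le_ofReal]
        have : (h₀ ^ m)⁻¹ * h₀ ^ m = 1 := inv_mul_cancel₀ (by positivity)
        rw [← this]
        gcongr
      have hΛh : h < Λ * h := by nlinarith
      refine ((sqInt_mono_measure (Measure.restrict_mono_set _ (inter_subset_inter_right _
        (Metric.closedBall_subset_ball hΛh))) _).trans
        (sqInt_weakDeriv_le_sobolevSq hα)).trans ?_
      exact le_mul_of_one_le_left zero_le h1
    refine ⟨0, isPoly_zero k, ?_, fun i => ?_⟩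
    · rw [sub_zero]
      refine le_trans (le_of_eq (sqInt_congr ?_)) (hbig 0 (2 * k + 2) (by simp) hC3)
      exact (hu0.filter_mono (ae_mono (hV _))).symm
    · have h0 : pderiv i (0 : Pt (n + 1) → ℝ) = 0 := by
        funext y
        change fderiv ℝ (fun _ => (0 : ℝ)) y _ = 0
        simp
      rw [h0, sub_zero]
      exact hbig _ (2 * k) (by simp) hC4

/-- The inverse power `|x|^{1-d}` is integrable near the origin. -/
lemma lintegral_ball_inv_enorm_pow (n : ℕ) : ∃ c : ℝ≥0∞, c ≠ ⊤ ∧ ∀ (y : Pt (n + 1)) (r : ℝ), 0 < r →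
    ∫⁻ x in Metric.ball y r, (‖x - y‖ₑ ^ n)⁻¹ = ENNReal.ofReal r * c := by
  refine ⟨∫⁻ x in Metric.ball (0 : Pt (n + 1)) 1, (‖x‖ₑ ^ n)⁻¹, ?_, ?_⟩
  -- In polar coordinates the radial weight `y ^ n` cancels the singularity and leaves the constant
  -- one.
  · have h1 : IntegrableOn (fun x : Pt (n + 1) => (‖x‖ ^ n)⁻¹) (Metric.ball 0 1) := by
      rw [integrableOn_fun_norm_addHaar volume (f := fun y => (y ^ n)⁻¹)]
      refine IntegrableOn.congr_fun (f := fun _ => (1 : ℝ)) (by simp) ?_ measurableSet_Ioo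
      intro y hy
      have : y ^ n ≠ 0 := pow_ne_zero _ hy.1.ne'
      simp [this]
    refine ne_of_lt (lt_of_le_of_lt (le_of_eq ?_) h1.2)
    refine lintegral_congr_ae ?_
    have : ∀ᵐ x : Pt (n + 1) ∂(volume.restrict (Metric.ball 0 1)), x ≠ 0 :=
      ae_restrict_of_ae (by simp [ae_iff])
    filter_upwards [this] with x hx
    rw [enorm_inv (pow_ne_zero _ (norm_ne_zero_iff.2 hx)), enorm_pow, enorm_norm]
  · intro y r hr
    rw [← lintegral_indicator Metric.isOpen_ball.measurableSet,
      ← lintegral_indicator Metric.isOpen_ball.measurableSet,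
      ← lintegral_add_left_eq_self _ y, lintegral_comp_smul_of_pos volume hr,
      ← lintegral_const_mul' _ _ ENNReal.ofReal_ne_top,
      ← lintegral_const_mul' _ _ ENNReal.ofReal_ne_top]
    refine lintegral_congr fun x => ?_
    by_cases hx : x ∈ Metric.ball (0 : Pt (n + 1)) 1
    · have hx' : y + r • x ∈ Metric.ball y r := by
        rw [mem_ball_zero_iff] at hx
        rw [Metric.mem_ball, dist_eq_norm, add_sub_cancel_left, norm_smul, Real.norm_of_nonneg hr.le]
        nlinarith
      rw [indicator_of_mem hx, indicator_of_mem hx', add_sub_cancel_left, enorm_smul, mul_pow,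
        Real.enorm_eq_ofReal hr.le]
      have e0 : ENNReal.ofReal r ≠ 0 := by simpa using hr
      have e1 : ENNReal.ofReal r ^ n ≠ 0 := pow_ne_zero _ e0
      have e2 : ENNReal.ofReal r ^ n ≠ ⊤ := ENNReal.pow_ne_top ENNReal.ofReal_ne_top
      rw [ENNReal.mul_inv (Or.inl e1) (Or.inl e2), ← mul_assoc]
      congr 1
      rw [finrank_euclideanSpace_fin, ENNReal.ofReal_pow hr.le, pow_succ', mul_assoc,
        ENNReal.mul_inv_cancel e1 e2, mul_one]
    · have hx' : y + r • x ∉ Metric.ball y r := by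
        rw [mem_ball_zero_iff, not_lt] at hx
        rw [Metric.mem_ball, dist_eq_norm, add_sub_cancel_left, norm_smul,
          Real.norm_of_nonneg hr.le, not_lt]
        nlinarith
      rw [indicator_of_notMem hx, indicator_of_notMem hx', mul_zero, mul_zero]

/-- Sums over the elements of a mesh of integrals over neighbourhoods of the elements: a shape
regular family may overlap arbitrarily often, but not with weights `h_T`. -/
lemma exists_sum_lintegral_le (n : ℕ) {ρ R : ℝ} (hρ : 0 < ρ) (hR : 0 < R) :
    ∃ C : ℝ, 0 < C ∧ ∀ {ι : Type} (s : Finset ι) (V : ι → Set (Pt (n + 1))) (x : ι → Pt (n + 1))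
      (r : ι → ℝ) (h : ℝ), (∀ j ∈ s, MeasurableSet (V j)) →
      ((s : Set ι).Pairwise (Function.onFun (AEDisjoint volume) V)) →
      (∀ j ∈ s, 0 < r j ∧ r j ≤ h) → (∀ j ∈ s, V j ⊆ Metric.closedBall (x j) (r j)) →
      (∀ j ∈ s, ENNReal.ofReal (ρ * r j ^ (n + 1)) ≤ volume (V j)) →
      ∀ (Ω : Set (Pt (n + 1))) (F : Pt (n + 1) → ℝ≥0∞), AEMeasurable F (volume.restrict Ω) →
        ∑ j ∈ s, ENNReal.ofReal (r j) * ∫⁻ y in Ω ∩ Metric.ball (x j) (R * r j), F y ≤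
          ENNReal.ofReal (C * h) * ∫⁻ y in Ω, F y := by
  classical
  obtain ⟨c, hc, hball⟩ := lintegral_ball_inv_enorm_pow n
  refine ⟨ρ⁻¹ * (R + 1) ^ n * ((R + 2) * (c.toReal + 1)), by positivity, ?_⟩
  intro ι s V x r h hVm hVd hr hVx hvol Ω F hF
  -- Every `z` in `V j` is within `(R + 1) * r j` of `y`, and `V j` has volume at least `ρ * r j ^
  -- (n + 1)`; so the integral of `‖z - y‖ ^ (-n)` over `V j` is at least a multiple of `r j`.
  have hlocal : ∀ y : Pt (n + 1), ∀ j ∈ s, y ∈ Metric.ball (x j) (R * r j) →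
      ENNReal.ofReal (r j) ≤ ENNReal.ofReal (ρ⁻¹ * (R + 1) ^ n) *
        ∫⁻ z in V j, (‖z - y‖ₑ ^ n)⁻¹ := by
    intro y j hj hy
    obtain ⟨hr0, -⟩ := hr j hj
    have h1 : ENNReal.ofReal (ρ * r j ^ (n + 1)) * (ENNReal.ofReal (((R + 1) * r j) ^ n))⁻¹ ≤
        ∫⁻ z in V j, (‖z - y‖ₑ ^ n)⁻¹ := by
      calc _ ≤ volume (V j) * (ENNReal.ofReal (((R + 1) * r j) ^ n))⁻¹ := by
            gcongr; exact hvol j hj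
        _ = ∫⁻ z in V j, (ENNReal.ofReal (((R + 1) * r j) ^ n))⁻¹ := by
            rw [lintegral_const, Measure.restrict_apply_univ, mul_comm]
        _ ≤ _ := by
            refine setLIntegral_mono' (hVm j hj) fun z hz => ?_
            rw [ENNReal.ofReal_pow (by positivity), ENNReal.inv_le_inv]
            gcongr
            rw [← ofReal_norm]
            refine ENNReal.ofReal_le_ofReal ?_
            have h2 := Metric.mem_closedBall.1 (hVx j hj hz)
            have h3 := Metric.mem_ball'.1 hy
            rw [← dist_eq_norm]
            linarith [dist_triangle z (x j) y]
    calc ENNReal.ofReal (r j) = ENNReal.ofReal (ρ⁻¹ * (R + 1) ^ n) *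
          (ENNReal.ofReal (ρ * r j ^ (n + 1)) * (ENNReal.ofReal (((R + 1) * r j) ^ n))⁻¹) := by
          rw [← ENNReal.ofReal_inv_of_pos (by positivity), ← ENNReal.ofReal_mul (by positivity),
            ← ENNReal.ofReal_mul (by positivity)]
          congr 1
          rw [mul_pow, pow_succ]
          field_simp
      _ ≤ _ := by gcongr
  -- The `V j` concerned are disjoint and lie in one ball of radius `(R + 2) * h` about `y`, over
  -- which the kernel integrates to a multiple of `h`. Adding one to `c.toReal` only makes the
  -- constant positive.
  have hpt : ∀ y : Pt (n + 1), ∑ j ∈ s, ENNReal.ofReal (r j) *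
      (Metric.ball (x j) (R * r j)).indicator 1 y ≤
        ENNReal.ofReal (ρ⁻¹ * (R + 1) ^ n * ((R + 2) * (c.toReal + 1)) * h) := by
    intro y
    rcases s.eq_empty_or_nonempty with rfl | ⟨j₀, hj₀⟩
    · simp
    have hh : 0 < h := (hr j₀ hj₀).1.trans_le (hr j₀ hj₀).2
    set t := s.filter fun j => y ∈ Metric.ball (x j) (R * r j) with ht
    calc ∑ j ∈ s, ENNReal.ofReal (r j) * (Metric.ball (x j) (R * r j)).indicator 1 y
        = ∑ j ∈ t, ENNReal.ofReal (r j) := by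
          rw [ht, Finset.sum_filter]
          exact Finset.sum_congr rfl fun j _ => by simp [indicator_apply]
      _ ≤ ∑ j ∈ t, ENNReal.ofReal (ρ⁻¹ * (R + 1) ^ n) * ∫⁻ z in V j, (‖z - y‖ₑ ^ n)⁻¹ :=
          Finset.sum_le_sum fun j hj => hlocal y j (Finset.mem_filter.1 hj).1
            (Finset.mem_filter.1 hj).2
      _ = ENNReal.ofReal (ρ⁻¹ * (R + 1) ^ n) * ∫⁻ z in ⋃ j ∈ t, V j, (‖z - y‖ₑ ^ n)⁻¹ := by
          rw [← Finset.mul_sum, lintegral_biUnion_finset₀]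
          · exact hVd.mono (Finset.coe_subset.2 (Finset.filter_subset _ _))
          · exact fun j hj => (hVm j (Finset.mem_filter.1 hj).1).nullMeasurableSet
      _ ≤ ENNReal.ofReal (ρ⁻¹ * (R + 1) ^ n) *
          ∫⁻ z in Metric.ball y ((R + 2) * h), (‖z - y‖ₑ ^ n)⁻¹ := by
          gcongr
          refine iUnion₂_subset fun j hj z hz => ?_
          obtain ⟨hjs, hy⟩ := Finset.mem_filter.1 hj
          obtain ⟨hr0, hrh⟩ := hr j hjs
          have h2 := Metric.mem_closedBall.1 (hVx j hjs hz)
          have h3 := Metric.mem_ball'.1 hy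
          rw [Metric.mem_ball]
          have h4 : R * r j ≤ R * h := by gcongr
          linarith [dist_triangle z (x j) y]
      _ = ENNReal.ofReal (ρ⁻¹ * (R + 1) ^ n) * (ENNReal.ofReal ((R + 2) * h) * c) := by
          rw [hball y _ (by positivity)]
      _ ≤ _ := by
          rw [← ENNReal.ofReal_toReal hc, ← ENNReal.ofReal_mul (by positivity),
            ← ENNReal.ofReal_mul (by positivity)]
          refine ENNReal.ofReal_le_ofReal ?_
          rw [ENNReal.toReal_ofReal (by positivity)]
          have : ρ⁻¹ * (R + 1) ^ n * ((R + 2) * (c.toReal + 1)) * h =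
            ρ⁻¹ * (R + 1) ^ n * ((R + 2) * h * c.toReal) + ρ⁻¹ * (R + 1) ^ n * ((R + 2) * h) := by
            ring
          rw [this]
          exact le_add_of_nonneg_right (by positivity)
  have hmeas : ∀ j, MeasurableSet (Metric.ball (x j) (R * r j)) := fun j =>
    Metric.isOpen_ball.measurableSet
  calc ∑ j ∈ s, ENNReal.ofReal (r j) * ∫⁻ y in Ω ∩ Metric.ball (x j) (R * r j), F y
      = ∑ j ∈ s, ∫⁻ y in Ω, ENNReal.ofReal (r j) *
          (Metric.ball (x j) (R * r j)).indicator 1 y * F y := by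
        refine Finset.sum_congr rfl fun j _ => ?_
        simp_rw [mul_assoc]
        rw [lintegral_const_mul' _ _ ENNReal.ofReal_ne_top, inter_comm,
          ← Measure.restrict_restrict (hmeas j), ← lintegral_indicator (hmeas j)]
        congr 1
        refine lintegral_congr fun y => ?_
        by_cases hy : y ∈ Metric.ball (x j) (R * r j) <;> simp [hy]
    _ = ∫⁻ y in Ω, (∑ j ∈ s, ENNReal.ofReal (r j) *
          (Metric.ball (x j) (R * r j)).indicator 1 y) * F y := by
        rw [← lintegral_finsetSum']
        · simp_rw [Finset.sum_mul]
        · intro j _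
          exact ((((measurable_one.indicator (hmeas j)).const_mul _).aemeasurable).mul hF)
    _ ≤ ∫⁻ y in Ω, ENNReal.ofReal (ρ⁻¹ * (R + 1) ^ n * ((R + 2) * (c.toReal + 1)) * h) * F y :=
        lintegral_mono fun y => by gcongr; exact hpt y
    _ = _ := lintegral_const_mul' _ _ ENNReal.ofReal_ne_top

end Local

/-! ### Norms of polynomials and `L²` projections -/

section PolynomialNorms

variable {d : ℕ}

/-- The space of polynomial functions of degree at most `k`. -/
def polySpace (d k : ℕ) : Submodule ℝ (Pt d → ℝ) where
  carrier := {p | IsPoly k p}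
  add_mem' := fun hp hq => IsPoly.add hp hq
  zero_mem' := isPoly_zero k
  smul_mem' := fun a _ hp => IsPoly.const_mul hp a

lemma mem_polySpace {k : ℕ} {p : Pt d → ℝ} : p ∈ polySpace d k ↔ IsPoly k p := Iff.rfl

instance finite_polySpace (d k : ℕ) : Module.Finite ℝ (polySpace d k) := by
  let L : MvPolynomial (Fin d) ℝ →ₗ[ℝ] (Pt d → ℝ) :=
    { toFun := evalPt
      map_add' := evalPt_add
      map_smul' := fun a P => by funext x; simp [evalPt] }
  have : polySpace d k = (MvPolynomial.restrictTotalDegree (Fin d) ℝ k).map L := by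
    ext p
    simp only [mem_polySpace, isPoly_iff, Submodule.mem_map, MvPolynomial.mem_restrictTotalDegree]
    exact ⟨fun ⟨P, h1, h2⟩ => ⟨P, h1, h2.symm⟩, fun ⟨P, h1, h2⟩ => ⟨P, h1, h2.symm⟩⟩
  rw [this]
  infer_instance

/-- The restriction to a line is a one-variable polynomial whose value at zero is `evalPt P a`,
hence a nonzero polynomial. -/
lemma finite_zeros_on_line (P : MvPolynomial (Fin d) ℝ) (a v : Pt d) (ha : evalPt P a ≠ 0) :
    {t : ℝ | evalPt P (a + t • v) = 0}.Finite := by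
  let Q : Polynomial ℝ := MvPolynomial.aeval
    (fun i => Polynomial.C (a i) + Polynomial.C (v i) * Polynomial.X) P
  have hQ : ∀ t, Q.eval t = evalPt P (a + t • v) := by
    intro t
    have h1 : (Polynomial.evalRingHom t).comp (MvPolynomial.aeval (R := ℝ)
        (fun i => Polynomial.C (a i) + Polynomial.C (v i) * Polynomial.X)).toRingHom =
          MvPolynomial.eval (fun i => (a + t • v) i) := by
      refine MvPolynomial.ringHom_ext (fun r => ?_) (fun i => ?_)
      · change Polynomial.eval t (MvPolynomial.aeval _ (MvPolynomial.C r)) = _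
        rw [MvPolynomial.aeval_C, MvPolynomial.eval_C]
        exact Polynomial.eval_C
      · change Polynomial.eval t (MvPolynomial.aeval _ (MvPolynomial.X i)) = _
        rw [MvPolynomial.aeval_X, MvPolynomial.eval_X]
        simp only [Polynomial.eval_add, Polynomial.eval_mul, Polynomial.eval_C, Polynomial.eval_X,
          PiLp.add_apply, PiLp.smul_apply, smul_eq_mul]
        ring
    exact congrArg (fun f => f P) h1
  have hQ0 : Q ≠ 0 := by
    intro h
    have := hQ 0
    rw [h] at this
    simp at this
    exact ha this.symm
  refine (Q.roots.toFinset.finite_toSet).subset fun t ht => ?_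
  simp only [Finset.mem_coe, Multiset.mem_toFinset, Polynomial.mem_roots hQ0, Polynomial.IsRoot.def]
  rw [hQ]; exact ht

/-- The zero set of a nonzero polynomial is a null set. -/
lemma IsPoly.volume_zeros {k : ℕ} {p : Pt d → ℝ} (hp : IsPoly k p) (h0 : p ≠ 0) :
    volume {x | p x = 0} = 0 := by
  obtain ⟨P, -, rfl⟩ := isPoly_iff.1 hp
  obtain ⟨a, ha⟩ := Function.ne_iff.1 h0
  set Z : Set (Pt d) := {x | evalPt P (a + x) = 0} with hZ
  have hc : Continuous (evalPt P) := (contDiff_evalPt P).continuous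
  have hZm : MeasurableSet Z := (isClosed_eq (by fun_prop) continuous_const).measurableSet
  -- The origin is placed off the zero set `Z`. Each line through it meets `Z` finitely often, so by
  -- Tonelli almost every dilate of `Z` is null; one null dilate suffices, by scaling.
  have h1 : ∫⁻ t in Ioc (1 : ℝ) 2, ∫⁻ x : Pt d, Z.indicator 1 (t • x) = 0 := by
    rw [lintegral_lintegral_swap]
    · refine lintegral_eq_zero_of_ae_eq_zero (ae_of_all _ fun x => ?_)
      refine lintegral_eq_zero_of_ae_eq_zero ?_
      have h2 : volume {t : ℝ | evalPt P (a + t • x) = 0} = 0 :=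
        (finite_zeros_on_line P a x ha).measure_zero _
      refine ae_restrict_of_ae ?_
      filter_upwards [compl_mem_ae_iff.2 h2] with t ht
      exact indicator_of_notMem (s := Z) ht (1 : Pt d → ℝ≥0∞)
    · exact ((measurable_one.indicator hZm).comp
        (f := fun q : ℝ × Pt d => q.1 • q.2) (by fun_prop)).aemeasurable
  have hm : Measurable fun t : ℝ => ∫⁻ x : Pt d, Z.indicator (1 : Pt d → ℝ≥0∞) (t • x) :=
    Measurable.lintegral_prod_right (f := fun (t : ℝ) (x : Pt d) => Z.indicator (1 : Pt d → ℝ≥0∞) (t • x))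
      ((measurable_one.indicator hZm).comp (f := fun q : ℝ × Pt d => q.1 • q.2) (by fun_prop))
  rw [lintegral_eq_zero_iff hm] at h1
  have h3 : ∃ t ∈ Ioc (1 : ℝ) 2, ∫⁻ x : Pt d, Z.indicator (1 : Pt d → ℝ≥0∞) (t • x) = 0 := by
    have hne : (volume.restrict (Ioc (1 : ℝ) 2)) ≠ 0 := by simp
    have := (ae_restrict_mem (μ := volume) (measurableSet_Ioc (a := (1 : ℝ)) (b := 2))).and h1
    have hnb : (ae (volume.restrict (Ioc (1 : ℝ) 2))).NeBot := ae_neBot.2 hne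
    obtain ⟨t, ht1, ht2⟩ := this.exists
    exact ⟨t, ht1, ht2⟩
  obtain ⟨t, ht, ht0⟩ := h3
  have h4 := lintegral_comp_smul_of_pos (volume : Measure (Pt d)) (by linarith [ht.1] : 0 < t)
    (Z.indicator (1 : Pt d → ℝ≥0∞))
  rw [ht0, mul_zero, lintegral_indicator_one hZm] at h4
  have h5 : {x | evalPt P x = 0} = (fun x => -a + x) ⁻¹' Z := by
    ext x; simp [hZ]
  rw [h5, measure_preimage_add, h4]

/-- On sets of volume at least `ρ` in the unit ball, polynomials are controlled by their
`L²` norm. -/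
lemma exists_remez_unit (d k : ℕ) {ρ : ℝ} (hρ : 0 < ρ) : ∃ C : ℝ, 0 < C ∧
    ∀ q : Pt d → ℝ, IsPoly k q → ∀ E ⊆ Metric.closedBall (0 : Pt d) 1, MeasurableSet E →
      ENNReal.ofReal ρ ≤ volume E → ∀ x ∈ Metric.closedBall (0 : Pt d) 1,
        ‖q x‖ₑ ^ 2 ≤ ENNReal.ofReal C * sqInt (volume.restrict E) q := by
  obtain ⟨N, ⟨b⟩⟩ : ∃ N : ℕ, Nonempty (Module.Basis (Fin N) ℝ (polySpace d k)) :=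
    ⟨_, ⟨Module.finBasis ℝ (polySpace d k)⟩⟩
  set Q : (Fin N → ℝ) → Pt d → ℝ := fun c x => ∑ j, c j * (b j : Pt d → ℝ) x with hQ
  set B := Metric.closedBall (0 : Pt d) 1 with hB
  have hBc : IsCompact B := isCompact_closedBall _ _
  have hbp : ∀ j, IsPoly k (b j : Pt d → ℝ) := fun j => (b j).2
  have hQp : ∀ c, IsPoly k (Q c) := fun c => IsPoly.sum _ fun j _ => (hbp j).const_mul (c j)
  have hQr : ∀ q : Pt d → ℝ, IsPoly k q → ∃ c, Q c = q := by
    intro q hq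
    refine ⟨b.repr ⟨q, hq⟩, ?_⟩
    funext x
    have h := congrArg (Submodule.subtype _) (b.sum_repr ⟨q, hq⟩)
    rw [map_sum] at h
    have := congrFun h x
    simpa [hQ, -Module.Basis.sum_repr] using this
  have hQ0 : ∀ c, Q c = 0 → c = 0 := by
    intro c hc
    have h1 : ∑ j, c j • b j = 0 := by
      refine Subtype.ext ?_
      funext x
      simpa [hQ] using congrFun hc x
    funext j
    exact Fintype.linearIndependent_iff.1 b.linearIndependent c h1 j
  choose M hM using fun j => hBc.exists_bound_of_continuousOn (hbp j).continuous.continuousOn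
  set K : ℝ := ∑ j, |M j| + 1 with hK
  have hKpos : 0 < K := by positivity
  have hQK : ∀ c, ∀ x ∈ B, |Q c x| ≤ K * ‖c‖ := by
    intro c x hx
    calc |Q c x| ≤ ∑ j, |c j * (b j : Pt d → ℝ) x| := Finset.abs_sum_le_sum_abs _ _
      _ ≤ ∑ j, |M j| * ‖c‖ := by
          refine Finset.sum_le_sum fun j _ => ?_
          rw [abs_mul, mul_comm]
          exact mul_le_mul ((hM j x hx).trans (le_abs_self _)) (norm_le_pi_norm c j)
            (abs_nonneg _) (abs_nonneg _)
      _ ≤ K * ‖c‖ := by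
          rw [← Finset.sum_mul]
          gcongr
          linarith
  have hsub : ∀ c c' x, Q c x - Q c' x = Q (c - c') x := fun c c' x => by
    simp [hQ, sub_mul, Finset.sum_sub_distrib]
  have hsmul : ∀ (a : ℝ) c x, Q (a • c) x = a * Q c x := fun a c x => by
    simp [hQ, Finset.mul_sum, mul_assoc]
  -- A lower bound uniform in the set `E`, obtained by compactness of the unit sphere of
  -- coefficients. It suffices to find `δ` near each `c`; homogeneity then covers all polynomials.
  have hlow : ∃ δ : ℝ, 0 < δ ∧ ∀ c ∈ Metric.sphere (0 : Fin N → ℝ) 1, ∀ E ⊆ B, MeasurableSet E →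
      ENNReal.ofReal ρ ≤ volume E → ENNReal.ofReal δ ≤ sqInt (volume.restrict E) (Q c) := by
    refine IsCompact.induction_on (p := fun U => ∃ δ : ℝ, 0 < δ ∧ ∀ c ∈ U, ∀ E ⊆ B,
      MeasurableSet E → ENNReal.ofReal ρ ≤ volume E →
        ENNReal.ofReal δ ≤ sqInt (volume.restrict E) (Q c)) (isCompact_sphere _ _)
      ⟨1, one_pos, by simp⟩ ?_ ?_ ?_
    · rintro U V hUV ⟨δ, hδ, h⟩
      exact ⟨δ, hδ, fun c hc => h c (hUV hc)⟩
    · rintro U V ⟨δ, hδ, h⟩ ⟨δ', hδ', h'⟩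
      refine ⟨min δ δ', lt_min hδ hδ', ?_⟩
      rintro c (hc | hc) E h1 h2 h3
      · exact (ENNReal.ofReal_le_ofReal (min_le_left _ _)).trans (h c hc E h1 h2 h3)
      · exact (ENNReal.ofReal_le_ofReal (min_le_right _ _)).trans (h' c hc E h1 h2 h3)
    · intro c hc
      have hc0 : Q c ≠ 0 := fun h => by
        have := hQ0 c h
        rw [this] at hc
        simp at hc
      have hcont : Continuous (Q c) := (hQp c).continuous
      -- The sublevel sets shrink to the null zero set. For small `ε` such a set takes less than `ρ
      -- / 2` of the volume, so on at least half of the volume guaranteed to `E` the polynomial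
      -- exceeds `ε`, whatever the position of `E`.
      have hε : ∃ ε : ℝ, 0 < ε ∧ volume (B ∩ {x | |Q c x| ≤ ε}) < ENNReal.ofReal (ρ / 2) := by
        have hlim : Tendsto (fun m : ℕ => volume (B ∩ {x | |Q c x| ≤ 1 / ((m : ℝ) + 1)})) atTop
            (𝓝 (volume (⋂ m : ℕ, B ∩ {x | |Q c x| ≤ 1 / ((m : ℝ) + 1)}))) := by
          refine tendsto_measure_iInter_atTop (fun m => ?_) ?_ ⟨0, ?_⟩
          · exact (hBc.measurableSet.inter
              (isClosed_le hcont.abs continuous_const).measurableSet).nullMeasurableSet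
          · intro m m' hmm
            refine inter_subset_inter_right _ fun x hx => ?_
            exact le_trans (show |Q c x| ≤ 1 / ((m' : ℝ) + 1) from hx)
              (Nat.one_div_le_one_div hmm)
          · exact ne_top_of_le_ne_top hBc.measure_lt_top.ne (measure_mono inter_subset_left)
        have h0 : volume (⋂ m : ℕ, B ∩ {x | |Q c x| ≤ 1 / ((m : ℝ) + 1)}) = 0 := by
          refine measure_mono_null ?_ ((hQp c).volume_zeros hc0)
          intro x hx
          have h1 : ∀ m : ℕ, |Q c x| ≤ 1 / ((m : ℝ) + 1) := fun m => (mem_iInter.1 hx m).2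
          have h2 : |Q c x| ≤ 0 := ge_of_tendsto' tendsto_one_div_add_atTop_nhds_zero_nat h1
          exact abs_nonpos_iff.1 h2
        rw [h0] at hlim
        obtain ⟨m, hm⟩ := ((tendsto_order.1 hlim).2 (ENNReal.ofReal (ρ / 2))
          (by simpa using half_pos hρ)).exists
        exact ⟨1 / ((m : ℝ) + 1), by positivity, hm⟩
      obtain ⟨ε, hε, hvol⟩ := hε
      refine ⟨Metric.ball c (ε / (2 * K)), mem_nhdsWithin_of_mem_nhds
        (Metric.ball_mem_nhds c (by positivity)), (ε / 2) ^ 2 * (ρ / 2), by positivity, ?_⟩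
      intro c' hc' E hEB hEm hEv
      set A := B ∩ {x | |Q c x| ≤ ε} with hA
      have hAm : MeasurableSet A :=
        hBc.measurableSet.inter (isClosed_le hcont.abs continuous_const).measurableSet
      have hbig : ∀ x ∈ E \ A, ENNReal.ofReal ((ε / 2) ^ 2) ≤ ‖Q c' x‖ₑ ^ 2 := by
        rintro x ⟨hxE, hxA⟩
        have h1 : ε < |Q c x| := by
          by_contra hle
          exact hxA ⟨hEB hxE, not_lt.1 hle⟩
        have h2 : |Q c x - Q c' x| ≤ ε / 2 := by
          rw [hsub]
          refine (hQK _ x (hEB hxE)).trans ?_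
          have h3 : ‖c - c'‖ ≤ ε / (2 * K) := by
            rw [← dist_eq_norm]; exact (Metric.mem_ball'.1 hc').le
          calc K * ‖c - c'‖ ≤ K * (ε / (2 * K)) := by gcongr
            _ = ε / 2 := by field_simp
        have h4 : ε / 2 ≤ |Q c' x| := by
          have := abs_sub_abs_le_abs_sub (Q c x) (Q c' x)
          linarith
        rw [enorm_sq_eq_ofReal, ← sq_abs (Q c' x)]
        exact ENNReal.ofReal_le_ofReal (by gcongr)
      have hvd : ENNReal.ofReal (ρ / 2) ≤ volume (E \ A) := by
        have h1 : ENNReal.ofReal ρ ≤ volume (E \ A) + ENNReal.ofReal (ρ / 2) := by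
          refine hEv.trans ((measure_le_inter_add_sdiff volume E A).trans ?_)
          rw [add_comm]
          gcongr
          exact (measure_mono inter_subset_right).trans hvol.le
        have h2 : ENNReal.ofReal ρ = ENNReal.ofReal (ρ / 2) + ENNReal.ofReal (ρ / 2) := by
          rw [← ENNReal.ofReal_add (by positivity) (by positivity), add_halves]
        rw [h2] at h1
        exact (ENNReal.add_le_add_iff_right ENNReal.ofReal_ne_top).1 h1
      calc ENNReal.ofReal ((ε / 2) ^ 2 * (ρ / 2))
          = ENNReal.ofReal ((ε / 2) ^ 2) * ENNReal.ofReal (ρ / 2) :=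
            ENNReal.ofReal_mul (by positivity)
        _ ≤ ENNReal.ofReal ((ε / 2) ^ 2) * volume (E \ A) := by gcongr
        _ = ∫⁻ x in E \ A, ENNReal.ofReal ((ε / 2) ^ 2) := by
            rw [lintegral_const, Measure.restrict_apply_univ]
        _ ≤ ∫⁻ x in E \ A, ‖Q c' x‖ₑ ^ 2 := setLIntegral_mono' (hEm.diff hAm) hbig
        _ ≤ _ := sqInt_mono_measure (Measure.restrict_mono_set _ sdiff_subset) _
  obtain ⟨δ, hδ, hlow⟩ := hlow
  refine ⟨K ^ 2 / δ, by positivity, ?_⟩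
  intro q hq E hEB hEm hEv x hx
  obtain ⟨c, rfl⟩ := hQr q hq
  rcases eq_or_ne c 0 with rfl | hc
  · simp [hQ]
  have hcn : 0 < ‖c‖ := norm_pos_iff.2 hc
  have h1 := hlow (‖c‖⁻¹ • c) (by simp [norm_smul, hcn.ne']) E hEB hEm hEv
  have h2 : sqInt (volume.restrict E) (Q (‖c‖⁻¹ • c)) =
      ENNReal.ofReal ((‖c‖⁻¹) ^ 2) * sqInt (volume.restrict E) (Q c) := by
    simp only [sqInt]
    rw [← lintegral_const_mul' _ _ ENNReal.ofReal_ne_top]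
    refine lintegral_congr fun y => ?_
    rw [hsmul, enorm_mul, mul_pow, enorm_sq_eq_ofReal (‖c‖⁻¹)]
  rw [h2] at h1
  calc ‖Q c x‖ₑ ^ 2 ≤ ENNReal.ofReal ((K * ‖c‖) ^ 2) := by
        rw [enorm_sq_eq_ofReal, ← sq_abs]
        exact ENNReal.ofReal_le_ofReal (by gcongr; exact hQK c x hx)
    _ = ENNReal.ofReal (K ^ 2 / δ * ‖c‖ ^ 2) * ENNReal.ofReal δ := by
        rw [← ENNReal.ofReal_mul (by positivity)]
        congr 1
        field_simp
    _ ≤ ENNReal.ofReal (K ^ 2 / δ * ‖c‖ ^ 2) *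
        (ENNReal.ofReal ((‖c‖⁻¹) ^ 2) * sqInt (volume.restrict E) (Q c)) := by gcongr
    _ = _ := by
        rw [← mul_assoc, ← ENNReal.ofReal_mul (by positivity)]
        congr 2
        field_simp

/-- The scaled form of `exists_remez_unit`. -/
lemma exists_remez (d k : ℕ) {ρ : ℝ} (hρ : 0 < ρ) : ∃ C : ℝ, 0 < C ∧
    ∀ q : Pt d → ℝ, IsPoly k q → ∀ (a : Pt d) (h : ℝ), 0 < h → ∀ E ⊆ Metric.closedBall a h,
      MeasurableSet E → ENNReal.ofReal (ρ * h ^ d) ≤ volume E → ∀ x ∈ Metric.closedBall a h,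
        ENNReal.ofReal (h ^ d) * ‖q x‖ₑ ^ 2 ≤ ENNReal.ofReal C * sqInt (volume.restrict E) q := by
  obtain ⟨C, hC, hmain⟩ := exists_remez_unit d k hρ
  refine ⟨C, hC, ?_⟩
  intro q hq a h hh E hE hEm hEv x hx
  set E' : Set (Pt d) := (fun y => a + h • y) ⁻¹' E with hE'
  have hE'm : MeasurableSet E' := hEm.preimage (by fun_prop)
  have hscale : ∀ f : Pt d → ℝ≥0∞, ∫⁻ y in E, f y =
      ENNReal.ofReal (h ^ d) * ∫⁻ y in E', f (a + h • y) := by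
    intro f
    rw [← lintegral_indicator hEm, ← lintegral_indicator hE'm,
      ← lintegral_add_left_eq_self _ a, lintegral_comp_smul_of_pos volume hh,
      finrank_euclideanSpace_fin]
    rfl
  have hh0 : ENNReal.ofReal (h ^ d) ≠ 0 := by simpa using pow_pos hh d
  have hvE' : ENNReal.ofReal ρ ≤ volume E' := by
    have h1 := hscale 1
    simp only [Pi.one_apply, lintegral_const, Measure.restrict_apply_univ, one_mul] at h1
    rw [h1, mul_comm ρ, ENNReal.ofReal_mul (by positivity)] at hEv
    exact (ENNReal.mul_le_mul_iff_right hh0 ENNReal.ofReal_ne_top).1 hEv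
  have hsub : E' ⊆ Metric.closedBall 0 1 := by
    intro y hy
    have := Metric.mem_closedBall.1 (hE hy)
    rw [dist_eq_norm, add_sub_cancel_left, norm_smul, Real.norm_of_nonneg hh.le] at this
    rw [mem_closedBall_zero_iff]
    exact le_of_mul_le_mul_left (by simpa using this) hh
  have hx' : h⁻¹ • (x - a) ∈ Metric.closedBall (0 : Pt d) 1 := by
    rw [mem_closedBall_zero_iff, norm_smul, norm_inv, Real.norm_of_nonneg hh.le,
      inv_mul_le_iff₀ hh, mul_one, ← dist_eq_norm]
    exact Metric.mem_closedBall.1 hx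
  have h2 := hmain _ (hq.comp_affine a h) E' hsub hE'm hvE' _ hx'
  simp only [smul_inv_smul₀ hh.ne', add_sub_cancel] at h2
  calc ENNReal.ofReal (h ^ d) * ‖q x‖ₑ ^ 2 ≤ ENNReal.ofReal (h ^ d) * (ENNReal.ofReal C *
        sqInt (volume.restrict E') fun y => q (a + h • y)) := by gcongr
    _ = _ := by
        rw [mul_left_comm]
        congr 1
        exact (hscale fun y => ‖q y‖ₑ ^ 2).symm

/-- Polynomials represent the linear functionals that vanish on the polynomials that are zero
almost everywhere. -/
lemma exists_isPoly_represent {k : ℕ} {μ : Measure (Pt d)}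
    (hL2 : ∀ p : Pt d → ℝ, IsPoly k p → MemLp p 2 μ) (L : polySpace d k →ₗ[ℝ] ℝ)
    (hL : ∀ p : polySpace d k, (p : Pt d → ℝ) =ᵐ[μ] 0 → L p = 0) :
    ∃ q : Pt d → ℝ, IsPoly k q ∧ ∀ p : polySpace d k, ∫ x, q x * (p : Pt d → ℝ) x ∂μ = L p := by
  have hint : ∀ p q : polySpace d k,
      Integrable (fun x => (p : Pt d → ℝ) x * (q : Pt d → ℝ) x) μ := fun p q =>
    (hL2 p p.2).integrable_mul (hL2 q q.2)
  let B : polySpace d k →ₗ[ℝ] polySpace d k →ₗ[ℝ] ℝ := LinearMap.mk₂ ℝ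
    (fun p q => ∫ x, (p : Pt d → ℝ) x * (q : Pt d → ℝ) x ∂μ)
    (fun p p' q => by
      rw [← integral_add (hint p q) (hint p' q)]
      congr 1; funext x; simp [add_mul])
    (fun a p q => by
      rw [smul_eq_mul, ← integral_const_mul]
      congr 1; funext x; simp [mul_assoc])
    (fun p q q' => by
      rw [← integral_add (hint p q) (hint p q')]
      congr 1; funext x; simp [mul_add])
    (fun a p q => by
      rw [smul_eq_mul, ← integral_const_mul]
      congr 1; funext x; simp [mul_left_comm])
  -- The `L²` form may be degenerate, for instance on a face, where distinct polynomials agree. Its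
  -- kernel consists of the polynomials that vanish almost everywhere, and the range of the dual map
  -- is the annihilator of that kernel.
  have hmem : L ∈ LinearMap.range (LinearMap.dualMap B) := by
    rw [LinearMap.range_dualMap_eq_dualAnnihilator_ker, Submodule.mem_dualAnnihilator]
    intro p hp
    refine hL p ?_
    have h1 : ∫ x, (p : Pt d → ℝ) x * (p : Pt d → ℝ) x ∂μ = 0 :=
      congrArg (fun f => f p) (LinearMap.mem_ker.1 hp)
    rw [integral_eq_zero_iff_of_nonneg (fun x => mul_self_nonneg _) (hint p p)] at h1
    exact h1.mono fun x hx => by simpa using hx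
  obtain ⟨ξ, hξ⟩ := hmem
  obtain ⟨q, rfl⟩ := (Module.evalEquiv ℝ (polySpace d k)).surjective ξ
  refine ⟨q, q.2, fun p => ?_⟩
  rw [← hξ]
  change _ = ∫ x, (p : Pt d → ℝ) x * (q : Pt d → ℝ) x ∂μ
  simp_rw [mul_comm]

/-- Integration against `w` ignores null sets, so it is represented by a polynomial even where the
representative is not unique. Hence the default value in `l2Proj` is not taken. -/
lemma l2Proj_spec {k : ℕ} {μ : Measure (Pt d)} (hL2 : ∀ p : Pt d → ℝ, IsPoly k p → MemLp p 2 μ)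
    {w : Pt d → ℝ} (hw : MemLp w 2 μ) : IsPoly k (l2Proj μ k w) ∧
      ∀ p : Pt d → ℝ, IsPoly k p → ∫ x, l2Proj μ k w x * p x ∂μ = ∫ x, w x * p x ∂μ := by
  have hint : ∀ p : polySpace d k, Integrable (fun x => w x * (p : Pt d → ℝ) x) μ := fun p =>
    hw.integrable_mul (hL2 p p.2)
  let L : polySpace d k →ₗ[ℝ] ℝ :=
    { toFun := fun p => ∫ x, w x * (p : Pt d → ℝ) x ∂μ
      map_add' := fun p q => by
        rw [← integral_add (hint p) (hint q)]
        congr 1; funext x; simp [mul_add]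
      map_smul' := fun a p => by
        rw [RingHom.id_apply, smul_eq_mul, ← integral_const_mul]
        congr 1; funext x; simp [mul_left_comm] }
  have h : ∃ q : Pt d → ℝ, IsPoly k q ∧
      ∀ p : Pt d → ℝ, IsPoly k p → ∫ x, q x * p x ∂μ = ∫ x, w x * p x ∂μ := by
    obtain ⟨q, hq, hqL⟩ := exists_isPoly_represent hL2 L (fun p hp => by
      refine integral_eq_zero_of_ae ?_
      exact hp.mono fun x hx => by simp [hx])
    exact ⟨q, hq, fun p hp => hqL ⟨p, hp⟩⟩
  rw [l2Proj, dif_pos h]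
  exact h.choose_spec

/-- The `L²` projection is a contraction relative to any polynomial. -/
lemma sqInt_l2Proj_sub_le {k : ℕ} {μ : Measure (Pt d)}
    (hL2 : ∀ p : Pt d → ℝ, IsPoly k p → MemLp p 2 μ) {w p : Pt d → ℝ} (hw : MemLp w 2 μ)
    (hp : IsPoly k p) : sqInt μ (l2Proj μ k w - p) ≤ sqInt μ (w - p) := by
  obtain ⟨hq, hqw⟩ := l2Proj_spec hL2 hw
  set q := l2Proj μ k w with hqdef
  rw [← ofReal_integral_sq ((hL2 q hq).sub (hL2 p hp)), ← ofReal_integral_sq (hw.sub (hL2 p hp))]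
  refine ENNReal.ofReal_le_ofReal ?_
  have hqp := hq.sub hp
  have i1 : Integrable (fun x => (w - q) x ^ 2) μ := (hw.sub (hL2 q hq)).integrable_sq
  have i2 : Integrable (fun x => (q - p) x ^ 2) μ := ((hL2 q hq).sub (hL2 p hp)).integrable_sq
  have i3 : Integrable (fun x => w x * (q - p) x) μ := hw.integrable_mul (hL2 _ hqp)
  have i4 : Integrable (fun x => q x * (q - p) x) μ := (hL2 q hq).integrable_mul (hL2 _ hqp)
  -- Pythagoras: the cross term is the defect in testing with the polynomial `q - p`, and vanishes.
  have h1 : ∫ x, (w - p) x ^ 2 ∂μ = ∫ x, (w - q) x ^ 2 ∂μ + ∫ x, (q - p) x ^ 2 ∂μ +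
      2 * (∫ x, w x * (q - p) x ∂μ - ∫ x, q x * (q - p) x ∂μ) := by
    have i5 : Integrable (fun x => 2 * (w x * (q - p) x - q x * (q - p) x)) μ :=
      (i3.sub i4).const_mul 2
    have i6 : Integrable (fun x => (w - q) x ^ 2 + (q - p) x ^ 2) μ := i1.add i2
    rw [← integral_sub i3 i4, ← integral_const_mul, ← integral_add i1 i2, ← integral_add i6 i5]
    congr 1
    funext x
    simp only [Pi.sub_apply]
    ring
  rw [h1, hqw _ hqp, sub_self, mul_zero, add_zero]
  have : 0 ≤ ∫ x, (w - q) x ^ 2 ∂μ := integral_nonneg fun x => sq_nonneg _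
  linarith

end PolynomialNorms

/-! ### Elements and faces of a mesh -/

section Elements

variable {n : ℕ} {Ω : Set (Pt (n + 1))}

lemma IsPolytope.isCompact {d m : ℕ} {P : Set (Pt d)} (h : IsPolytope m P) : IsCompact P := by
  obtain ⟨S, -, -, rfl⟩ := h
  exact S.isCompact_biUnion fun s _ => (finite_range s).isCompact_convexHull ℝ

namespace Mesh

variable {M : Mesh Ω} {T e : Set (Pt (n + 1))}

lemma mem_facesOf : e ∈ M.facesOf T ↔ e ∈ M.faces ∧ e ⊆ frontier T := by
  simp [facesOf]

lemma isCompact_elem (hT : T ∈ M.elems) : IsCompact T := (M.elem_polytope T hT).isCompact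

lemma isCompact_face (he : e ∈ M.facesOf T) : IsCompact e :=
  (M.face_polytope e (mem_facesOf.1 he).1).isCompact

lemma face_subset_elem (hT : T ∈ M.elems) (he : e ∈ M.facesOf T) : e ⊆ T :=
  (mem_facesOf.1 he).2.trans (isCompact_elem hT).isClosed.frontier_subset

lemma elem_subset_closure (hT : T ∈ M.elems) : T ⊆ closure Ω := by
  rw [← M.elem_cover]
  exact subset_biUnion_of_mem (u := fun T => T) hT

lemma interior_elem_subset (hΩ : IsLipschitzDomain Ω) (hT : T ∈ M.elems) : interior T ⊆ Ω :=
  (interior_mono (elem_subset_closure hT)).trans hΩ.interior_closure_subset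

lemma frontier_elem_subset (hT : T ∈ M.elems) : frontier T ⊆ ⋃ e ∈ M.facesOf T, e := by
  intro x hx
  obtain ⟨e, he⟩ := mem_iUnion.1 (M.elem_frontier T hT hx)
  obtain ⟨he1, he⟩ := mem_iUnion.1 he
  obtain ⟨he2, he⟩ := mem_iUnion.1 he
  exact mem_iUnion₂.2 ⟨e, mem_facesOf.2 ⟨he1, he2⟩, he⟩

lemma volume_frontier_elem (hT : T ∈ M.elems) : volume (frontier T) = 0 := by
  refine measure_mono_null (frontier_elem_subset hT) ?_
  refine (measure_biUnion_null_iff (M.facesOf T).countable_toSet).2 fun e he => ?_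
  obtain ⟨h1, h2⟩ := mem_facesOf.1 (Finset.mem_coe.1 he)
  exact volume_flat_eq_zero (M.normal_norm T hT e h1 h2) (M.face_flat T hT e h1 h2)

/-- The boundary is covered by finitely many flat faces and hence is null. This reconciles integrals
over closed elements with data that are only controlled in their interiors. -/
lemma restrict_elem_eq (hT : T ∈ M.elems) :
    (volume : Measure (Pt (n + 1))).restrict T = volume.restrict (interior T) := by
  refine Measure.restrict_congr_set ?_
  refine (interior_ae_eq_of_null_frontier (volume_frontier_elem hT)).symm

lemma volume_interior_elem (hT : T ∈ M.elems) : volume (interior T) = volume T :=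
  measure_congr (interior_ae_eq_of_null_frontier (volume_frontier_elem hT))

lemma restrict_elem_le (hΩ : IsLipschitzDomain Ω) (hT : T ∈ M.elems) :
    (volume : Measure (Pt (n + 1))).restrict T ≤ volume.restrict Ω := by
  rw [restrict_elem_eq hT]
  exact Measure.restrict_mono_set _ (interior_elem_subset hΩ hT)

lemma elem_subset_closedBall (hT : T ∈ M.elems) {x : Pt (n + 1)} (hx : x ∈ T) :
    T ⊆ Metric.closedBall x (Metric.diam T) := fun _ hy =>
  Metric.dist_le_diam_of_mem (isCompact_elem hT).isBounded hy hx

lemma restrict_elem_le_inter (hΩ : IsLipschitzDomain Ω) (hT : T ∈ M.elems) {x : Pt (n + 1)}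
    (hx : x ∈ T) : (volume : Measure (Pt (n + 1))).restrict T ≤
      volume.restrict (Ω ∩ Metric.closedBall x (Metric.diam T)) := by
  rw [restrict_elem_eq hT]
  exact Measure.restrict_mono_set _ (subset_inter (interior_elem_subset hΩ hT)
    (interior_subset.trans (elem_subset_closedBall hT hx)))

lemma volume_elem_pos (hT : T ∈ M.elems) : 0 < volume T :=
  (isOpen_interior.measure_pos volume (M.elem_connected T hT).nonempty).trans_le
    (measure_mono interior_subset)

lemma diam_elem_pos (hT : T ∈ M.elems) : 0 < Metric.diam T := by
  refine lt_of_le_of_ne Metric.diam_nonneg fun h0 => ?_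
  obtain ⟨x, hx⟩ := (M.elem_connected T hT).nonempty
  have h1 := elem_subset_closedBall hT (interior_subset hx)
  rw [← h0, Metric.closedBall_zero] at h1
  have h2 := (volume_elem_pos hT).trans_le (measure_mono h1)
  simp at h2

lemma memLp_elem_of_continuous (hT : T ∈ M.elems) {f : Pt (n + 1) → ℝ} (hf : Continuous f) :
    MemLp f 2 (volume.restrict T) := by
  have hfin : IsFiniteMeasure (volume.restrict T) :=
    ⟨by simpa using (isCompact_elem hT).measure_lt_top⟩
  obtain ⟨C, hC⟩ := (isCompact_elem hT).exists_bound_of_continuousOn hf.continuousOn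
  refine MemLp.of_bound hf.aestronglyMeasurable C ?_
  filter_upwards [ae_restrict_mem (isCompact_elem hT).measurableSet] with x hx using hC x hx

namespace ShapeRegular

variable {K : ShapeConstants}

/-- The trace inequality on the elements of a shape regular mesh. -/
lemma trace_inequality (hM : M.ShapeRegular K) (hT : T ∈ M.elems) (he : e ∈ M.facesOf T)
    {φ : Pt (n + 1) → ℝ} (hφ : ContDiff ℝ ∞ φ) :
    ENNReal.ofReal (K.heightC * Metric.diam T) * sqInt ((surface (n + 1)).restrict e) φ ≤
      (n + 2 : ℕ) * sqInt (volume.restrict T) φ + ENNReal.ofReal (Metric.diam T ^ 2) *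
        ∑ i, sqInt (volume.restrict T) (pderiv i φ) := by
  obtain ⟨A, hA, hconv, hheight⟩ := hM.pyramid T hT e he
  obtain ⟨h1, h2⟩ := mem_facesOf.1 he
  obtain ⟨x₀, hx₀⟩ := (M.face_connected e h1).nonempty
  have hH := (hheight x₀ hx₀).1
  have hpos : 0 < K.heightC * Metric.diam T := mul_pos K.heightC_pos (diam_elem_pos hT)
  refine le_trans ?_ (WGLS.trace_inequality (M.normal_norm T hT e h1 h2)
    (isCompact_face he).measurableSet (isCompact_elem hT).measurableSet
    (H := ⟪x₀ - A, M.normal T e⟫_ℝ) (A := A) (hpos.trans_le hH) ?_ ?_ ?_ hφ)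
  · gcongr
  · intro x hx
    have h3 := M.face_flat T hT e h1 h2 x hx x₀ hx₀
    have h4 : x - A = (x - x₀) + (x₀ - A) := by abel
    rw [h4, inner_add_right, h3, zero_add, real_inner_comm]
  · intro x hx t ht
    refine hconv (mem_convexJoin.2 ⟨A, rfl, x, hx, ?_⟩)
    rw [segment_eq_image']
    exact ⟨t, ⟨ht.1.le, ht.2.le⟩, rfl⟩
  · intro x hx
    rw [← dist_eq_norm]
    exact Metric.dist_le_diam_of_mem (isCompact_elem hT).isBounded (face_subset_elem hT he hx) hA

/-- The trace inequality for the constant function one: a pyramid over the face fits into the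
element. -/
lemma surface_face_le (hM : M.ShapeRegular K) (hT : T ∈ M.elems) (he : e ∈ M.facesOf T) :
    ENNReal.ofReal (K.heightC * Metric.diam T) * surface (n + 1) e ≤ (n + 2 : ℕ) * volume T := by
  have h := hM.trace_inequality hT he (φ := fun _ => 1) contDiff_const
  have h0 : ∀ i : Fin (n + 1), pderiv i (fun _ : Pt (n + 1) => (1 : ℝ)) = 0 := fun i => by
    funext x; simp [pderiv]
  simpa [sqInt, h0] using h

/-- The volume of the element, which is finite, bounds the area of the base of the pyramid.
Finiteness makes continuous functions square integrable on faces. -/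
lemma surface_face_lt_top (hM : M.ShapeRegular K) (hT : T ∈ M.elems) (he : e ∈ M.facesOf T) :
    surface (n + 1) e < ⊤ := by
  have hpos : 0 < K.heightC * Metric.diam T := mul_pos K.heightC_pos (diam_elem_pos hT)
  by_contra hc
  have h := hM.surface_face_le hT he
  rw [not_lt, top_le_iff] at hc
  rw [hc, ENNReal.mul_top (by simpa using hpos), top_le_iff] at h
  exact ENNReal.mul_ne_top (ENNReal.natCast_ne_top _) (isCompact_elem hT).measure_lt_top.ne h

lemma memLp_face_of_continuous (hM : M.ShapeRegular K) (hT : T ∈ M.elems) (he : e ∈ M.facesOf T)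
    {f : Pt (n + 1) → ℝ} (hf : Continuous f) : MemLp f 2 ((surface (n + 1)).restrict e) := by
  have hfin : IsFiniteMeasure ((surface (n + 1)).restrict e) :=
    ⟨by simpa using hM.surface_face_lt_top hT he⟩
  obtain ⟨C, hC⟩ := (isCompact_face he).exists_bound_of_continuousOn hf.continuousOn
  refine MemLp.of_bound hf.aestronglyMeasurable C ?_
  filter_upwards [ae_restrict_mem (isCompact_face he).measurableSet] with x hx using hC x hx

end ShapeRegular

end Mesh

end Elements

/-! ### Traces on the faces -/

section Traces

variable {n : ℕ} {Ω : Set (Pt (n + 1))}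

/-- The smooth functions `φ m` converge to `u` in `H¹(Ω)`. -/
def TendstoSobolev {d : ℕ} (Ω : Set (Pt d)) (φ : ℕ → Pt d → ℝ) (u : Pt d → ℝ) : Prop :=
  (∀ m, ContDiff ℝ ∞ (φ m)) ∧
    Tendsto (fun m => sqInt (volume.restrict Ω) (φ m - u)) atTop (𝓝 0) ∧
    ∀ i, Tendsto (fun m => sqInt (volume.restrict Ω) (pderiv i (φ m) -
      weakDeriv Ω (Pi.single i 1) u)) atTop (𝓝 0)

lemma IsTrace.exists_tendsto {d : ℕ} {Ω e : Set (Pt d)} {u γ : Pt d → ℝ} (h : IsTrace Ω u e γ) :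
    ∃ φ, TendstoSobolev Ω φ u ∧
      Tendsto (fun m => sqInt ((surface d).restrict e) (φ m - γ)) atTop (𝓝 0) := by
  obtain ⟨-, φ, h1, h2, h3, h4⟩ := h
  exact ⟨φ, ⟨h1, tendsto_eLpNorm_two_iff.1 h2, fun i => tendsto_eLpNorm_two_iff.1 (h3 i)⟩,
    tendsto_eLpNorm_two_iff.1 h4⟩

lemma IsTrace.of_tendsto {d : ℕ} {Ω e : Set (Pt d)} {u γ : Pt d → ℝ}
    (hγ : MemLp γ 2 ((surface d).restrict e)) {φ : ℕ → Pt d → ℝ} (hφ : TendstoSobolev Ω φ u)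
    (h : Tendsto (fun m => sqInt ((surface d).restrict e) (φ m - γ)) atTop (𝓝 0)) :
    IsTrace Ω u e γ :=
  ⟨hγ, φ, hφ.1, tendsto_eLpNorm_two_iff.2 hφ.2.1, fun i => tendsto_eLpNorm_two_iff.2 (hφ.2.2 i),
    tendsto_eLpNorm_two_iff.2 h⟩

lemma MemSobolev.exists_tendstoSobolev (hΩ : IsLipschitzDomain Ω) {m : ℕ} {u : Pt (n + 1) → ℝ}
    (hu : MemSobolev Ω (m + 1) u) : ∃ φ, TendstoSobolev Ω φ u := by
  have h := fun i : Fin (n + 1) => hu.weakDeriv_spec (α := Pi.single i 1) (by simp)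
  exact hΩ.smoothApprox hu.1 (fun i => (h i).1) (fun i => (h i).2)

namespace Mesh.ShapeRegular

variable {M : Mesh Ω} {T e : Set (Pt (n + 1))} {K : ShapeConstants}

/-- Differences of two `H¹`-approximations of the same function tend to zero on faces. -/
lemma tendsto_sqInt_face_sub (hM : M.ShapeRegular K) (hΩ : IsLipschitzDomain Ω) (hT : T ∈ M.elems)
    (he : e ∈ M.facesOf T) {u : Pt (n + 1) → ℝ} {m : ℕ} (hu : MemSobolev Ω (m + 1) u)
    {φ ψ : ℕ → Pt (n + 1) → ℝ}
    (hφ : TendstoSobolev Ω φ u) (hψ : TendstoSobolev Ω ψ u) :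
    Tendsto (fun p : ℕ × ℕ => sqInt ((surface (n + 1)).restrict e) (φ p.1 - ψ p.2)) atTop
      (𝓝 0) := by
  set c : ℝ := K.heightC * Metric.diam T with hc
  have hpos : 0 < c := mul_pos K.heightC_pos (diam_elem_pos hT)
  have hc0 : ENNReal.ofReal c ≠ 0 := by simpa using hpos
  have hle := restrict_elem_le hΩ hT
  have hder := fun i : Fin (n + 1) => hu.weakDeriv_spec (α := Pi.single i 1) (by simp)
  have key : ∀ (f : ℕ → Pt (n + 1) → ℝ) (g : ℕ → Pt (n + 1) → ℝ) (w : Pt (n + 1) → ℝ),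
      (∀ m, Continuous (f m)) → AEMeasurable w (volume.restrict Ω) →
      Tendsto (fun m => sqInt (volume.restrict Ω) (f m - w)) atTop (𝓝 0) →
      Tendsto (fun m => sqInt (volume.restrict Ω) (g m - w)) atTop (𝓝 0) →
      Tendsto (fun p : ℕ × ℕ => sqInt (volume.restrict T) (f p.1 - g p.2)) atTop (𝓝 0) := by
    intro f g w hf hw h1 h2
    rw [← prod_atTop_atTop_eq]
    have h3 : Tendsto (fun p : ℕ × ℕ => 2 * sqInt (volume.restrict Ω) (f p.1 - w) +
        2 * sqInt (volume.restrict Ω) (g p.2 - w)) (atTop ×ˢ atTop) (𝓝 0) := by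
      simpa using (ENNReal.Tendsto.const_mul (h1.comp tendsto_fst)
        (Or.inr ENNReal.ofNat_ne_top)).add (ENNReal.Tendsto.const_mul (h2.comp tendsto_snd)
        (Or.inr ENNReal.ofNat_ne_top))
    refine tendsto_of_tendsto_of_tendsto_of_le_of_le tendsto_const_nhds h3 (fun _ => zero_le)
      fun p => ?_
    refine (sqInt_mono_measure hle _).trans ?_
    have h4 : f p.1 - g p.2 = (f p.1 - w) - (g p.2 - w) := by abel
    rw [h4]
    exact sqInt_sub_le ((hf p.1).aemeasurable.sub hw) _
  have h1 : Tendsto (fun p : ℕ × ℕ => (n + 2 : ℕ) * sqInt (volume.restrict T) (φ p.1 - ψ p.2) +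
      ENNReal.ofReal (Metric.diam T ^ 2) *
        ∑ i, sqInt (volume.restrict T) (pderiv i (φ p.1) - pderiv i (ψ p.2))) atTop (𝓝 0) := by
    have hA := key φ ψ u (fun m => (hφ.1 m).continuous) hu.1.aestronglyMeasurable.aemeasurable
      hφ.2.1 hψ.2.1
    have hB := tendsto_finsetSum Finset.univ fun i (_ : i ∈ Finset.univ) =>
      key (fun m => pderiv i (φ m)) (fun m => pderiv i (ψ m)) (weakDeriv Ω (Pi.single i 1) u)
        (fun m => (contDiff_pderiv (hφ.1 m)).continuous)
        (hder i).1.aestronglyMeasurable.aemeasurable (hφ.2.2 i) (hψ.2.2 i)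
    rw [Finset.sum_const_zero] at hB
    have hAB := (ENNReal.Tendsto.const_mul (a := ((n + 2 : ℕ) : ℝ≥0∞)) hA
      (Or.inr (ENNReal.natCast_ne_top _))).add (ENNReal.Tendsto.const_mul
        (a := ENNReal.ofReal (Metric.diam T ^ 2)) hB (Or.inr ENNReal.ofReal_ne_top))
    rw [mul_zero, mul_zero, add_zero] at hAB
    exact hAB
  have h2 := ENNReal.Tendsto.const_mul (a := (ENNReal.ofReal c)⁻¹) h1
    (Or.inr (ENNReal.inv_ne_top.2 hc0))
  rw [mul_zero] at h2
  refine tendsto_of_tendsto_of_tendsto_of_le_of_le tendsto_const_nhds h2 (fun _ => zero_le)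
    fun p => ?_
  have h3 := hM.trace_inequality hT he ((hφ.1 p.1).sub (hψ.1 p.2))
  have h4 : ∀ i, pderiv i (fun x => φ p.1 x - ψ p.2 x) = pderiv i (φ p.1) - pderiv i (ψ p.2) :=
    fun i => pderiv_sub ((hφ.1 p.1).differentiable (by simp))
      ((hψ.1 p.2).differentiable (by simp))
  simp only [h4] at h3
  calc sqInt ((surface (n + 1)).restrict e) (φ p.1 - ψ p.2) = (ENNReal.ofReal c)⁻¹ *
        (ENNReal.ofReal c * sqInt ((surface (n + 1)).restrict e) (φ p.1 - ψ p.2)) := by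
        rw [← mul_assoc, ENNReal.inv_mul_cancel hc0 ENNReal.ofReal_ne_top, one_mul]
    _ ≤ _ := by gcongr; exact h3

/-- By the trace inequality an `H¹` approximation is Cauchy in `L²(e)`, and its limit is a trace.
The zero default of `trace` is therefore not taken on mesh faces. -/
lemma isTrace_trace (hM : M.ShapeRegular K) (hΩ : IsLipschitzDomain Ω) (hT : T ∈ M.elems)
    (he : e ∈ M.facesOf T) {u : Pt (n + 1) → ℝ} {m : ℕ} (hu : MemSobolev Ω (m + 1) u) :
    IsTrace Ω u e (trace Ω u e) := by
  have hex : ∃ γ, IsTrace Ω u e γ := by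
    obtain ⟨φ, hφ⟩ := hu.exists_tendstoSobolev hΩ
    have hmem : ∀ j, MemLp (φ j) 2 ((surface (n + 1)).restrict e) := fun j =>
      hM.memLp_face_of_continuous hT he (hφ.1 j).continuous
    have hcau : CauchySeq fun j => (hmem j).toLp (φ j) := by
      rw [Lp.cauchySeq_Lp_iff_cauchySeq_eLpNorm]
      have h1 : Tendsto (fun p : ℕ × ℕ => eLpNorm (φ p.1 - φ p.2) 2
          ((surface (n + 1)).restrict e)) atTop (𝓝 0) := by
        have h2 := (hM.tendsto_sqInt_face_sub hΩ hT he hu hφ hφ).ennrpow_const (1 / 2 : ℝ)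
        simp only [sqInt_eq_eLpNorm_sq] at h2
        rw [ENNReal.zero_rpow_of_pos (by norm_num)] at h2
        refine h2.congr fun p => ?_
        rw [← ENNReal.rpow_natCast, ← ENNReal.rpow_mul]
        norm_num
      refine h1.congr fun p => eLpNorm_congr_ae ?_
      exact ((hmem p.1).coeFn_toLp.sub (hmem p.2).coeFn_toLp).symm
    obtain ⟨γ, hγ⟩ := cauchySeq_tendsto_of_complete hcau
    refine ⟨γ, IsTrace.of_tendsto (Lp.memLp γ) hφ ?_⟩
    rw [← tendsto_eLpNorm_two_iff]
    rw [Lp.tendsto_Lp_iff_tendsto_eLpNorm'] at hγ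
    refine hγ.congr fun j => eLpNorm_congr_ae ?_
    exact (hmem j).coeFn_toLp.sub (ae_eq_refl _)
  rw [trace, dif_pos hex]
  exact hex.choose_spec

/-- Any `H¹`-approximation converges to the trace on each face. -/
lemma tendsto_trace (hM : M.ShapeRegular K) (hΩ : IsLipschitzDomain Ω) (hT : T ∈ M.elems)
    (he : e ∈ M.facesOf T) {u : Pt (n + 1) → ℝ} {m : ℕ} (hu : MemSobolev Ω (m + 1) u)
    {φ : ℕ → Pt (n + 1) → ℝ} (hφ : TendstoSobolev Ω φ u) :
    Tendsto (fun j => sqInt ((surface (n + 1)).restrict e) (φ j - trace Ω u e)) atTop (𝓝 0) := by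
  obtain ⟨ψ, hψ, hψt⟩ := (hM.isTrace_trace hΩ hT he hu).exists_tendsto
  have h1 := (hM.tendsto_sqInt_face_sub hΩ hT he hu hφ hψ).comp
    ((tendsto_id.prodMk tendsto_id).mono_right (le_of_eq prod_atTop_atTop_eq))
  have h2 : Tendsto (fun j => 2 * sqInt ((surface (n + 1)).restrict e) (φ j - ψ j) +
      2 * sqInt ((surface (n + 1)).restrict e) (ψ j - trace Ω u e)) atTop (𝓝 0) := by
    simpa using (ENNReal.Tendsto.const_mul h1 (Or.inr ENNReal.ofNat_ne_top)).add
      (ENNReal.Tendsto.const_mul hψt (Or.inr ENNReal.ofNat_ne_top))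
  refine tendsto_of_tendsto_of_tendsto_of_le_of_le tendsto_const_nhds h2 (fun _ => zero_le)
    fun j => ?_
  have h3 : φ j - trace Ω u e = (φ j - ψ j) + (ψ j - trace Ω u e) := by abel
  conv_lhs => rw [h3]
  exact sqInt_add_le ((hφ.1 j).continuous.sub (hψ.1 j).continuous).aemeasurable _

/-- The trace inequality for Sobolev functions. -/
lemma sqInt_trace_sub_le (hM : M.ShapeRegular K) (hΩ : IsLipschitzDomain Ω) (hT : T ∈ M.elems)
    (he : e ∈ M.facesOf T) {u p : Pt (n + 1) → ℝ} {m : ℕ} (hu : MemSobolev Ω (m + 1) u)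
    (hp : ContDiff ℝ ∞ p) :
    ENNReal.ofReal (K.heightC * Metric.diam T) *
        sqInt ((surface (n + 1)).restrict e) (trace Ω u e - p) ≤
      4 * ((n + 2 : ℕ) * sqInt (volume.restrict T) (u - p) + ENNReal.ofReal (Metric.diam T ^ 2) *
        ∑ i, sqInt (volume.restrict T) (weakDeriv Ω (Pi.single i 1) u - pderiv i p)) := by
  obtain ⟨φ, hφ⟩ := hu.exists_tendstoSobolev hΩ
  have htr := hM.tendsto_trace hΩ hT he hu hφ
  have hγ := (hM.isTrace_trace hΩ hT he hu).1
  have hle := restrict_elem_le hΩ hT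
  set c := ENNReal.ofReal (K.heightC * Metric.diam T) with hc
  set γ := trace Ω u e
  set a : ℕ → ℝ≥0∞ := fun j => sqInt (volume.restrict Ω) (φ j - u)
  set b : ℕ → ℝ≥0∞ := fun j => ∑ i, sqInt (volume.restrict Ω) (pderiv i (φ j) -
      weakDeriv Ω (Pi.single i 1) u) with hb
  set A := sqInt (volume.restrict T) (u - p) with hA
  set B := ∑ i, sqInt (volume.restrict T) (weakDeriv Ω (Pi.single i 1) u - pderiv i p) with hB
  set h2 := ENNReal.ofReal (Metric.diam T ^ 2) with hh2
  have hb0 : Tendsto b atTop (𝓝 0) := by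
    simpa using tendsto_finsetSum Finset.univ fun i _ => hφ.2.2 i
  -- The smooth trace inequality is applied to the difference of the approximation and `p`; two
  -- further triangle inequalities yield the factor four in the limit.
  have hbound : ∀ j, c * sqInt ((surface (n + 1)).restrict e) (γ - p) ≤
      c * (2 * sqInt ((surface (n + 1)).restrict e) (φ j - γ)) +
        2 * ((n + 2 : ℕ) * (2 * a j + 2 * A) + h2 * (2 * b j + 2 * B)) := by
    intro j
    have h3 : sqInt ((surface (n + 1)).restrict e) (γ - p) ≤
        2 * sqInt ((surface (n + 1)).restrict e) (φ j - γ) +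
          2 * sqInt ((surface (n + 1)).restrict e) (φ j - p) := by
      have : γ - p = (γ - φ j) + (φ j - p) := by abel
      rw [this, sqInt_sub_comm (φ j) γ]
      exact sqInt_add_le (hγ.aestronglyMeasurable.aemeasurable.sub
        (hφ.1 j).continuous.aemeasurable) _
    have h4 := hM.trace_inequality hT he ((hφ.1 j).sub hp)
    have h7 : ∀ i, pderiv i (fun x => φ j x - p x) = pderiv i (φ j) - pderiv i p := fun i =>
      pderiv_sub ((hφ.1 j).differentiable (by simp)) (hp.differentiable (by simp))
    simp only [h7] at h4
    have key : ∀ f g w : Pt (n + 1) → ℝ, Continuous f → AEMeasurable w (volume.restrict Ω) →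
        sqInt (volume.restrict T) (f - g) ≤ 2 * sqInt (volume.restrict Ω) (f - w) +
          2 * sqInt (volume.restrict T) (w - g) := by
      intro f g w hf hw
      have : f - g = (f - w) + (w - g) := by abel
      rw [this]
      refine (sqInt_add_le (hf.aemeasurable.sub (hw.mono_measure hle)) _).trans ?_
      gcongr
      exact sqInt_mono_measure hle _
    have h5 : sqInt (volume.restrict T) (φ j - p) ≤ 2 * a j + 2 * A :=
      key _ _ _ (hφ.1 j).continuous hu.1.aestronglyMeasurable.aemeasurable
    have h6 : ∑ i, sqInt (volume.restrict T) (pderiv i (φ j) - pderiv i p) ≤ 2 * b j + 2 * B := by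
      rw [hb, hB, Finset.mul_sum, Finset.mul_sum, ← Finset.sum_add_distrib]
      exact Finset.sum_le_sum fun i _ => key _ _ _ (contDiff_pderiv (hφ.1 j)).continuous
        (hu.weakDeriv_spec (α := Pi.single i 1) (by simp)).1.aestronglyMeasurable.aemeasurable
    calc c * sqInt ((surface (n + 1)).restrict e) (γ - p) ≤ c * (_ + _) := by gcongr
      _ = c * (2 * sqInt ((surface (n + 1)).restrict e) (φ j - γ)) +
          2 * (c * sqInt ((surface (n + 1)).restrict e) (φ j - p)) := by ring
      _ ≤ _ := by
        gcongr
        exact h4.trans (add_le_add (mul_le_mul_right h5 _) (mul_le_mul_right h6 _))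
  have hlim : Tendsto (fun j => c * (2 * sqInt ((surface (n + 1)).restrict e) (φ j - γ)) +
        2 * ((n + 2 : ℕ) * (2 * a j + 2 * A) + h2 * (2 * b j + 2 * B))) atTop
      (𝓝 (c * (2 * 0) + 2 * ((n + 2 : ℕ) * (2 * 0 + 2 * A) + h2 * (2 * 0 + 2 * B)))) := by
    have tc : ∀ {f : ℕ → ℝ≥0∞} {l c : ℝ≥0∞}, c ≠ ⊤ → Tendsto f atTop (𝓝 l) →
        Tendsto (fun m => c * f m) atTop (𝓝 (c * l)) := fun hc h =>
      ENNReal.Tendsto.const_mul h (Or.inr hc)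
    have t2 : (2 : ℝ≥0∞) ≠ ⊤ := ENNReal.ofNat_ne_top
    exact (tc ENNReal.ofReal_ne_top (tc t2 htr)).add (tc t2
      ((tc (ENNReal.natCast_ne_top _) ((tc t2 hφ.2.1).add_const _)).add
        (tc ENNReal.ofReal_ne_top ((tc t2 hb0).add_const _))))
  refine (ge_of_tendsto' hlim hbound).trans (le_of_eq ?_)
  simp only [mul_zero, zero_add]
  ring

lemma _root_.WGLS.tendsto_integral_mul {X : Type*} [MeasurableSpace X] {μ : Measure X}
    {f : ℕ → X → ℝ} {w p : X → ℝ} (hf : ∀ j, MemLp (f j) 2 μ) (hw : MemLp w 2 μ)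
    (hp : MemLp p 2 μ) (h : Tendsto (fun j => sqInt μ (f j - w)) atTop (𝓝 0)) :
    Tendsto (fun j => ∫ x, f j x * p x ∂μ) atTop (𝓝 (∫ x, w x * p x ∂μ)) := by
  refine tendsto_integral_of_L1 _ (hw.integrable_mul hp).aestronglyMeasurable
    (Eventually.of_forall fun j => (hf j).integrable_mul hp) ?_
  have h1 := ENNReal.Tendsto.mul_const (tendsto_eLpNorm_two_iff.2 h) (Or.inr hp.2.ne)
  rw [zero_mul] at h1
  refine tendsto_of_tendsto_of_tendsto_of_le_of_le tendsto_const_nhds h1 (fun _ => zero_le)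
    fun j => ?_
  have h2 := eLpNorm_smul_le_mul_eLpNorm (p := 2) (q := 2) (r := 1) hp.1
    ((hf j).sub hw).1
  rw [eLpNorm_one_eq_lintegral_enorm] at h2
  refine le_trans (le_of_eq (lintegral_congr fun x => ?_)) h2
  simp [sub_mul]

/-- Integration by parts on an element, for Sobolev functions. -/
lemma integral_weakDeriv_mul (hM : M.ShapeRegular K) (hΩ : IsLipschitzDomain Ω) (hT : T ∈ M.elems)
    {u p : Pt (n + 1) → ℝ} {m : ℕ} (hu : MemSobolev Ω (m + 1) u) (hp : ContDiff ℝ ∞ p)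
    (i : Fin (n + 1)) :
    ∫ x in T, weakDeriv Ω (Pi.single i 1) u x * p x = -(∫ x in T, u x * pderiv i p x) +
      ∑ e ∈ M.facesOf T, M.normal T e i * ∫ x in e, trace Ω u e x * p x ∂(surface (n + 1)) := by
  obtain ⟨φ, hφ⟩ := hu.exists_tendstoSobolev hΩ
  have hle := restrict_elem_le hΩ hT
  have hsm : ∀ {w : ℕ → Pt (n + 1) → ℝ},
      Tendsto (fun j => sqInt (volume.restrict Ω) (w j)) atTop (𝓝 0) →
      Tendsto (fun j => sqInt (volume.restrict T) (w j)) atTop (𝓝 0) := fun h =>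
    tendsto_of_tendsto_of_tendsto_of_le_of_le tendsto_const_nhds h (fun _ => zero_le)
      fun j => sqInt_mono_measure hle _
  have hpc := hp.continuous
  have hpc' : Continuous (pderiv i p) := (contDiff_pderiv hp).continuous
  have hφc' : ∀ j, Continuous (pderiv i (φ j)) := fun j => (contDiff_pderiv (hφ.1 j)).continuous
  have hd := (hu.weakDeriv_spec (α := Pi.single i 1) (by simp)).1
  have L1 := tendsto_integral_mul (μ := volume.restrict T)
    (fun j => memLp_elem_of_continuous hT (hφc' j)) (hd.mono_measure hle)
    (memLp_elem_of_continuous hT hpc) (hsm (hφ.2.2 i))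
  have L2 := tendsto_integral_mul (μ := volume.restrict T)
    (fun j => memLp_elem_of_continuous hT (hφ.1 j).continuous) (hu.1.mono_measure hle)
    (memLp_elem_of_continuous hT hpc') (hsm hφ.2.1)
  have L3 : Tendsto (fun j => ∑ e ∈ M.facesOf T, M.normal T e i *
      ∫ x in e, φ j x * p x ∂(surface (n + 1))) atTop (𝓝 (∑ e ∈ M.facesOf T, M.normal T e i *
        ∫ x in e, trace Ω u e x * p x ∂(surface (n + 1)))) := by
    refine tendsto_finsetSum _ fun e he => Tendsto.const_mul _ ?_
    exact tendsto_integral_mul (fun j => hM.memLp_face_of_continuous hT he (hφ.1 j).continuous)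
      (hM.isTrace_trace hΩ hT he hu).1 (hM.memLp_face_of_continuous hT he hpc)
      (hM.tendsto_trace hΩ hT he hu hφ)
  -- For each approximant the identity is the divergence theorem for the product with `p`; both
  -- sides converge.
  refine tendsto_nhds_unique L1 ((L2.neg.add L3).congr fun j => ?_)
  have hdiv := setIntegral_pderiv_eq_sum_faces (isCompact_elem hT) (M.facesOf T) (M.normal T)
    (fun e he => M.normal_norm T hT e (mem_facesOf.1 he).1 (mem_facesOf.1 he).2)
    (fun e he => isCompact_face he)
    (fun e he => M.face_flat T hT e (mem_facesOf.1 he).1 (mem_facesOf.1 he).2)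
    (frontier_elem_subset hT)
    (fun e he e' he' => M.face_overlap e (mem_facesOf.1 he).1 e' (mem_facesOf.1 he').1)
    (fun e he => hM.surface_face_lt_top hT he)
    (fun e he => M.normal_outward T hT e (mem_facesOf.1 he).1 (mem_facesOf.1 he).2) i
    ((hφ.1 j).mul hp)
  have h5 : pderiv i (fun x => φ j x * p x) = fun x => pderiv i (φ j) x * p x +
      φ j x * pderiv i p x :=
    pderiv_mul ((hφ.1 j).differentiable (by simp)) (hp.differentiable (by simp))
  rw [h5, integral_add] at hdiv
  · rw [← hdiv]; ring
  · exact (memLp_elem_of_continuous hT (hφc' j)).integrable_mul (memLp_elem_of_continuous hT hpc)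
  · exact (memLp_elem_of_continuous hT (hφ.1 j).continuous).integrable_mul
      (memLp_elem_of_continuous hT hpc')

end Mesh.ShapeRegular

end Traces

/-! ### The stabilizer of the projection -/

section Stabilizer

variable {n : ℕ} {Ω : Set (Pt (n + 1))}

namespace Mesh

variable {M : Mesh Ω} {T e : Set (Pt (n + 1))} {K : ShapeConstants}

lemma isPoly_Qh_v0 (hΩ : IsLipschitzDomain Ω) {m k : ℕ} {u : Pt (n + 1) → ℝ}
    (hu : MemSobolev Ω (m + 1) u) (hT : T ∈ M.elems) : IsPoly k ((M.Qh k u).v0 T) ∧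
      ∀ p : Pt (n + 1) → ℝ, IsPoly k p →
        ∫ x in T, (M.Qh k u).v0 T x * p x = ∫ x in T, u x * p x :=
  l2Proj_spec (fun _ hp => memLp_elem_of_continuous hT hp.continuous)
    (hu.1.mono_measure (restrict_elem_le hΩ hT))

lemma ShapeRegular.isPoly_Qh_vb (hM : M.ShapeRegular K) (hΩ : IsLipschitzDomain Ω) {m k : ℕ}
    {u : Pt (n + 1) → ℝ} (hu : MemSobolev Ω (m + 1) u) (hT : T ∈ M.elems)
    (he : e ∈ M.facesOf T) : IsPoly k ((M.Qh k u).vb e) ∧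
      ∀ p : Pt (n + 1) → ℝ, IsPoly k p → ∫ x in e, (M.Qh k u).vb e x * p x ∂(surface (n + 1)) =
        ∫ x in e, trace Ω u e x * p x ∂(surface (n + 1)) :=
  l2Proj_spec (fun _ hp => hM.memLp_face_of_continuous hT he hp.continuous)
    (hM.isTrace_trace hΩ hT he hu).1

/-- The local bound for the jump `Q₀u - Q_b u` on a face. -/
lemma exists_local_stabilizer_le (hΩ : IsLipschitzDomain Ω) (k : ℕ) (K : ShapeConstants) :
    ∃ C R : ℝ, 0 < C ∧ 1 ≤ R ∧ ∀ M : Mesh Ω, M.ShapeRegular K → ∀ u : Pt (n + 1) → ℝ,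
      MemSobolev Ω (k + 1) u → ∀ T ∈ M.elems, ∀ x ∈ T, ∀ e ∈ M.facesOf T,
        ENNReal.ofReal (Metric.diam T)⁻¹ * sqInt ((surface (n + 1)).restrict e)
          ((M.Qh k u).v0 T - (M.Qh k u).vb e) ≤ ENNReal.ofReal (C * Metric.diam T ^ (2 * k)) *
            ∑ j ∈ Finset.range (k + 2), sobolevSq Ω j u
              (Ω ∩ Metric.ball x (R * Metric.diam T)) := by
  obtain ⟨c₁, R, hc₁, hR, happ⟩ := hΩ.exists_local_approx k
  obtain ⟨c₂, hc₂, hrem⟩ := exists_remez (n + 1) k K.volC_pos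
  set v₁ : ℝ := volume.real (Metric.ball (0 : Pt (n + 1)) 1) with hv₁
  -- Twice the two bounds below. The first has the factor `4 * ((n + 2) + (n + 1))`, from the
  -- function and the `n + 1` derivatives in the trace inequality.
  set C₂ : ℝ := 8 * (2 * n + 3) * c₁ + 2 * ((n + 2) * v₁ * c₂ * c₁) with hC₂
  have hσ := K.heightC_pos
  have hv₁0 : 0 ≤ v₁ := measureReal_nonneg
  refine ⟨C₂ / K.heightC, R, by positivity, hR, ?_⟩
  intro M hM u hu T hT x hx e he
  set H := Metric.diam T with hHdef
  have hH : 0 < H := diam_elem_pos hT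
  obtain ⟨p, hp, hup, hdup⟩ := happ u hu x (elem_subset_closure hT hx) H hH
  set Φ := ∑ j ∈ Finset.range (k + 2), sobolevSq Ω j u (Ω ∩ Metric.ball x (R * H)) with hΦ
  have hle := restrict_elem_le_inter hΩ hT hx
  have hup' : sqInt (volume.restrict T) (u - p) ≤ ENNReal.ofReal (c₁ * H ^ (2 * k + 2)) * Φ :=
    (sqInt_mono_measure hle _).trans hup
  set q₀ := (M.Qh k u).v0 T with hq₀
  set q := (M.Qh k u).vb e with hq
  set γ := trace Ω u e with hγ
  set μ := (surface (n + 1)).restrict e with hμ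
  have hq₀p : IsPoly k q₀ := (isPoly_Qh_v0 hΩ hu hT).1
  have hγL : MemLp γ 2 μ := (hM.isTrace_trace hΩ hT he hu).1
  -- The polynomial `Q₀u` competes with the best approximation of the trace on the face, so the jump
  -- is bounded by the distance of the trace from `Q₀u`.
  have hjump : sqInt μ (q₀ - q) ≤ 2 * sqInt μ (γ - p) + 2 * sqInt μ (p - q₀) := by
    rw [sqInt_sub_comm]
    refine (sqInt_l2Proj_sub_le (fun _ hp => hM.memLp_face_of_continuous hT he hp.continuous)
      hγL hq₀p).trans ?_
    have : γ - q₀ = (γ - p) + (p - q₀) := by abel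
    rw [this]
    exact sqInt_add_le (hγL.aestronglyMeasurable.aemeasurable.sub hp.continuous.aemeasurable) _
  have h1 : ENNReal.ofReal (K.heightC * H) * sqInt μ (γ - p) ≤
      ENNReal.ofReal (4 * (2 * n + 3) * c₁ * H ^ (2 * k + 2)) * Φ := by
    refine (hM.sqInt_trace_sub_le hΩ hT he hu hp.contDiff).trans ?_
    calc _ ≤ 4 * (((n + 2 : ℕ) : ℝ≥0∞) * (ENNReal.ofReal (c₁ * H ^ (2 * k + 2)) * Φ) +
          ENNReal.ofReal (H ^ 2) * ∑ _i : Fin (n + 1),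
            (ENNReal.ofReal (c₁ * H ^ (2 * k)) * Φ)) := by
          refine mul_le_mul_right (add_le_add (mul_le_mul_right hup' _) (mul_le_mul_right ?_ _)) _
          exact Finset.sum_le_sum fun i _ => (sqInt_mono_measure hle _).trans (hdup i)
      _ = _ := by
          rw [Finset.sum_const, Finset.card_univ, Fintype.card_fin, nsmul_eq_mul]
          rw [show ((n + 2 : ℕ) : ℝ≥0∞) = ENNReal.ofReal (n + 2 : ℕ) from
              (ENNReal.ofReal_natCast _).symm,
            show ((n + 1 : ℕ) : ℝ≥0∞) = ENNReal.ofReal (n + 1 : ℕ) from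
              (ENNReal.ofReal_natCast _).symm,
            show (4 : ℝ≥0∞) = ENNReal.ofReal 4 by simp]
          simp only [← mul_assoc]
          rw [← ENNReal.ofReal_mul (by positivity), ← ENNReal.ofReal_mul (by positivity),
            ← ENNReal.ofReal_mul (by positivity), ← add_mul,
            ← ENNReal.ofReal_add (by positivity) (by positivity), ← mul_assoc,
            ← ENNReal.ofReal_mul (by positivity)]
          congr 2
          push_cast
          ring
  -- A polynomial on an element of volume at least `volC * H ^ d` is bounded pointwise by its
  -- `L²(T)` norm, which here is at most that of `u - p`. The face area is then compared with the
  -- volume of `T`.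
  have h2 : ENNReal.ofReal (K.heightC * H) * sqInt μ (p - q₀) ≤
      ENNReal.ofReal ((n + 2) * v₁ * c₂ * c₁ * H ^ (2 * k + 2)) * Φ := by
    have hHn : ENNReal.ofReal (H ^ (n + 1)) ≠ 0 := by simpa using pow_pos hH (n + 1)
    have hvolT : volume T ≤ ENNReal.ofReal (H ^ (n + 1) * v₁) := by
      refine (measure_mono (elem_subset_closedBall hT hx)).trans (le_of_eq ?_)
      rw [Measure.addHaar_closedBall _ _ hH.le, finrank_euclideanSpace_fin,
        ENNReal.ofReal_mul (by positivity), hv₁, ofReal_measureReal measure_ball_lt_top.ne]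
    have hpt : ∀ y ∈ e, ENNReal.ofReal (H ^ (n + 1)) * ‖(p - q₀) y‖ₑ ^ 2 ≤
        ENNReal.ofReal (c₂ * c₁ * H ^ (2 * k + 2)) * Φ := by
      intro y hy
      have h3 := hrem (p - q₀) (hp.sub hq₀p) x H hH T (elem_subset_closedBall hT hx)
        (isCompact_elem hT).measurableSet (ENNReal.ofReal_le_of_le_toReal (hM.vol_elem T hT)) y
        (elem_subset_closedBall hT hx (face_subset_elem hT he hy))
      refine h3.trans ?_
      rw [mul_assoc, ENNReal.ofReal_mul hc₂.le, mul_assoc]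
      refine mul_le_mul_right (le_trans ?_ hup') _
      rw [sqInt_sub_comm]
      exact sqInt_l2Proj_sub_le (fun _ hp => memLp_elem_of_continuous hT hp.continuous)
        (hu.1.mono_measure (restrict_elem_le hΩ hT)) hp
    refine (ENNReal.mul_le_mul_iff_right hHn ENNReal.ofReal_ne_top).1 ?_
    calc ENNReal.ofReal (H ^ (n + 1)) * (ENNReal.ofReal (K.heightC * H) * sqInt μ (p - q₀))
        = ENNReal.ofReal (K.heightC * H) *
          ∫⁻ y in e, ENNReal.ofReal (H ^ (n + 1)) * ‖(p - q₀) y‖ₑ ^ 2 ∂(surface (n + 1)) := by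
          rw [lintegral_const_mul' _ _ ENNReal.ofReal_ne_top, mul_left_comm]
          rfl
      _ ≤ ENNReal.ofReal (K.heightC * H) *
          ∫⁻ y in e, ENNReal.ofReal (c₂ * c₁ * H ^ (2 * k + 2)) * Φ ∂(surface (n + 1)) :=
          mul_le_mul_right (setLIntegral_mono' (isCompact_face he).measurableSet hpt) _
      _ = ENNReal.ofReal (c₂ * c₁ * H ^ (2 * k + 2)) * Φ *
          (ENNReal.ofReal (K.heightC * H) * surface (n + 1) e) := by
          rw [lintegral_const, Measure.restrict_apply_univ]; ring
      _ ≤ ENNReal.ofReal (c₂ * c₁ * H ^ (2 * k + 2)) * Φ *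
          ((n + 2 : ℕ) * ENNReal.ofReal (H ^ (n + 1) * v₁)) :=
          mul_le_mul_right ((hM.surface_face_le hT he).trans (mul_le_mul_right hvolT _)) _
      _ = ENNReal.ofReal (c₂ * c₁ * H ^ (2 * k + 2)) *
          (ENNReal.ofReal (n + 2 : ℕ) * ENNReal.ofReal (H ^ (n + 1) * v₁)) * Φ := by
          rw [ENNReal.ofReal_natCast]; ring
      _ = _ := by
          rw [← ENNReal.ofReal_mul (by positivity), ← ENNReal.ofReal_mul (by positivity),
            ← mul_assoc (ENNReal.ofReal (H ^ (n + 1))), ← ENNReal.ofReal_mul (by positivity)]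
          congr 2
          push_cast
          ring
  have h3 : ENNReal.ofReal (K.heightC * H) * sqInt μ (q₀ - q) ≤
      ENNReal.ofReal (C₂ * H ^ (2 * k + 2)) * Φ := by
    calc _ ≤ ENNReal.ofReal (K.heightC * H) * (2 * sqInt μ (γ - p) + 2 * sqInt μ (p - q₀)) :=
          mul_le_mul_right hjump _
      _ = 2 * (ENNReal.ofReal (K.heightC * H) * sqInt μ (γ - p)) +
          2 * (ENNReal.ofReal (K.heightC * H) * sqInt μ (p - q₀)) := by ring
      _ ≤ _ := add_le_add (mul_le_mul_right h1 _) (mul_le_mul_right h2 _)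
      _ = _ := by
          rw [show (2 : ℝ≥0∞) = ENNReal.ofReal 2 by simp, ← mul_assoc, ← mul_assoc,
            ← ENNReal.ofReal_mul (by positivity), ← ENNReal.ofReal_mul (by positivity), ← add_mul,
            ← ENNReal.ofReal_add (by positivity) (by positivity)]
          congr 2
          rw [hC₂]
          ring
  calc ENNReal.ofReal H⁻¹ * sqInt μ (q₀ - q) = ENNReal.ofReal (K.heightC⁻¹ * (H ^ 2)⁻¹) *
        (ENNReal.ofReal (K.heightC * H) * sqInt μ (q₀ - q)) := by
        rw [← mul_assoc, ← ENNReal.ofReal_mul (by positivity)]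
        congr 2
        field_simp
    _ ≤ ENNReal.ofReal (K.heightC⁻¹ * (H ^ 2)⁻¹) * (ENNReal.ofReal (C₂ * H ^ (2 * k + 2)) * Φ) :=
        mul_le_mul_right h3 _
    _ = _ := by
        rw [← mul_assoc, ← ENNReal.ofReal_mul (by positivity)]
        congr 2
        field_simp
        ring

lemma diam_le_meshSize (hT : T ∈ M.elems) : Metric.diam T ≤ M.meshSize :=
  le_csSup ((M.elems.finite_toSet.image _).bddAbove) (mem_image_of_mem _ hT)

lemma meshSize_nonneg : 0 ≤ M.meshSize :=
  Real.sSup_nonneg (by rintro _ ⟨T, -, rfl⟩; exact Metric.diam_nonneg)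

lemma _root_.WGLS.MemSobolev.ofReal_sobolevNorm_sq {m : ℕ} {u : Pt (n + 1) → ℝ}
    (hu : MemSobolev Ω m u) : ENNReal.ofReal (sobolevNorm Ω m u ^ 2) =
      ∑ j ∈ Finset.range (m + 1), sobolevSq Ω j u Ω := by
  have h0 : ∀ α, 0 ≤ ∫ x in Ω, (weakDeriv Ω α u x) ^ 2 := fun α => integral_nonneg fun x => sq_nonneg _
  rw [sobolevNorm, Real.sq_sqrt (Finset.sum_nonneg fun j _ => Finset.sum_nonneg fun α _ => h0 α),
    ENNReal.ofReal_sum_of_nonneg fun j _ => Finset.sum_nonneg fun α _ => h0 α]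
  refine Finset.sum_congr rfl fun j hj => ?_
  rw [ENNReal.ofReal_sum_of_nonneg fun α _ => h0 α]
  refine Finset.sum_congr rfl fun α hα => ofReal_integral_sq (hu.weakDeriv_spec ?_).1
  have h1 : ∑ i, α i = j := by simpa using hα
  have := Finset.mem_range.1 hj
  omega

/-- The bound for the stabilizer of the projection of a Sobolev function. -/
lemma exists_sForm_Qh_le (hΩ : IsLipschitzDomain Ω) {k : ℕ} (hk : 1 ≤ k) (K : ShapeConstants) :
    ∃ C : ℝ, 0 < C ∧ ∀ M : Mesh Ω, M.ShapeRegular K → ∀ u : Pt (n + 1) → ℝ,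
      MemSobolev Ω (k + 1) u → M.sForm (M.Qh k u) (M.Qh k u) ≤
        C * (M.meshSize ^ k) ^ 2 * sobolevNorm Ω (k + 1) u ^ 2 := by
  -- Here `c` and `R` come from a single face, and `c'` below from summing over the overlapping
  -- neighbourhoods; the `+ 1` next to `K.cardC` keeps the product positive.
  obtain ⟨c, R, hc, hR, hloc⟩ := exists_local_stabilizer_le hΩ k K
  obtain ⟨c', hc', hsum⟩ := exists_sum_lintegral_le n K.volC_pos (by linarith : 0 < R)
  refine ⟨(K.cardC + 1) * c * c', by positivity, ?_⟩
  intro M hM u hu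
  set h := M.meshSize with hh
  have hh0 : 0 ≤ h := meshSize_nonneg
  choose! x hx using fun T (hT : T ∈ M.elems) => (M.elem_connected T hT).nonempty
  have hxT : ∀ T ∈ M.elems, x T ∈ T := fun T hT => interior_subset (hx T hT)
  set F : Pt (n + 1) → ℝ≥0∞ := fun y => ∑ j ∈ Finset.range (k + 2),
    ∑ α ∈ Finset.piAntidiag (Finset.univ : Finset (Fin (n + 1))) j, ‖weakDeriv Ω α u y‖ₑ ^ 2 with hF
  have hdm : ∀ j ∈ Finset.range (k + 2),
      ∀ α ∈ Finset.piAntidiag (Finset.univ : Finset (Fin (n + 1))) j,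
        AEMeasurable (fun y => ‖weakDeriv Ω α u y‖ₑ ^ 2) (volume.restrict Ω) := by
    intro j hj α hα
    have h1 : ∑ i, α i = j := by simpa using hα
    have := Finset.mem_range.1 hj
    exact (hu.weakDeriv_spec (α := α) (by omega)).1.aestronglyMeasurable.aemeasurable.enorm.pow_const 2
  have hFm : AEMeasurable F (volume.restrict Ω) :=
    Finset.aemeasurable_fun_sum _ fun j hj => Finset.aemeasurable_fun_sum _ fun α hα => hdm j hj α hα
  have hFint : ∀ D ⊆ Ω, ∫⁻ y in D, F y = ∑ j ∈ Finset.range (k + 2), sobolevSq Ω j u D := by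
    intro D hD
    have hDm := Measure.restrict_mono_set (volume : Measure (Pt (n + 1))) hD
    rw [lintegral_finsetSum']
    · refine Finset.sum_congr rfl fun j hj => ?_
      rw [lintegral_finsetSum']
      · rfl
      · exact fun α hα => (hdm j hj α hα).mono_measure hDm
    · exact fun j hj => Finset.aemeasurable_fun_sum _ fun α hα => (hdm j hj α hα).mono_measure hDm
  -- The interiors of the elements play the role of the disjoint fat sets: they have the same
  -- volumes as the elements.
  have hFsum := hsum M.elems interior x Metric.diam h (fun T _ => isOpen_interior.measurableSet)
    (fun T hT T' hT' hne => (M.elem_disjoint T hT T' hT' hne).aedisjoint)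
    (fun T hT => ⟨diam_elem_pos hT, diam_le_meshSize hT⟩)
    (fun T hT => interior_subset.trans (elem_subset_closedBall hT (hxT T hT)))
    (fun T hT => by
      rw [volume_interior_elem hT]
      exact ENNReal.ofReal_le_of_le_toReal (hM.vol_elem T hT)) Ω F hFm
  rw [hFint Ω le_rfl, ← hu.ofReal_sobolevNorm_sq] at hFsum
  have hcont : ∀ T ∈ M.elems, ∀ e ∈ M.facesOf T,
      MemLp ((M.Qh k u).v0 T - (M.Qh k u).vb e) 2 ((surface (n + 1)).restrict e) :=
    fun T hT e he => hM.memLp_face_of_continuous hT he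
      ((isPoly_Qh_v0 hΩ hu hT).1.sub (hM.isPoly_Qh_vb hΩ hu hT he).1).continuous
  have hs : ENNReal.ofReal (M.sForm (M.Qh k u) (M.Qh k u)) =
      ∑ T ∈ M.elems, ∑ e ∈ M.facesOf T, ENNReal.ofReal (Metric.diam T)⁻¹ *
        sqInt ((surface (n + 1)).restrict e) ((M.Qh k u).v0 T - (M.Qh k u).vb e) := by
    have h0 : ∀ (T e : Set (Pt (n + 1))), (∫ x in e, (Metric.diam T)⁻¹ *
        ((M.Qh k u).v0 T x - (M.Qh k u).vb e x) * ((M.Qh k u).v0 T x - (M.Qh k u).vb e x)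
          ∂(surface (n + 1))) = (Metric.diam T)⁻¹ *
          ∫ x in e, ((M.Qh k u).v0 T - (M.Qh k u).vb e) x ^ 2 ∂(surface (n + 1)) := by
      intro T e
      rw [← integral_const_mul]
      congr 1
      funext x
      simp only [Pi.sub_apply]
      ring
    have h1 : ∀ (T e : Set (Pt (n + 1))), 0 ≤ (Metric.diam T)⁻¹ *
        ∫ x in e, ((M.Qh k u).v0 T - (M.Qh k u).vb e) x ^ 2 ∂(surface (n + 1)) := fun T e =>
      mul_nonneg (inv_nonneg.2 Metric.diam_nonneg) (integral_nonneg fun x => sq_nonneg _)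
    rw [sForm]
    simp only [h0]
    rw [ENNReal.ofReal_sum_of_nonneg fun T _ => Finset.sum_nonneg fun e _ => h1 T e]
    refine Finset.sum_congr rfl fun T hT => ?_
    rw [ENNReal.ofReal_sum_of_nonneg fun e _ => h1 T e]
    refine Finset.sum_congr rfl fun e he => ?_
    rw [ENNReal.ofReal_mul (inv_nonneg.2 Metric.diam_nonneg), ofReal_integral_sq (hcont T hT e he)]
  have hfinal : ENNReal.ofReal (M.sForm (M.Qh k u) (M.Qh k u)) ≤ ENNReal.ofReal
      ((K.cardC + 1) * c * c' * (h ^ k) ^ 2 * sobolevNorm Ω (k + 1) u ^ 2) := by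
    rw [hs]
    calc _ ≤ ∑ T ∈ M.elems, ∑ _e ∈ M.facesOf T, ENNReal.ofReal (c * Metric.diam T ^ (2 * k)) *
          ∫⁻ y in Ω ∩ Metric.ball (x T) (R * Metric.diam T), F y := by
          refine Finset.sum_le_sum fun T hT => Finset.sum_le_sum fun e he => ?_
          rw [hFint _ inter_subset_left]
          exact hloc M hM u hu T hT (x T) (hxT T hT) e he
      -- Of `h_T ^ (2 * k)` one factor `h_T` is kept as the weight required by the overlap estimate;
      -- the other `2 * k - 1` are bounded by `h`.
      _ ≤ ∑ T ∈ M.elems, ENNReal.ofReal ((K.cardC + 1) * c * h ^ (2 * k - 1)) *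
          (ENNReal.ofReal (Metric.diam T) *
            ∫⁻ y in Ω ∩ Metric.ball (x T) (R * Metric.diam T), F y) := by
          refine Finset.sum_le_sum fun T hT => ?_
          rw [Finset.sum_const, nsmul_eq_mul, ← mul_assoc, ← mul_assoc]
          refine mul_le_mul_left ?_ _
          rw [← ENNReal.ofReal_natCast, ← ENNReal.ofReal_mul (by positivity),
            ← ENNReal.ofReal_mul (by positivity)]
          refine ENNReal.ofReal_le_ofReal ?_
          have hd := diam_elem_pos hT
          have hcard : ((M.facesOf T).card : ℝ) ≤ K.cardC + 1 := by
            have : ((M.facesOf T).card : ℝ) ≤ K.cardC := by exact_mod_cast hM.card_faces T hT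
            linarith
          have h2k : 2 * k = (2 * k - 1) + 1 := by omega
          calc ((M.facesOf T).card : ℝ) * (c * Metric.diam T ^ (2 * k))
              ≤ (K.cardC + 1) * (c * (h ^ (2 * k - 1) * Metric.diam T)) := by
                rw [h2k, pow_succ, ← h2k]
                gcongr
                exact diam_le_meshSize hT
            _ = _ := by ring
      _ = ENNReal.ofReal ((K.cardC + 1) * c * h ^ (2 * k - 1)) * ∑ T ∈ M.elems,
          ENNReal.ofReal (Metric.diam T) *
            ∫⁻ y in Ω ∩ Metric.ball (x T) (R * Metric.diam T), F y := by rw [Finset.mul_sum]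
      _ ≤ _ := mul_le_mul_right hFsum _
      _ = _ := by
          rw [← ENNReal.ofReal_mul (by positivity), ← ENNReal.ofReal_mul (by positivity)]
          congr 1
          have : (h ^ k) ^ 2 = h ^ (2 * k - 1) * h := by
            rw [← pow_mul, ← pow_succ]; congr 1; omega
          rw [this]
          ring
  exact (ENNReal.ofReal_le_ofReal_iff (by positivity)).1 hfinal

end Mesh

end Stabilizer

/-! ### The discrete weak gradient and the error equation -/

section WeakGradient

variable {n : ℕ} {Ω : Set (Pt (n + 1))}

lemma _root_.MeasureTheory.MemLp.integrable_fun_mul {X : Type*} [MeasurableSpace X]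
    {μ : Measure X} {f g : X → ℝ} (hf : MemLp f 2 μ) (hg : MemLp g 2 μ) :
    Integrable (fun x => f x * g x) μ :=
  hf.integrable_mul hg

lemma integral_inner_eq_sum {d : ℕ} {X : Type*} [MeasurableSpace X] {μ : Measure X}
    {q ψ : X → Pt d} (hq : ∀ i, MemLp (fun x => q x i) 2 μ) (hψ : ∀ i, MemLp (fun x => ψ x i) 2 μ) :
    ∫ x, ⟪q x, ψ x⟫_ℝ ∂μ = ∑ i, ∫ x, q x i * ψ x i ∂μ := by
  rw [← integral_finsetSum _ fun i _ => (hq i).integrable_fun_mul (hψ i)]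
  congr 1
  funext x
  simp [PiLp.inner_apply, mul_comm]

lemma pderiv_const_mul {d : ℕ} {i : Fin d} {φ : Pt d → ℝ} (h : Differentiable ℝ φ) (a : ℝ) :
    pderiv i (fun x => a * φ x) = fun x => a * pderiv i φ x := by
  funext x
  simp [pderiv, fderiv_const_mul (h x)]

lemma IsVecPoly.isPoly_divergence {d k : ℕ} {ψ : Pt d → Pt d} (hψ : IsVecPoly k ψ) :
    IsPoly k (divergence ψ) :=
  IsPoly.sum Finset.univ fun i _ => (hψ i).pderiv i

lemma IsVecPoly.isPoly_inner {d k : ℕ} {ψ : Pt d → Pt d} (hψ : IsVecPoly k ψ) (b : Pt d) :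
    IsPoly k (fun x => ⟪ψ x, b⟫_ℝ) := by
  have : (fun x => ⟪ψ x, b⟫_ℝ) = fun x => ∑ i, b i * ψ x i := by
    funext x; simp [PiLp.inner_apply]
  rw [this]
  exact IsPoly.sum Finset.univ fun i _ => (hψ i).const_mul (b i)

lemma IsVecPoly.sub {d k : ℕ} {ψ ψ' : Pt d → Pt d} (h : IsVecPoly k ψ) (h' : IsVecPoly k ψ') :
    IsVecPoly k (ψ - ψ') := fun i => (h i).sub (h' i)

/-- The projection is chosen from a predicate that sees `w` only through integrals, so almost equal
functions have literally the same projection. This yields pointwise vanishing of the error on inflow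
faces, where the representative need not be unique. -/
lemma l2Proj_congr {d k : ℕ} {μ : Measure (Pt d)} {w w' : Pt d → ℝ} (h : w =ᵐ[μ] w') :
    l2Proj μ k w = l2Proj μ k w' := by
  have : ∀ p : Pt d → ℝ, ∫ x, w x * p x ∂μ = ∫ x, w' x * p x ∂μ := fun p =>
    integral_congr_ae (h.mono fun x hx => by simp [hx])
  have key : ∀ P P' : (Pt d → ℝ) → Prop, P = P' → open Classical in
      (if h : ∃ q, P q then h.choose else 0) = if h : ∃ q, P' q then h.choose else 0 := by
    rintro P _ rfl
    rfl
  exact key _ _ (by funext q; simp only [this])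

namespace Mesh

variable {M : Mesh Ω} {T e : Set (Pt (n + 1))} {K : ShapeConstants} {k : ℕ} {v w : WeakFn (n + 1)}

lemma mem_facesOf_of_mem_faces (he : e ∈ M.faces) : ∃ T ∈ M.elems, e ∈ M.facesOf T := by
  obtain ⟨T, hT, h⟩ := M.face_of_elem e he
  exact ⟨T, hT, mem_facesOf.2 ⟨he, h⟩⟩

lemma sub_v0 (v w : WeakFn (n + 1)) (T : Set (Pt (n + 1))) : (v - w).v0 T = v.v0 T - w.v0 T := rfl

lemma sub_vb (v w : WeakFn (n + 1)) (e : Set (Pt (n + 1))) : (v - w).vb e = v.vb e - w.vb e := rfl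

lemma MemW.sub (hv : M.MemW k v) (hw : M.MemW k w) : M.MemW k (v - w) := by
  refine ⟨fun T hT => ?_, fun e he => ?_⟩
  · obtain ⟨p, hp, hvp⟩ := hv.1 T hT
    obtain ⟨q, hq, hwq⟩ := hw.1 T hT
    exact ⟨p - q, hp.sub hq, fun x hx => by simp [sub_v0, hvp hx, hwq hx]⟩
  · obtain ⟨p, hp, hvp⟩ := hv.2 e he
    obtain ⟨q, hq, hwq⟩ := hw.2 e he
    exact ⟨p - q, hp.sub hq, fun x hx => by simp [sub_vb, hvp hx, hwq hx]⟩

lemma MemW.memLp_v0 (hv : M.MemW k v) (hT : T ∈ M.elems) :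
    MemLp (v.v0 T) 2 (volume.restrict T) := by
  obtain ⟨p, hp, hvp⟩ := hv.1 T hT
  refine (memLp_congr_ae ?_).2 (memLp_elem_of_continuous hT hp.continuous)
  exact (ae_restrict_mem (isCompact_elem hT).measurableSet).mono hvp

namespace ShapeRegular

lemma memW_Qh (hM : M.ShapeRegular K) (hΩ : IsLipschitzDomain Ω) {m : ℕ} {u : Pt (n + 1) → ℝ}
    (hu : MemSobolev Ω (m + 1) u) : M.MemW k (M.Qh k u) := by
  refine ⟨fun T hT => ⟨_, (isPoly_Qh_v0 hΩ hu hT).1, fun _ _ => rfl⟩, fun e he => ?_⟩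
  obtain ⟨T, hT, he⟩ := mem_facesOf_of_mem_faces he
  exact ⟨_, (hM.isPoly_Qh_vb hΩ hu hT he).1, fun _ _ => rfl⟩

lemma memLp_vb (hM : M.ShapeRegular K) (hv : M.MemW k v) (hT : T ∈ M.elems)
    (he : e ∈ M.facesOf T) : MemLp (v.vb e) 2 ((surface (n + 1)).restrict e) := by
  obtain ⟨p, hp, hvp⟩ := hv.2 e (mem_facesOf.1 he).1
  refine (memLp_congr_ae ?_).2 (hM.memLp_face_of_continuous hT he hp.continuous)
  exact (ae_restrict_mem (isCompact_face he).measurableSet).mono hvp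

lemma memLp_v0_face (hM : M.ShapeRegular K) (hv : M.MemW k v) (hT : T ∈ M.elems)
    (he : e ∈ M.facesOf T) : MemLp (v.v0 T) 2 ((surface (n + 1)).restrict e) := by
  obtain ⟨p, hp, hvp⟩ := hv.1 T hT
  refine (memLp_congr_ae ?_).2 (hM.memLp_face_of_continuous hT he hp.continuous)
  exact (ae_restrict_mem (isCompact_face he).measurableSet).mono fun x hx =>
    hvp (face_subset_elem hT he hx)

/-- The discrete weak gradient of a function in `W_h` exists. -/
lemma isWeakGrad_weakGrad (hM : M.ShapeRegular K) (hv : M.MemW k v) (hT : T ∈ M.elems) :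
    M.IsWeakGrad k v T (M.weakGrad k v T) := by
  have hpT : ∀ p : Pt (n + 1) → ℝ, IsPoly k p → MemLp p 2 (volume.restrict T) := fun _ hp =>
    memLp_elem_of_continuous hT hp.continuous
  have hpe : ∀ e ∈ M.facesOf T, ∀ p : Pt (n + 1) → ℝ, IsPoly k p →
      MemLp p 2 ((surface (n + 1)).restrict e) := fun e he _ hp =>
    hM.memLp_face_of_continuous hT he hp.continuous
  have hv0 := hv.memLp_v0 hT
  have hvb := fun e he => hM.memLp_vb hv hT (e := e) he
  have hex : ∃ q, M.IsWeakGrad k v T q := by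
    let L : Fin (n + 1) → polySpace (n + 1) k →ₗ[ℝ] ℝ := fun i =>
      { toFun := fun p => -(∫ x in T, v.v0 T x * pderiv i p x) + ∑ e ∈ M.facesOf T,
          M.normal T e i * ∫ x in e, v.vb e x * (p : Pt (n + 1) → ℝ) x ∂(surface (n + 1))
        map_add' := fun p q => by
          have h1 : ∫ x in T, v.v0 T x * pderiv i (p + q : polySpace (n + 1) k) x =
              (∫ x in T, v.v0 T x * pderiv i p x) + ∫ x in T, v.v0 T x * pderiv i q x := by
            rw [← integral_add (hv0.integrable_fun_mul (hpT _ (p.2.pderiv i)))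
              (hv0.integrable_fun_mul (hpT _ (q.2.pderiv i))), Submodule.coe_add,
              pderiv_add (p.2.contDiff.differentiable (by simp))
                (q.2.contDiff.differentiable (by simp))]
            simp only [Pi.add_apply, mul_add]
          have h2 : ∀ e ∈ M.facesOf T, M.normal T e i *
              ∫ x in e, v.vb e x * ((p + q : polySpace (n + 1) k) : Pt (n + 1) → ℝ) x
                ∂(surface (n + 1)) =
              M.normal T e i * (∫ x in e, v.vb e x * (p : Pt (n + 1) → ℝ) x ∂(surface (n + 1))) +
              M.normal T e i * ∫ x in e, v.vb e x * (q : Pt (n + 1) → ℝ) x ∂(surface (n + 1)) := by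
            intro e he
            rw [← mul_add, ← integral_add ((hvb e he).integrable_fun_mul (hpe e he _ p.2))
              ((hvb e he).integrable_fun_mul (hpe e he _ q.2))]
            simp only [Submodule.coe_add, Pi.add_apply, mul_add]
          rw [h1, Finset.sum_congr rfl h2, Finset.sum_add_distrib]
          ring
        map_smul' := fun a p => by
          have h1 : ∫ x in T, v.v0 T x * pderiv i (a • p : polySpace (n + 1) k) x =
              a * ∫ x in T, v.v0 T x * pderiv i p x := by
            have h3 : pderiv i ((a • p : polySpace (n + 1) k) : Pt (n + 1) → ℝ) =
                fun x => a * pderiv i p x :=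
              pderiv_const_mul (p.2.contDiff.differentiable (by simp)) a
            rw [← integral_const_mul, h3]
            simp only [mul_left_comm]
          have h2 : ∀ e ∈ M.facesOf T, M.normal T e i *
              ∫ x in e, v.vb e x * ((a • p : polySpace (n + 1) k) : Pt (n + 1) → ℝ) x
                ∂(surface (n + 1)) = a * (M.normal T e i *
                  ∫ x in e, v.vb e x * (p : Pt (n + 1) → ℝ) x ∂(surface (n + 1))) := by
            intro e he
            rw [mul_left_comm a, ← integral_const_mul a]
            congr 2
            funext x
            simp only [Submodule.coe_smul, Pi.smul_apply, smul_eq_mul]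
            ring
          rw [h1, Finset.sum_congr rfl h2, ← Finset.mul_sum, RingHom.id_apply, smul_eq_mul]
          ring }
    have hL : ∀ i, ∃ q : Pt (n + 1) → ℝ, IsPoly k q ∧ ∀ p : polySpace (n + 1) k,
        ∫ x in T, q x * (p : Pt (n + 1) → ℝ) x = L i p := by
      intro i
      refine exists_isPoly_represent hpT (L i) fun p hp => ?_
      -- On an element, which has positive volume, only the zero polynomial vanishes almost
      -- everywhere, so the compatibility condition holds.
      have hp0 : p = 0 := by
        by_contra hne
        have hne' : (p : Pt (n + 1) → ℝ) ≠ 0 := fun h => hne (Subtype.ext h)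
        have h1 : volume.restrict T {x | (p : Pt (n + 1) → ℝ) x = 0} = 0 :=
          Measure.absolutelyContinuous_of_le Measure.restrict_le_self (p.2.volume_zeros hne')
        have h2 : volume.restrict T univ = 0 := by
          refine measure_mono_null (fun x _ => ?_) (measure_union_null h1 (ae_iff.1 hp))
          by_cases h : (p : Pt (n + 1) → ℝ) x = 0
          · exact Or.inl h
          · exact Or.inr h
        rw [Measure.restrict_apply_univ] at h2
        exact (volume_elem_pos hT).ne' h2
      rw [hp0, map_zero]
    choose q hq hqL using hL
    refine ⟨fun x => WithLp.toLp 2 fun i => q i x, fun i => hq i, fun ψ hψ => ?_⟩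
    rw [integral_inner_eq_sum (fun i => hpT _ (hq i)) (fun i => hpT _ (hψ i))]
    have h1 : ∀ i, ∫ x in T, q i x * ψ x i = L i ⟨fun x => ψ x i, hψ i⟩ := fun i =>
      hqL i ⟨fun x => ψ x i, hψ i⟩
    have h2 : ∫ x in T, v.v0 T x * divergence ψ x =
        ∑ i, ∫ x in T, v.v0 T x * pderiv i (fun y => ψ y i) x := by
      rw [← integral_finsetSum _ fun i _ => hv0.integrable_fun_mul (hpT _ ((hψ i).pderiv i))]
      simp only [divergence, Finset.mul_sum]
    have h3 : ∀ e ∈ M.facesOf T, ∫ x in e, v.vb e x * ⟪ψ x, M.normal T e⟫_ℝ ∂(surface (n + 1)) =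
        ∑ i, M.normal T e i * ∫ x in e, v.vb e x * ψ x i ∂(surface (n + 1)) := by
      intro e he
      simp only [← integral_const_mul]
      rw [← integral_finsetSum _ fun i _ => ((hvb e he).integrable_fun_mul (hpe e he _ (hψ i))).const_mul _]
      congr 1
      funext x
      simp [PiLp.inner_apply, Finset.mul_sum, mul_left_comm]
    calc ∑ i, ∫ x in T, q i x * ψ x i = ∑ i, (-(∫ x in T, v.v0 T x * pderiv i (fun y => ψ y i) x) +
          ∑ e ∈ M.facesOf T, M.normal T e i * ∫ x in e, v.vb e x * ψ x i ∂(surface (n + 1))) :=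
          Finset.sum_congr rfl fun i _ => h1 i
      _ = _ := by
          rw [Finset.sum_add_distrib, Finset.sum_neg_distrib, h2, Finset.sum_comm,
            Finset.sum_congr rfl h3]
  rw [weakGrad, dif_pos hex]
  exact hex.choose_spec

/-- The discrete weak gradient is additive. -/
lemma weakGrad_sub_ae (hM : M.ShapeRegular K) (hv : M.MemW k v) (hw : M.MemW k w)
    (hT : T ∈ M.elems) : M.weakGrad k (v - w) T =ᵐ[volume.restrict T]
      M.weakGrad k v T - M.weakGrad k w T := by
  obtain ⟨hgv, hv'⟩ := hM.isWeakGrad_weakGrad hv hT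
  obtain ⟨hgw, hw'⟩ := hM.isWeakGrad_weakGrad hw hT
  obtain ⟨hgd, hd'⟩ := hM.isWeakGrad_weakGrad (hv.sub hw) hT
  set gv := M.weakGrad k v T
  set gw := M.weakGrad k w T
  set gd := M.weakGrad k (v - w) T
  have hpT : ∀ p : Pt (n + 1) → ℝ, IsPoly k p → MemLp p 2 (volume.restrict T) := fun _ hp =>
    memLp_elem_of_continuous hT hp.continuous
  have hint : ∀ q ψ : Pt (n + 1) → Pt (n + 1), IsVecPoly k q → IsVecPoly k ψ →
      Integrable (fun x => ⟪q x, ψ x⟫_ℝ) (volume.restrict T) := by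
    intro q ψ hq hψ
    have : (fun x => ⟪q x, ψ x⟫_ℝ) = fun x => ∑ i, q x i * ψ x i := by
      funext x; simp [PiLp.inner_apply, mul_comm]
    rw [this]
    exact integrable_finsetSum _ fun i _ => (hpT _ (hq i)).integrable_fun_mul (hpT _ (hψ i))
  have h0 : ∀ ψ : Pt (n + 1) → Pt (n + 1), IsVecPoly k ψ →
      ∫ x in T, ⟪gd x, ψ x⟫_ℝ = (∫ x in T, ⟪gv x, ψ x⟫_ℝ) - ∫ x in T, ⟪gw x, ψ x⟫_ℝ := by
    intro ψ hψ
    have hdivp := hpT _ hψ.isPoly_divergence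
    have h1 : ∫ x in T, (v - w).v0 T x * divergence ψ x = (∫ x in T, v.v0 T x * divergence ψ x) -
        ∫ x in T, w.v0 T x * divergence ψ x := by
      rw [← integral_sub ((hv.memLp_v0 hT).integrable_fun_mul hdivp)
        ((hw.memLp_v0 hT).integrable_fun_mul hdivp)]
      simp only [sub_v0, Pi.sub_apply, sub_mul]
    have h2 : ∀ e ∈ M.facesOf T,
        ∫ x in e, (v - w).vb e x * ⟪ψ x, M.normal T e⟫_ℝ ∂(surface (n + 1)) =
        (∫ x in e, v.vb e x * ⟪ψ x, M.normal T e⟫_ℝ ∂(surface (n + 1))) -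
        ∫ x in e, w.vb e x * ⟪ψ x, M.normal T e⟫_ℝ ∂(surface (n + 1)) := by
      intro e he
      have hψe := hM.memLp_face_of_continuous hT he (hψ.isPoly_inner (M.normal T e)).continuous
      rw [← integral_sub ((hM.memLp_vb hv hT he).integrable_fun_mul hψe)
        ((hM.memLp_vb hw hT he).integrable_fun_mul hψe)]
      simp only [sub_vb, Pi.sub_apply, sub_mul]
    rw [hd' ψ hψ, hv' ψ hψ, hw' ψ hψ, h1, Finset.sum_congr rfl h2, Finset.sum_sub_distrib]
    ring
  -- The difference of the gradients is itself an admissible test field, and it is orthogonal to all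
  -- such fields, hence to itself.
  have hδ : IsVecPoly k (gd - (gv - gw)) := hgd.sub (hgv.sub hgw)
  have h1 : ∫ x in T, ⟪(gd - (gv - gw)) x, (gd - (gv - gw)) x⟫_ℝ = 0 := by
    have h2 := h0 _ hδ
    have h3 : Integrable (fun x => ⟪gv x, (gd - (gv - gw)) x⟫_ℝ - ⟪gw x, (gd - (gv - gw)) x⟫_ℝ)
        (volume.restrict T) := (hint _ _ hgv hδ).sub (hint _ _ hgw hδ)
    rw [← sub_eq_zero, ← integral_sub (hint _ _ hgv hδ) (hint _ _ hgw hδ),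
      ← integral_sub (hint _ _ hgd hδ) h3] at h2
    rw [← h2]
    congr 1
    funext x
    simp only [Pi.sub_apply, inner_sub_left]
  rw [integral_eq_zero_iff_of_nonneg (fun x => real_inner_self_nonneg) (hint _ _ hδ hδ)] at h1
  refine h1.mono fun x hx => ?_
  have : (gd - (gv - gw)) x = 0 := inner_self_eq_zero.1 hx
  exact sub_eq_zero.1 this

/-- The discrete weak gradient of the projection is the projection of the gradient. -/
lemma integral_weakGrad_Qh (hM : M.ShapeRegular K) (hΩ : IsLipschitzDomain Ω) {m : ℕ}
    {u : Pt (n + 1) → ℝ} (hu : MemSobolev Ω (m + 1) u) (hT : T ∈ M.elems)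
    {ψ : Pt (n + 1) → Pt (n + 1)} (hψ : IsVecPoly k ψ) :
    ∫ x in T, ⟪M.weakGrad k (M.Qh k u) T x, ψ x⟫_ℝ = ∫ x in T, ⟪gradient Ω u x, ψ x⟫_ℝ := by
  have hle := restrict_elem_le hΩ hT
  have hpT : ∀ p : Pt (n + 1) → ℝ, IsPoly k p → MemLp p 2 (volume.restrict T) := fun _ hp =>
    memLp_elem_of_continuous hT hp.continuous
  have huT := hu.1.mono_measure hle
  have hd : ∀ i, MemLp (fun x => gradient Ω u x i) 2 (volume.restrict T) := fun i =>
    (hu.weakDeriv_spec (α := Pi.single i 1) (by simp)).1.mono_measure hle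
  -- The divergence and the normal component of `ψ` are polynomials of degree at most `k`, so `Q₀`
  -- and `Q_b` can be removed; what remains is integration by parts for `u`.
  rw [(hM.isWeakGrad_weakGrad (hM.memW_Qh hΩ hu) hT).2 ψ hψ,
    integral_inner_eq_sum hd (fun i => hpT _ (hψ i)), (isPoly_Qh_v0 hΩ hu hT).2 _
      hψ.isPoly_divergence]
  have h2 : ∫ x in T, u x * divergence ψ x =
      ∑ i, ∫ x in T, u x * pderiv i (fun y => ψ y i) x := by
    rw [← integral_finsetSum _ fun i _ => huT.integrable_fun_mul (hpT _ ((hψ i).pderiv i))]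
    simp only [divergence, Finset.mul_sum]
  have h3 : ∀ e ∈ M.facesOf T,
      ∫ x in e, (M.Qh k u).vb e x * ⟪ψ x, M.normal T e⟫_ℝ ∂(surface (n + 1)) =
        ∑ i, M.normal T e i * ∫ x in e, trace Ω u e x * ψ x i ∂(surface (n + 1)) := by
    intro e he
    rw [(hM.isPoly_Qh_vb hΩ hu hT he).2 _ (hψ.isPoly_inner _)]
    simp only [← integral_const_mul]
    rw [← integral_finsetSum _ fun i _ => ((hM.isTrace_trace hΩ hT he hu).1.integrable_fun_mul
      (hM.memLp_face_of_continuous hT he (hψ i).continuous)).const_mul _]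
    congr 1
    funext x
    simp [PiLp.inner_apply, Finset.mul_sum, mul_left_comm]
  have h4 : ∀ i, ∫ x in T, gradient Ω u x i * ψ x i =
      -(∫ x in T, u x * pderiv i (fun y => ψ y i) x) + ∑ e ∈ M.facesOf T, M.normal T e i *
        ∫ x in e, trace Ω u e x * ψ x i ∂(surface (n + 1)) := fun i =>
    hM.integral_weakDeriv_mul hΩ hT hu (hψ i).contDiff i
  rw [h2, Finset.sum_congr rfl h3, Finset.sum_congr rfl fun i _ => h4 i, Finset.sum_add_distrib,
    Finset.sum_neg_distrib, Finset.sum_comm]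

variable {β : Pt (n + 1) → Pt (n + 1)} {c f g u : Pt (n + 1) → ℝ}

/-- For piecewise constant coefficients the residual is a polynomial on each element. -/
lemma exists_isPoly_residual (hM : M.ShapeRegular K) (hβ : M.PiecewiseConst β)
    (hc : M.PiecewiseConst c) (hv : M.MemW k v) (hT : T ∈ M.elems) :
    ∃ r, IsPoly k r ∧ M.residual k β c v T =ᵐ[volume.restrict T] r := by
  obtain ⟨b, hb⟩ := hβ T hT
  obtain ⟨a, ha⟩ := hc T hT
  obtain ⟨p, hp, hvp⟩ := hv.1 T hT
  refine ⟨fun x => ⟪M.weakGrad k v T x, b⟫_ℝ + a * p x,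
    ((hM.isWeakGrad_weakGrad hv hT).1.isPoly_inner b).add (hp.const_mul a), ?_⟩
  rw [restrict_elem_eq hT]
  filter_upwards [ae_restrict_mem isOpen_interior.measurableSet] with x hx
  rw [residual, hb x hx, ha x hx, hvp (interior_subset hx), real_inner_comm]

lemma memLp_residual (hM : M.ShapeRegular K) (hβ : M.PiecewiseConst β)
    (hc : M.PiecewiseConst c) (hv : M.MemW k v) (hT : T ∈ M.elems) :
    MemLp (M.residual k β c v T) 2 (volume.restrict T) := by
  obtain ⟨r, hr, hvr⟩ := hM.exists_isPoly_residual hβ hc hv hT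
  exact (memLp_congr_ae hvr).2 (memLp_elem_of_continuous hT hr.continuous)

/-- Consistency: the projection of the exact solution satisfies the least-squares equations. -/
lemma integral_residual_Qh (hM : M.ShapeRegular K) (hΩ : IsLipschitzDomain Ω) {m : ℕ}
    (hβ : M.PiecewiseConst β) (hc : M.PiecewiseConst c)
    (hu : M.IsExactSolution (m + 1) β c f g u) (hv : M.MemW k v) (hT : T ∈ M.elems) :
    ∫ x in T, M.residual k β c (M.Qh k u) T x * M.residual k β c v T x =
      ∫ x in T, f x * M.residual k β c v T x := by
  have hle := restrict_elem_le hΩ hT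
  have huS := hu.memSobolev
  obtain ⟨r, hr, hvr⟩ := hM.exists_isPoly_residual hβ hc hv hT
  obtain ⟨b, hb⟩ := hβ T hT
  obtain ⟨a, ha⟩ := hc T hT
  have hint : ∀ᵐ x ∂(volume.restrict T), x ∈ interior T := by
    rw [restrict_elem_eq hT]
    exact ae_restrict_mem isOpen_interior.measurableSet
  -- With `b` the constant value of `β`, pairing `β · ∇_w` with the polynomial residual `r` amounts
  -- to testing with the field `r b`; the reaction term is tested with `r` itself.
  have hψ : IsVecPoly k (fun x => r x • b) := fun i => by
    have := hr.const_mul (b i)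
    simpa [mul_comm] using this
  have hpT : ∀ p : Pt (n + 1) → ℝ, IsPoly k p → MemLp p 2 (volume.restrict T) := fun _ hp =>
    memLp_elem_of_continuous hT hp.continuous
  have hgT : ∀ q : Pt (n + 1) → Pt (n + 1), (∀ i, MemLp (fun x => q x i) 2 (volume.restrict T)) →
      Integrable (fun x => ⟪q x, r x • b⟫_ℝ) (volume.restrict T) := by
    intro q hq
    have : (fun x => ⟪q x, r x • b⟫_ℝ) = fun x => ∑ i, q x i * (r x • b) i := by
      funext x; simp [PiLp.inner_apply, mul_comm]
    rw [this]
    exact integrable_finsetSum _ fun i _ => (hq i).integrable_fun_mul (hpT _ (hψ i))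
  have hQ := isPoly_Qh_v0 (M := M) (k := k) hΩ huS hT
  have i1 := hgT (M.weakGrad k (M.Qh k u) T) fun i =>
    hpT _ ((hM.isWeakGrad_weakGrad (hM.memW_Qh hΩ huS) hT).1 i)
  have i2 := hgT (gradient Ω u) fun i =>
    (huS.weakDeriv_spec (α := Pi.single i 1) (by simp)).1.mono_measure hle
  have i3 : Integrable (fun x => a * ((M.Qh k u).v0 T x * r x)) (volume.restrict T) :=
    ((hpT _ hQ.1).integrable_fun_mul (hpT _ hr)).const_mul a
  have i4 : Integrable (fun x => a * (u x * r x)) (volume.restrict T) :=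
    ((huS.1.mono_measure hle).integrable_fun_mul (hpT _ hr)).const_mul a
  calc ∫ x in T, M.residual k β c (M.Qh k u) T x * M.residual k β c v T x
      = ∫ x in T, (⟪M.weakGrad k (M.Qh k u) T x, r x • b⟫_ℝ + a * ((M.Qh k u).v0 T x * r x)) := by
        refine integral_congr_ae ?_
        filter_upwards [hvr, hint] with x hx hxi
        rw [hx, residual, hb x hxi, ha x hxi, inner_smul_right, real_inner_comm]
        ring
    _ = ∫ x in T, (⟪gradient Ω u x, r x • b⟫_ℝ + a * (u x * r x)) := by
        rw [integral_add i1 i3, integral_add i2 i4, hM.integral_weakGrad_Qh hΩ huS hT hψ,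
          integral_const_mul, integral_const_mul, hQ.2 r hr]
    _ = ∫ x in T, f x * M.residual k β c v T x := by
        refine integral_congr_ae ?_
        filter_upwards [hvr, hint, hu.equation.filter_mono (ae_mono hle)] with x hx hxi hxe
        rw [hx, ← hxe, hb x hxi, ha x hxi, inner_smul_right, real_inner_comm]
        ring

/-- The error in the energy norm is bounded by the stabilizer of the projection. -/
lemma aForm_error_le (hM : M.ShapeRegular K) (hΩ : IsLipschitzDomain Ω) {m : ℕ}
    {uh : WeakFn (n + 1)} (hβ : M.PiecewiseConst β) (hc : M.PiecewiseConst c)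
    (hu : M.IsExactSolution (m + 1) β c f g u) (huh : M.IsDiscreteSolution k β c f g uh) :
    4 * M.aForm k β c (uh - M.Qh k u) (uh - M.Qh k u) ≤ M.sForm (M.Qh k u) (M.Qh k u) := by
  have hQ : M.MemW k (M.Qh k u) := hM.memW_Qh hΩ hu.memSobolev
  set q := M.Qh k u with hq
  have hE : M.MemW k (uh - q) := huh.memW.sub hQ
  -- On inflow faces `u_h` carries the projection of `g` and `q` that of the trace of `u`, and these
  -- data agree almost everywhere.
  have hE0 : M.MemW0 k β (uh - q) := by
    refine ⟨hE, fun e he x hx => ?_⟩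
    rw [sub_vb, Pi.sub_apply, huh.boundary e he hx, sub_eq_zero, ← l2Proj_congr (hu.boundary e he)]
    rfl
  have heq := huh.equation _ hE0
  -- By linearity of the residual and consistency, `a(q, e)` is replaced by the load functional.
  -- With the scheme this becomes `a(e, e) = -s(u_h, e)`.
  have ha : M.aForm k β c (uh - q) (uh - q) = M.aForm k β c uh (uh - q) -
      ∑ T ∈ M.elems, ∫ x in T, f x * M.residual k β c (uh - q) T x := by
    rw [aForm, aForm, ← Finset.sum_sub_distrib]
    refine Finset.sum_congr rfl fun T hT => ?_
    rw [← hM.integral_residual_Qh hΩ hβ hc hu hE hT, ← integral_sub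
      ((hM.memLp_residual hβ hc huh.memW hT).integrable_fun_mul (hM.memLp_residual hβ hc hE hT))
      ((hM.memLp_residual hβ hc hQ hT).integrable_fun_mul (hM.memLp_residual hβ hc hE hT))]
    refine integral_congr_ae ?_
    filter_upwards [hM.weakGrad_sub_ae huh.memW hQ hT] with x hx
    have h1 : M.residual k β c (uh - q) T x =
        M.residual k β c uh T x - M.residual k β c q T x := by
      simp only [residual, hx, Pi.sub_apply, inner_sub_right, sub_v0]
      ring
    rw [← sub_mul, ← h1]
  -- With jumps `U` and `Q` of `u_h` and `q`, this is `-4 U (U - Q) ≤ Q²`, that is `0 ≤ (2 U - Q)²`,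
  -- on every face.
  have hs : -(4 * M.sForm uh (uh - q)) ≤ M.sForm q q := by
    rw [sForm, sForm, Finset.mul_sum, ← Finset.sum_neg_distrib]
    refine Finset.sum_le_sum fun T hT => ?_
    rw [Finset.mul_sum, ← Finset.sum_neg_distrib]
    refine Finset.sum_le_sum fun e he => ?_
    have hj : ∀ {v : WeakFn (n + 1)}, M.MemW k v → MemLp (fun x => v.v0 T x - v.vb e x) 2
        ((surface (n + 1)).restrict e) := fun hv =>
      (hM.memLp_v0_face hv hT he).sub (hM.memLp_vb hv hT he)
    have hji : ∀ {v w : WeakFn (n + 1)}, M.MemW k v → M.MemW k w → Integrable (fun x =>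
        (Metric.diam T)⁻¹ * (v.v0 T x - v.vb e x) * (w.v0 T x - w.vb e x))
        ((surface (n + 1)).restrict e) := by
      intro v w hv hw
      simp only [mul_assoc]
      exact ((hj hv).integrable_fun_mul (hj hw)).const_mul _
    rw [← integral_const_mul, ← integral_neg]
    refine integral_mono ((hji huh.memW hE).const_mul 4).neg (hji hQ hQ) fun x => ?_
    have hH : 0 ≤ (Metric.diam T)⁻¹ := inv_nonneg.2 Metric.diam_nonneg
    simp only [sub_v0, sub_vb, Pi.sub_apply]
    nlinarith [mul_nonneg hH (sq_nonneg (2 * (uh.v0 T x - uh.vb e x) - (q.v0 T x - q.vb e x)))]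
  rw [ha]
  linarith

end ShapeRegular

end Mesh

end WeakGradient

end WGLS

end

/-! ### The error estimate -/

theorem lemma6p2 (d : ℕ) (hd : d = 2 ∨ d = 3) (Ω : Set (WGLS.Pt d))
    (hΩ : WGLS.IsLipschitzDomain Ω) (k : ℕ) (hk : 1 ≤ k) (K : WGLS.ShapeConstants) :
    ∃ C : ℝ, 0 < C ∧ ∀ M : WGLS.Mesh Ω, M.ShapeRegular K →
      ∀ (β : WGLS.Pt d → WGLS.Pt d) (c f g u : WGLS.Pt d → ℝ) (uh : WGLS.WeakFn d),
        M.PiecewiseConst β → M.PiecewiseConst c →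
        MemLp f 2 (volume.restrict Ω) →
        MemLp g 2 ((WGLS.surface d).restrict (M.inflowBoundary β)) →
        M.IsExactSolution (k + 1) β c f g u →
        M.IsDiscreteSolution k β c f g uh →
        M.energyNorm k β c (uh - M.Qh k u) ≤
          C * M.meshSize ^ k * WGLS.sobolevNorm Ω (k + 1) u := by
  obtain ⟨n, rfl⟩ : ∃ n, d = n + 1 := ⟨d - 1, by omega⟩
  obtain ⟨C, hC, hbound⟩ := WGLS.Mesh.exists_sForm_Qh_le hΩ hk K
  -- The stabilizer bound concerns the squared norm, so its root is taken; the gain of the factor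
  -- four from `aForm_error_le` is discarded.
  refine ⟨√C, Real.sqrt_pos.2 hC, ?_⟩
  intro M hM β c f g u uh hβ hc _ _ hu huh
  have h1 := hM.aForm_error_le hΩ hβ hc hu huh
  have h2 := hbound M hM u hu.memSobolev
  have h3 : 0 ≤ WGLS.sobolevNorm Ω (k + 1) u := Real.sqrt_nonneg _
  have h4 : 0 ≤ M.meshSize := WGLS.Mesh.meshSize_nonneg
  refine Real.sqrt_le_iff.2 ⟨by positivity, ?_⟩
  rw [mul_pow, mul_pow, Real.sq_sqrt hC.le]
  have h5 : 0 ≤ C * (M.meshSize ^ k) ^ 2 * WGLS.sobolevNorm Ω (k + 1) u ^ 2 := by positivity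
  linarith
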